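/- Work over $\mathbb{C}$; a variety is an irreducible Zariski closed set. A trilinear rational map $\phi:(\mathbb{P}^1_{\mathbb{C}})^3\dashrightarrow\mathbb{P}^3_{\mathbb{C}}$ is given by four trilinear forms $f_0,\dots,f_3$ in $(s_0,s_1),(t_0,t_1),(u_0,u_1)$ without a common factor, and so is a point of the projective space $\mathbb{P}^{31}_{\mathbb{C}}$ of their coefficients. It is birational of type $(2,2,2)$ if it has an inverse rational map $(\sigma_0:\sigma_1)\times(\tau_0:\tau_1)\times(\upsilon_0:\upsilon_1)$ in which each of the three pairs consists of quadratic forms without a common factor. Let $\mathrm{Bir}_{(2,2,2)}\subset\mathbb{P}^{31}_{\mathbb{C}}$ be the set of these maps. An $s$-line of $\phi$ is a line obtained as the image of $\phi$ for fixed $(t_0:t_1)$ and $(u_0:u_1)$, and $S$ is the Zariski closure, in the Klein quadric of lines in $\mathbb{P}^3_{\mathbb{C}}$ (inside $\mathbb{P}^5_{\mathbb{C}}$), of the set of $s$-lines; $T$ and $U$ are defined in the same way by the $t$-lines and $u$-lines. A line congruence is a surface (a two-dimensional variety) contained in the Klein quadric. A variety $V\subset\mathbb{P}^3_{\mathbb{C}}$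 is focal for a set $X$ of lines if it meets every line of $X$ and no variety properly contained in $V$ does; a focal curve is a one-dimensional focal variety. A line congruence is quadratic if it has a focal line and a focal smooth plane conic that meet. Proposition. The set $\mathrm{Bir}_{(2,2,2)}$ is not empty, and it has a dense, relatively Zariski open subset such that for every $\phi$ in this subset there are pairwise distinct lines $x,y,z\subset\mathbb{P}^3_{\mathbb{C}}$ and a smooth plane conic $c\subset\mathbb{P}^3_{\mathbb{C}}$ with the following properties: 1. $x\cap y\cap z$ is a single point; 2. each of $x\cap c$, $y\cap c$, $z\cap c$ is a single point; 3. the focal curves of $S$ are exactly $x$ and $c$, those of $T$ are exactly $y$ and $c$, and those of $U$ are exactly $z$ and $c$; 4. $S$, $T$ and $U$ are quadratic line congruences (in particular, surfaces). -/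

import Mathlib

open MvPolynomial Topology

noncomputable section

namespace LineCongruence

/-- The projective space `ℙ(ℂ^ι)` with homogeneous coordinates indexed by `ι`. -/
def PSpace (ι : Type) : Type := Projectivization ℂ (ι → ℂ)

namespace PSpace

/-- The point `(v i)_i` given by a nonzero coordinate vector. -/
def mk {ι : Type} (v : ι → ℂ) (hv : v ≠ 0) : PSpace ι := Projectivization.mk ℂ v hv

/-- A representative of the homogeneous coordinates of a point. -/
def rep {ι : Type} (p : PSpace ι) : ι → ℂ := Projectivization.rep p

/-- The common zeros in projective space of a set of (homogeneous) polynomials. -/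
def zeroLocus {ι : Type} (F : Set (MvPolynomial ι ℂ)) : Set (PSpace ι) :=
  {p | ∀ f ∈ F, eval p.rep f = 0}

/-- Projective algebraic sets: the zero loci of sets of homogeneous polynomials. -/
def IsAlgebraic {ι : Type} (Z : Set (PSpace ι)) : Prop :=
  ∃ F : Set (MvPolynomial ι ℂ), (∀ f ∈ F, ∃ d : ℕ, f.IsHomogeneous d) ∧ Z = zeroLocus F

theorem isAlgebraic_empty {ι : Type} : IsAlgebraic (∅ : Set (PSpace ι)) := by
  refine ⟨{1}, ?_, ?_⟩
  · rintro f rfl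
    exact ⟨0, isHomogeneous_one _ _⟩
  · ext p
    simp [zeroLocus]

theorem isAlgebraic_sInter {ι : Type} (A : Set (Set (PSpace ι)))
    (hA : ∀ Z ∈ A, IsAlgebraic Z) : IsAlgebraic (⋂₀ A) := by
  choose! F hF hZ using hA
  refine ⟨⋃ Z ∈ A, F Z, ?_, ?_⟩
  · intro f hf
    simp only [Set.mem_iUnion] at hf
    obtain ⟨Z, hZA, hf⟩ := hf
    exact hF Z hZA f hf
  · ext p
    constructor
    · intro hp f hf
      simp only [Set.mem_iUnion] at hf
      obtain ⟨Z, hZA, hf⟩ := hf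
      have h := hp Z hZA
      rw [hZ Z hZA] at h
      exact h f hf
    · intro hp Z hZA
      rw [hZ Z hZA]
      intro f hf
      exact hp f (Set.mem_biUnion hZA hf)

theorem isAlgebraic_union {ι : Type} (Y : Set (PSpace ι)) (hY : IsAlgebraic Y)
    (Z : Set (PSpace ι)) (hZ : IsAlgebraic Z) : IsAlgebraic (Y ∪ Z) := by
  obtain ⟨F, hF, rfl⟩ := hY
  obtain ⟨G, hG, rfl⟩ := hZ
  refine ⟨{h | ∃ f ∈ F, ∃ g ∈ G, h = f * g}, ?_, ?_⟩
  · rintro h ⟨f, hf, g, hg, rfl⟩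
    obtain ⟨d, hd⟩ := hF f hf
    obtain ⟨e, he⟩ := hG g hg
    exact ⟨d + e, hd.mul he⟩
  · ext p
    constructor
    · rintro (hp | hp) h ⟨f, hf, g, hg, rfl⟩
      · simp [hp f hf]
      · simp [hp g hg]
    · intro hp
      by_contra hn
      simp only [Set.mem_union, not_or, zeroLocus, Set.mem_ofPred_eq, not_forall] at hn
      obtain ⟨⟨f, hf, hf0⟩, ⟨g, hg, hg0⟩⟩ := hn
      have h := hp (f * g) ⟨f, hf, g, hg, rfl⟩
      rw [map_mul] at h
      exact (mul_ne_zero hf0 hg0) h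

/-- The Zariski topology of projective space. -/
instance instTopologicalSpace (ι : Type) : TopologicalSpace (PSpace ι) :=
  TopologicalSpace.ofClosed {Z | IsAlgebraic Z} isAlgebraic_empty
    (fun A hA => isAlgebraic_sInter A fun _ hZ => hA hZ)
    (fun Y hY Z hZ => isAlgebraic_union Y hY Z hZ)

theorem isClosed_iff {ι : Type} (Z : Set (PSpace ι)) : IsClosed Z ↔ IsAlgebraic Z := by
  rw [← isOpen_compl_iff]
  change IsAlgebraic (Zᶜᶜ) ↔ IsAlgebraic Z
  rw [compl_compl]

end PSpace

/-! ### Varieties, lines and conics in projective 3-space -/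

/-- A (projective) variety: an irreducible Zariski closed subset. -/
def IsVariety {ι : Type} (V : Set (PSpace ι)) : Prop := IsClosed V ∧ IsIrreducible V

/-- A curve: a one-dimensional variety. -/
def IsCurve {ι : Type} (V : Set (PSpace ι)) : Prop :=
  IsVariety V ∧ topologicalKrullDim V = 1

/-- A surface: a two-dimensional variety. -/
def IsSurface {ι : Type} (V : Set (PSpace ι)) : Prop :=
  IsVariety V ∧ topologicalKrullDim V = 2

/-- A line in projective 3-space: the projectivization of a plane of `ℂ⁴`. -/
def IsLine (L : Set (PSpace (Fin 4))) : Prop :=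
  ∃ W : Submodule ℂ (Fin 4 → ℂ), Module.finrank ℂ W = 2 ∧ L = {p | p.rep ∈ W}

/-- A smooth plane conic in projective 3-space: the zeros, in a plane `ℙ(W)`, of a
nondegenerate quadratic form on the 3-dimensional space `W`. -/
def IsSmoothPlaneConic (c : Set (PSpace (Fin 4))) : Prop :=
  ∃ W : Submodule ℂ (Fin 4 → ℂ), Module.finrank ℂ W = 3 ∧
    ∃ q : QuadraticForm ℂ W, (QuadraticMap.polarBilin q).Nondegenerate ∧
      c = {p | ∃ h : p.rep ∈ W, q ⟨p.rep, h⟩ = 0}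

/-! ### Plücker coordinates and line congruences -/

/-- The Plücker coordinates `(c₀₁, c₀₂, c₀₃, c₂₃, c₃₁, c₁₂)` of `a ∧ b`. -/
def plucker (a b : Fin 4 → ℂ) : Fin 6 → ℂ :=
  ![a 0 * b 1 - a 1 * b 0, a 0 * b 2 - a 2 * b 0, a 0 * b 3 - a 3 * b 0,
    a 2 * b 3 - a 3 * b 2, a 3 * b 1 - a 1 * b 3, a 1 * b 2 - a 2 * b 1]

/-- The Klein quadric `c₀₁ c₂₃ + c₀₂ c₃₁ + c₀₃ c₁₂ = 0`. -/
def kleinQuadric : Set (PSpace (Fin 6)) :=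
  {ω | ω.rep 0 * ω.rep 3 + ω.rep 1 * ω.rep 4 + ω.rep 2 * ω.rep 5 = 0}

/-- The line in projective 3-space with Plücker coordinates `ω`: the span of any two points
`a`, `b` with `a ∧ b = ω`. -/
def lineOf (ω : PSpace (Fin 6)) : Set (PSpace (Fin 4)) :=
  {p | ∃ (a b : Fin 4 → ℂ) (h : plucker a b ≠ 0),
    PSpace.mk (plucker a b) h = ω ∧ p.rep ∈ Submodule.span ℂ {a, b}}

/-- A line congruence: an algebraic surface contained in the Klein quadric. -/
def IsLineCongruence (X : Set (PSpace (Fin 6))) : Prop :=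
  IsSurface X ∧ X ⊆ kleinQuadric

/-- `V` meets every line of `X`. -/
def MeetsAll (X : Set (PSpace (Fin 6))) (V : Set (PSpace (Fin 4))) : Prop :=
  ∀ ω ∈ X, (V ∩ lineOf ω).Nonempty

/-- `V` is a focal variety of `X`: it meets every line of `X` and is minimal among the varieties
with this property. -/
def IsFocal (X : Set (PSpace (Fin 6))) (V : Set (PSpace (Fin 4))) : Prop :=
  IsVariety V ∧ MeetsAll X V ∧ ∀ W, IsVariety W → W ⊆ V → MeetsAll X W → W = V

/-- The set of focal curves of `X`. -/
def focalCurves (X : Set (PSpace (Fin 6))) : Set (Set (PSpace (Fin 4))) :=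
  {V | IsCurve V ∧ IsFocal X V}

/-- A quadratic line congruence: it has a focal plane conic and a focal line that meets the
conic. -/
def IsQuadratic (X : Set (PSpace (Fin 6))) : Prop :=
  IsLineCongruence X ∧ ∃ x c, IsLine x ∧ IsSmoothPlaneConic c ∧
    IsFocal X x ∧ IsFocal X c ∧ (x ∩ c).Nonempty

/-! ### Trilinear birational maps -/

/-- The projective space `ℙ³¹` of the quadruples of trilinear forms up to a common scalar;
the coordinate `(i, j, k, l)` is the coefficient of `s_j t_k u_l` in `f_i`. -/
abbrev TrilinearTuple : Type := PSpace (Fin 4 × Fin 2 × Fin 2 × Fin 2)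

/-- The values `(f₀, f₁, f₂, f₃)` of the four trilinear forms, with arguments in an arbitrary
commutative `ℂ`-algebra. -/
def value {R : Type} [CommRing R] [Algebra ℂ R] (φ : TrilinearTuple) (s t u : Fin 2 → R) :
    Fin 4 → R :=
  fun i => ∑ j, ∑ k, ∑ l, algebraMap ℂ R (φ.rep (i, j, k, l)) * (s j * t k * u l)

/-- The coordinate ring of `ℙ¹ × ℙ¹ × ℙ¹`; the variables `(0, j)`, `(1, j)`, `(2, j)` are
`s_j`, `t_j`, `u_j`. -/
abbrev CoordRing : Type := MvPolynomial (Fin 3 × Fin 2) ℂ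

/-- The four trilinear polynomials `f₀, f₁, f₂, f₃`. -/
def form (φ : TrilinearTuple) : Fin 4 → CoordRing :=
  value φ (fun j => X (0, j)) (fun j => X (1, j)) (fun j => X (2, j))

/-- The polynomials `g i` have no common factor other than the units. -/
def NoCommonFactor {R κ : Type} [CommRing R] (g : κ → R) : Prop :=
  ∀ d : R, (∀ i, d ∣ g i) → IsUnit d

/-- The tuple `g` is not zero, and `g` and `h` are proportional: `(g i)_i = (h i)_i` as points of
projective space over the field of fractions (for `h ≠ 0`). -/
def SamePoint {R κ : Type} [CommRing R] (g h : κ → R) : Prop :=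
  (∃ i, g i ≠ 0) ∧ ∀ i j, g i * h j = g j * h i

/-- The rational map `(σ, τ, υ) : ℙ³ ⇢ ℙ¹ × ℙ¹ × ℙ¹` is inverse to the rational map `φ`. -/
structure IsInverse (φ : TrilinearTuple) (σ τ υ : Fin 2 → MvPolynomial (Fin 4) ℂ) : Prop where
  left_s : SamePoint (fun i => aeval (form φ) (σ i)) (fun i => (X (0, i) : CoordRing))
  left_t : SamePoint (fun i => aeval (form φ) (τ i)) (fun i => (X (1, i) : CoordRing))
  left_u : SamePoint (fun i => aeval (form φ) (υ i)) (fun i => (X (2, i) : CoordRing))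
  right : SamePoint (value φ σ τ υ) (fun i => (X i : MvPolynomial (Fin 4) ℂ))

/-- `φ` is a trilinear birational map of type `(d₁, d₂, d₃)`: the forms `f_i` have no common
factor, and there is an inverse whose three factors are given by pairs of forms without common
factor, of degrees `d₁`, `d₂`, `d₃`. -/
def IsBirationalOfType (φ : TrilinearTuple) (d₁ d₂ d₃ : ℕ) : Prop :=
  NoCommonFactor (form φ) ∧ ∃ σ τ υ : Fin 2 → MvPolynomial (Fin 4) ℂ,
    (∀ i, (σ i).IsHomogeneous d₁) ∧ (∀ i, (τ i).IsHomogeneous d₂) ∧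
    (∀ i, (υ i).IsHomogeneous d₃) ∧
    NoCommonFactor σ ∧ NoCommonFactor τ ∧ NoCommonFactor υ ∧ IsInverse φ σ τ υ

/-- The set of trilinear birational maps of type `(d₁, d₂, d₃)`. -/
def Bir (d₁ d₂ d₃ : ℕ) : Set TrilinearTuple := {φ | IsBirationalOfType φ d₁ d₂ d₃}

/-! ### The parametric line congruences -/

/-- The congruence `S` of the `s`-lines: the Zariski closure of the set of the lines
`φ(ℙ¹ × t × u)`, each joining `φ((1:0), t, u)` and `φ((0:1), t, u)`. -/
def congruenceS (φ : TrilinearTuple) : Set (PSpace (Fin 6)) :=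
  closure {ω | ∃ (t u : Fin 2 → ℂ)
    (h : plucker (value φ ![1, 0] t u) (value φ ![0, 1] t u) ≠ 0), ω = PSpace.mk _ h}

/-- The congruence `T` of the `t`-lines. -/
def congruenceT (φ : TrilinearTuple) : Set (PSpace (Fin 6)) :=
  closure {ω | ∃ (s u : Fin 2 → ℂ)
    (h : plucker (value φ s ![1, 0] u) (value φ s ![0, 1] u) ≠ 0), ω = PSpace.mk _ h}

/-- The congruence `U` of the `u`-lines. -/
def congruenceU (φ : TrilinearTuple) : Set (PSpace (Fin 6)) :=
  closure {ω | ∃ (s t : Fin 2 → ℂ)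
    (h : plucker (value φ s t ![1, 0]) (value φ s t ![0, 1]) ≠ 0), ω = PSpace.mk _ h}

end LineCongruence

end

/-!
The maps of type `(2, 2, 2)` have a normal form, up to a proper closed subset: in suitable bases of
the three planes and for a suitable basis `A, B₁, B₂, B₃` of `ℂ⁴`, a general one is
`A (s₁t₀u₀ + s₀t₁u₀ + s₀t₀u₁) + B₁ s₀t₁u₁ + B₂ s₁t₀u₁ + B₃ s₁t₁u₀` (`IsNormal`). For such a map the
line congruences can be computed, and the theorem is read off from one model.

*Existence of the normal form.* For fixed `s`, the map is a linear map `M(s)` on tensors `t ⊗ u`,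
and the quadratic form `s₁ σ₀ - s₀ σ₁` of the inverse vanishes on the image of the rank one tensors.
The quadratic forms vanishing on the rank one tensors are the multiples of the determinant form, so
this expresses a scalar cubic polynomial as a product of three linear operator polynomials, two of
which are adjoint for the determinant form (`exists_cubic_factorization`). The possible
multiplicities of the eigenvalues (`exists_root_of_factorization`) then force the kernel of some
slice `M(r)` to be a tangent line of the Segre quadric of rank one tensors
(`exists_tangent_kernel`). Comparing the three directions gives bases of the three planes in which
the map vanishes at one vertex of the cube `{0, 1}³` and takes a common value `A` at the three
neighbours (`QuadraticInverse.exists_bases`). The remaining values `B₁, B₂, B₃` and `C` satisfy with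
`A` a linear relation `m A + n₁ B₁ + n₂ B₂ + n₃ B₃ + e C = 0`. The five trilinear coordinates
parametrize the quadric `e m = n₁ n₂ + n₁ n₃ + n₂ n₃`, and injectivity of the map forces the relation
to lie on this quadric too: otherwise a point and its reflection in the relation would have the same
image (`CubeValues.quadric_of_ne_zero`). If `e ≠ 0`, a translation of the parameters turns the
relation into `C = 0`, which is the normal form (`CubeValues.isNormal`). Conversely, a map in normal
form has the inverse `(w a : q) × (w b : q) × (w c : q)` with `q = a b + b c + c a`, where
`a, b, c, w` are the coordinates for `B₁, B₂, B₃, A` (`CubeValues.mem_bir`).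

*The open subset.* The determinant of `M(s)` is a binary quartic. For the maps in normal form it is
`s₀ s₁³`, up to a constant, and for the maps with `e = 0` it is a fourth power, up to a constant.
So the maps of type `(2, 2, 2)` for which the Hessian of this quartic does not vanish
(`generalMaps`) are exactly those in normal form, and they are relatively open. They are also dense:
when `e = 0`, moving `B₁` along a line gives a polynomial path whose other members are, with finitely
many exceptions, in normal form (`bir_subset_closure`).

*The congruences.* In the coordinates `(a, b, c, w)`, the `s`-lines of a map in normal form are the
lines with Plücker coordinates `(αβ, αγ, βγ, -γ(β + γ), β(β + γ), 0)`. Their closure is irreducible,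
as it is connected by polynomial paths; its dimension is at most two, by comparing transcendence
degrees, and at least two, as it contains a line properly. All these lines meet the axis `b = c = 0`
and the conic `w = 0 = a b + b c + c a`, and no single point meets them all. There are no other
focal curves: the rulings of the cone over the conic with a vertex on the axis belong to the
congruence, so a curve that meets all of them contains the vertex, or has infinitely many points on
the cone and is contained in it (`focalVertex_mem_or_subset_focalCone`). In the first case for
infinitely many vertices the curve is the axis; otherwise it lies on two of the cones, which have
only the axis and the conic in common (`eq_of_isCurve_of_meetsAll`). The normal form is symmetric in the three directions: the congruences
`S`, `T`, `U` share the conic, and their focal lines join the point `A` to `B₁`, `B₂` and `B₃`.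
-/

noncomputable section

namespace LineCongruence

/-! ### Projective space and its closed sets -/

namespace PSpace

variable {ι : Type}

theorem rep_ne_zero (p : PSpace ι) : p.rep ≠ 0 := Projectivization.rep_nonzero p

theorem mk_rep (p : PSpace ι) : mk p.rep p.rep_ne_zero = p := Projectivization.mk_rep p

theorem exists_rep_mk (v : ι → ℂ) (hv : v ≠ 0) : ∃ c : ℂ, c ≠ 0 ∧ (mk v hv).rep = c • v := by
  obtain ⟨a, ha⟩ := Projectivization.exists_smul_eq_mk_rep ℂ v hv
  exact ⟨a, a.ne_zero, ha.symm⟩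

theorem mk_eq_mk_iff {v w : ι → ℂ} (hv : v ≠ 0) (hw : w ≠ 0) :
    mk v hv = mk w hw ↔ ∃ c : ℂ, c • w = v :=
  Projectivization.mk_eq_mk_iff' ℂ v w hv hw

theorem mk_smul {v : ι → ℂ} {c : ℂ} (h : c • v ≠ 0) :
    mk (c • v) h = mk v (right_ne_zero_of_smul h) := by
  rw [mk_eq_mk_iff]
  exact ⟨c, rfl⟩

/-- The affine cone over a set of points of projective space (the zero vector included). -/
def cone (Z : Set (PSpace ι)) : Set (ι → ℂ) := {v | ∀ h : v ≠ 0, mk v h ∈ Z}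

theorem mk_mem_iff {Z : Set (PSpace ι)} {v : ι → ℂ} (h : v ≠ 0) : mk v h ∈ Z ↔ v ∈ cone Z :=
  ⟨fun hm _ => hm, fun hm => hm h⟩

theorem rep_mem_cone {Z : Set (PSpace ι)} {p : PSpace ι} : p.rep ∈ cone Z ↔ p ∈ Z := by
  rw [← mk_mem_iff p.rep_ne_zero, mk_rep]

theorem cone_mono {Y Z : Set (PSpace ι)} (h : Y ⊆ Z) : cone Y ⊆ cone Z :=
  fun _ hv hn => h (hv hn)

theorem smul_mem_cone {Z : Set (PSpace ι)} {v : ι → ℂ} (hv : v ∈ cone Z) (c : ℂ) :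
    c • v ∈ cone Z := by
  intro h
  rw [mk_smul]
  exact hv _

theorem smul_mem_cone_iff {Z : Set (PSpace ι)} {v : ι → ℂ} {c : ℂ} (hc : c ≠ 0) :
    c • v ∈ cone Z ↔ v ∈ cone Z := by
  refine ⟨fun h => ?_, fun h => smul_mem_cone h c⟩
  have := smul_mem_cone h c⁻¹
  rwa [smul_smul, inv_mul_cancel₀ hc, one_smul] at this

theorem eval_smul {f : MvPolynomial ι ℂ} {d : ℕ} (hf : f.IsHomogeneous d) (c : ℂ) (v : ι → ℂ) :
    eval (c • v) f = c ^ d * eval v f := by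
  rw [eval_eq, eval_eq, Finset.mul_sum]
  refine Finset.sum_congr rfl fun m hm => ?_
  have hd : ∑ i ∈ m.support, m i = d := by
    have := hf (mem_support_iff.mp hm)
    rwa [Finsupp.weight_apply, Finsupp.sum, show (∑ i ∈ m.support, m i • (1 : ι → ℕ) i) =
      ∑ i ∈ m.support, m i by simp] at this
  simp only [Pi.smul_apply, smul_eq_mul, mul_pow, Finset.prod_mul_distrib,
    Finset.prod_pow_eq_pow_sum, hd]
  ring

theorem eval_rep_mk_iff {f : MvPolynomial ι ℂ} {d : ℕ} (hf : f.IsHomogeneous d) {v : ι → ℂ}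
    (hv : v ≠ 0) : eval (mk v hv).rep f = 0 ↔ eval v f = 0 := by
  obtain ⟨c, hc, h⟩ := exists_rep_mk v hv
  rw [h, eval_smul hf]
  simp [hc]

/-- Along each line through the origin, a polynomial is a polynomial in one variable, whose
coefficients are the values of the homogeneous components. -/
theorem exists_poly_smul (f : MvPolynomial ι ℂ) (v : ι → ℂ) :
    ∃ P : Polynomial ℂ, (∀ c : ℂ, P.eval c = eval (c • v) f) ∧
      ∀ i, P.coeff i = eval v (homogeneousComponent i f) := by
  refine ⟨∑ i ∈ Finset.range (f.totalDegree + 1),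
    Polynomial.C (eval v (homogeneousComponent i f)) * Polynomial.X ^ i, fun c => ?_, fun i => ?_⟩
  · conv_rhs => rw [← sum_homogeneousComponent f, map_sum]
    rw [Polynomial.eval_finsetSum]
    refine Finset.sum_congr rfl fun i _ => ?_
    rw [eval_smul (homogeneousComponent_isHomogeneous i f)]
    rw [Polynomial.eval_mul, Polynomial.eval_C, Polynomial.eval_pow, Polynomial.eval_X, mul_comm]
  · simp only [Polynomial.finsetSum_coeff, Polynomial.coeff_C_mul, Polynomial.coeff_X_pow,
      mul_ite, mul_one, mul_zero, Finset.sum_ite_eq, Finset.mem_range]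
    split_ifs with h
    · rfl
    · rw [homogeneousComponent_eq_zero _ _ (by omega), map_zero]

/-- A set of points whose representatives satisfy, with all their multiples, arbitrary polynomial
equations is closed: the homogeneous components of the equations cut it out. -/
theorem isClosed_forall_smul (F : Set (MvPolynomial ι ℂ)) :
    IsClosed {p : PSpace ι | ∀ f ∈ F, ∀ c : ℂ, eval (c • p.rep) f = 0} := by
  rw [isClosed_iff]
  refine ⟨{g | ∃ f ∈ F, ∃ i, g = homogeneousComponent i f}, ?_, ?_⟩
  · rintro g ⟨f, _, i, rfl⟩
    exact ⟨i, homogeneousComponent_isHomogeneous i f⟩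
  · ext p
    constructor
    · rintro h g ⟨f, hf, i, rfl⟩
      obtain ⟨P, hP, hc⟩ := exists_poly_smul f p.rep
      have : P = 0 := Polynomial.funext fun c => by rw [hP, h f hf, Polynomial.eval_zero]
      rw [← hc, this, Polynomial.coeff_zero]
    · intro h f hf c
      obtain ⟨P, hP, hc⟩ := exists_poly_smul f p.rep
      have : P = 0 := Polynomial.ext fun i => by
        rw [hc, Polynomial.coeff_zero]
        exact h _ ⟨f, hf, i, rfl⟩
      rw [← hP, this, Polynomial.eval_zero]

/-- Polynomials whose values scale by a power of the scalar cut out a closed set. -/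
theorem isClosed_setOf_eval (F : Set (MvPolynomial ι ℂ))
    (hF : ∀ f ∈ F, ∃ d : ℕ, ∀ (c : ℂ) (v : ι → ℂ), eval (c • v) f = c ^ d * eval v f) :
    IsClosed {p : PSpace ι | ∀ f ∈ F, eval p.rep f = 0} := by
  convert isClosed_forall_smul F using 3 with p
  constructor
  · intro h f hf c
    obtain ⟨d, hd⟩ := hF f hf
    rw [hd, h f hf, mul_zero]
  · intro h f hf
    simpa using h f hf 1

theorem mem_of_isClosed {Z : Set (PSpace ι)} (hZ : IsClosed Z) :
    ∃ F : Set (MvPolynomial ι ℂ), (∀ f ∈ F, ∃ d : ℕ, f.IsHomogeneous d) ∧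
      ∀ v : ι → ℂ, v ≠ 0 → (v ∈ cone Z ↔ ∀ f ∈ F, eval v f = 0) := by
  obtain ⟨F, hF, rfl⟩ := (isClosed_iff Z).mp hZ
  refine ⟨F, hF, fun v hv => ?_⟩
  rw [← mk_mem_iff hv]
  refine forall₂_congr fun f hf => ?_
  obtain ⟨d, hd⟩ := hF f hf
  exact eval_rep_mk_iff hd hv

/-! ### Polynomial paths -/

/-- The point at parameter `x` of a vector of polynomials in one variable. -/
def pathAt (w : ι → Polynomial ℂ) (x : ℂ) : ι → ℂ := fun i => (w i).eval x

theorem eval_pathAt (w : ι → Polynomial ℂ) (x : ℂ) (f : MvPolynomial ι ℂ) :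
    eval (pathAt w x) f = (aeval w f).eval x := by
  rw [← Polynomial.coe_evalRingHom, aeval_def, hom_eval₂]
  have : (Polynomial.evalRingHom x).comp (algebraMap ℂ (Polynomial ℂ)) = RingHom.id ℂ := by
    ext; simp
  rw [this]
  rfl

theorem pathAt_eq_zero_of_infinite {w : ι → Polynomial ℂ} (h : {x | pathAt w x = 0}.Infinite) :
    w = 0 := by
  funext i
  refine Polynomial.eq_zero_of_infinite_isRoot _ (h.mono fun x hx => ?_)
  exact congrFun hx i

theorem finite_pathAt_eq_zero {w : ι → Polynomial ℂ} {y : ℂ} (h : pathAt w y ≠ 0) :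
    {x | pathAt w x = 0}.Finite := by
  by_contra hn
  apply h
  rw [pathAt_eq_zero_of_infinite hn]
  funext i
  simp [pathAt]

/-- A polynomial path that is in a closed set for infinitely many parameters stays in it. -/
theorem mem_cone_of_path {Z : Set (PSpace ι)} (hZ : IsClosed Z) (w : ι → Polynomial ℂ)
    (h : {x | pathAt w x ∈ cone Z}.Infinite) (x : ℂ) : pathAt w x ∈ cone Z := by
  obtain ⟨F, hF, hmem⟩ := mem_of_isClosed hZ
  by_cases hx : pathAt w x = 0
  · exact fun hn => absurd hx hn
  rw [hmem _ hx]
  intro f hf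
  rw [eval_pathAt]
  have hz : aeval w f = 0 := by
    refine Polynomial.eq_zero_of_infinite_isRoot _
      ((h.sdiff (finite_pathAt_eq_zero hx)).mono ?_)
    rintro y ⟨hy, hy0⟩
    have := (hmem _ hy0).mp hy f hf
    rwa [eval_pathAt] at this
  rw [hz, Polynomial.eval_zero]

theorem mem_cone_closure_of_path {Z : Set (PSpace ι)} (w : ι → Polynomial ℂ)
    (h : {x | pathAt w x ∉ cone Z}.Finite) (x : ℂ) : pathAt w x ∈ cone (closure Z) := by
  refine mem_cone_of_path isClosed_closure w ?_ x
  refine (Set.Finite.infinite_compl h).mono fun y hy => ?_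
  simp only [Set.mem_compl_iff, Set.mem_ofPred_eq, not_not] at hy
  exact cone_mono subset_closure hy

/-- A set is irreducible if any two of its points are joined by a polynomial path in it. -/
theorem isIrreducible_of_path {S : Set (PSpace ι)} (hne : S.Nonempty)
    (h : ∀ p ∈ S, ∀ q ∈ S, ∃ w : ι → Polynomial ℂ, (∃ x hx, mk (pathAt w x) hx = p) ∧
      (∃ y hy, mk (pathAt w y) hy = q) ∧ {x | pathAt w x ∉ cone S}.Finite) :
    IsIrreducible S := by
  refine ⟨hne, ?_⟩
  rw [isPreirreducible_iff_isClosed_union_isClosed]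
  intro Y Z hY hZ hS
  by_contra hn
  simp only [not_or, Set.not_subset] at hn
  obtain ⟨⟨p, hp, hpY⟩, q, hq, hqZ⟩ := hn
  obtain ⟨w, ⟨x, hx, rfl⟩, ⟨y, hy, rfl⟩, hfin⟩ := h p hp q hq
  have hYf : {x | pathAt w x ∈ cone Y}.Finite := by
    by_contra hi
    exact hpY (mem_cone_of_path hY w hi x hx)
  have hZf : {x | pathAt w x ∈ cone Z}.Finite := by
    by_contra hi
    exact hqZ (mem_cone_of_path hZ w hi y hy)
  refine Set.infinite_univ (α := ℂ) (((hfin.union hYf).union hZf).subset fun z _ => ?_)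
  by_cases hz : pathAt w z ∈ cone S
  · by_cases h0 : pathAt w z = 0
    · exact Or.inl (Or.inr fun hn => absurd h0 hn)
    · rcases hS (hz h0) with h1 | h1
      · exact Or.inl (Or.inr fun _ => h1)
      · exact Or.inr fun _ => h1
  · exact Or.inl (Or.inl hz)

/-! ### Points are closed, and the space is Noetherian -/

theorem isClosed_point (p : PSpace ι) : IsClosed {p} := by
  rw [isClosed_iff]
  refine ⟨{f | ∃ i j, f = C (p.rep j) * X i - C (p.rep i) * X j}, ?_, ?_⟩
  · rintro f ⟨i, j, rfl⟩
    exact ⟨1, ((isHomogeneous_C_mul_X _ _).sub (isHomogeneous_C_mul_X _ _))⟩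
  · ext q
    constructor
    · rintro rfl f ⟨i, j, rfl⟩
      simp [mul_comm]
    · intro h
      have h2 : ∀ i j, p.rep j * q.rep i - p.rep i * q.rep j = 0 := fun i j => by
        simpa using h _ ⟨i, j, rfl⟩
      obtain ⟨j, hj⟩ := Function.ne_iff.mp p.rep_ne_zero
      change q = p
      rw [← mk_rep q, ← mk_rep p, mk_eq_mk_iff]
      refine ⟨q.rep j / p.rep j, ?_⟩
      funext i
      simp only [Pi.zero_apply] at hj
      simp only [Pi.smul_apply, smul_eq_mul]
      field_simp
      linear_combination (-1 : ℂ) * h2 i j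

instance : T1Space (PSpace ι) := ⟨isClosed_point⟩

/-- The ideal of the polynomials vanishing on the affine cone over a set of points. -/
def vanishingIdeal (Z : Set (PSpace ι)) : Ideal (MvPolynomial ι ℂ) where
  carrier := {f | ∀ p ∈ Z, ∀ c : ℂ, eval (c • p.rep) f = 0}
  add_mem' := by
    intro f g hf hg p hp c
    rw [map_add, hf p hp c, hg p hp c, add_zero]
  zero_mem' := by
    intro p _ c
    simp
  smul_mem' := by
    intro f g hg p hp c
    rw [smul_eq_mul, map_mul, hg p hp c, mul_zero]

theorem vanishingIdeal_anti {Y Z : Set (PSpace ι)} (h : Y ⊆ Z) :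
    vanishingIdeal Z ≤ vanishingIdeal Y := fun _ hf p hp => hf p (h hp)

theorem subset_of_vanishingIdeal_le {Y Z : Set (PSpace ι)} (hZ : IsClosed Z)
    (h : vanishingIdeal Z ≤ vanishingIdeal Y) : Y ⊆ Z := by
  intro p hp
  obtain ⟨F, hF, hmem⟩ := mem_of_isClosed hZ
  rw [← rep_mem_cone, hmem _ p.rep_ne_zero]
  intro f hf
  rcases Z.eq_empty_or_nonempty with rfl | ⟨z, hz⟩
  · have : (1 : MvPolynomial ι ℂ) ∈ vanishingIdeal Y := h fun p hp => absurd hp (by simp)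
    simpa using this p hp 1
  obtain ⟨d, hd⟩ := hF f hf
  have h1 : f ∈ vanishingIdeal Z ∨ ∃ c, f = C c := by
    rcases Nat.eq_zero_or_pos d with rfl | hdpos
    · exact Or.inr ⟨_, totalDegree_eq_zero_iff_eq_C.mp (Nat.le_zero.mp hd.totalDegree_le)⟩
    · refine Or.inl fun q hq c => ?_
      rw [eval_smul hd, (hmem _ q.rep_ne_zero).mp (rep_mem_cone.mpr hq) f hf, mul_zero]
  rcases h1 with h1 | ⟨c, rfl⟩
  · simpa using h h1 p hp 1
  · have := (hmem _ z.rep_ne_zero).mp (rep_mem_cone.mpr hz) _ hf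
    simpa using this

theorem vanishingIdeal_lt {Y Z : Set (PSpace ι)} (hY : IsClosed Y) (h : Y ⊂ Z) : vanishingIdeal Z < vanishingIdeal Y :=
  lt_of_le_not_ge (vanishingIdeal_anti h.subset) fun hle =>
    h.not_subset (subset_of_vanishingIdeal_le hY hle)

instance [Finite ι] : TopologicalSpace.NoetherianSpace (PSpace ι) := by
  have hiff : TopologicalSpace.NoetherianSpace (PSpace ι) ↔
      WellFoundedLT (TopologicalSpace.Closeds (PSpace ι)) :=
    (TopologicalSpace.noetherianSpace_TFAE (PSpace ι)).out 0 1
  refine hiff.mpr ⟨?_⟩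
  have : WellFounded fun I J : Ideal (MvPolynomial ι ℂ) => I > J := wellFounded_gt
  refine Subrelation.wf (r := InvImage (· > ·) fun Z : TopologicalSpace.Closeds (PSpace ι) =>
    vanishingIdeal (Z : Set (PSpace ι))) ?_ (InvImage.wf _ this)
  intro Y Z hYZ
  have hss : (Y : Set (PSpace ι)) ⊂ Z := hYZ
  exact vanishingIdeal_lt Y.isClosed hss

theorem isPrime_vanishingIdeal {Z : Set (PSpace ι)} (hZ : IsIrreducible Z) :
    (vanishingIdeal Z).IsPrime := by
  refine ⟨?_, ?_⟩
  · rw [Ideal.ne_top_iff_one]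
    obtain ⟨p, hp⟩ := hZ.1
    intro h
    simpa using h p hp 1
  · intro f g hfg
    have hc : ∀ h : MvPolynomial ι ℂ, IsClosed {p : PSpace ι | ∀ c : ℂ, eval (c • p.rep) h = 0} :=
      fun h => by simpa using isClosed_forall_smul {h}
    have := isPreirreducible_iff_isClosed_union_isClosed.mp hZ.2 _ _ (hc f) (hc g) ?_
    · exact this
    intro p hp
    obtain ⟨P, hP, -⟩ := exists_poly_smul f p.rep
    obtain ⟨Q, hQ, -⟩ := exists_poly_smul g p.rep
    have hPQ : P * Q = 0 := Polynomial.funext fun c => by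
      have := hfg p hp c
      rw [map_mul] at this
      rw [Polynomial.eval_mul, hP, hQ, this, Polynomial.eval_zero]
    rcases mul_eq_zero.mp hPQ with h0 | h0
    · exact Or.inl fun c => by rw [← hP, h0, Polynomial.eval_zero]
    · exact Or.inr fun c => by rw [← hQ, h0, Polynomial.eval_zero]

end PSpace

/-! ### Dimension -/

/-- The transcendence degree drops along a surjection with nonzero kernel onto a domain: lift a
transcendence basis and add an element of the kernel. -/
theorem trdeg_add_one_le {A B : Type} [CommRing A] [CommRing B] [IsDomain A] [IsDomain B]
    [Algebra ℂ A] [Algebra ℂ B] (π : A →ₐ[ℂ] B) (hπ : Function.Surjective π)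
    {f : A} (hf : f ≠ 0) (hf0 : π f = 0) : Algebra.trdeg ℂ B + 1 ≤ Algebra.trdeg ℂ A := by
  obtain ⟨ι, x, hx⟩ := exists_isTranscendenceBasis' ℂ B
  choose y hy using fun i => hπ (x i)
  have hxy : π ∘ y = x := funext hy
  have hyi : AlgebraicIndependent ℂ y := AlgebraicIndependent.of_comp π (hxy ▸ hx.1)
  have hinj : ∀ a ∈ Algebra.adjoin ℂ (Set.range y), π a = 0 → a = 0 := by
    intro a ha h0
    rw [Algebra.adjoin_range_eq_range_aeval] at ha
    obtain ⟨P, rfl⟩ := ha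
    have h1 : aeval x P = 0 := by
      rw [← hxy]
      have := comp_aeval_apply y π P
      exact this.symm.trans h0
    rw [(algebraicIndependent_iff.mp hx.1) P h1, map_zero]
  have htr : Transcendental (Algebra.adjoin ℂ (Set.range y)) f := by
    rw [transcendental_iff]
    intro p hp
    by_contra hp0
    obtain ⟨q, hq, hdvd⟩ := p.exists_eq_pow_rootMultiplicity_mul_and_not_dvd hp0 0
    rw [Polynomial.C_0, sub_zero] at hq hdvd
    rw [hq, map_mul, map_pow, Polynomial.aeval_X] at hp
    have hq0 : Polynomial.aeval f q = 0 :=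
      (mul_eq_zero.mp hp).resolve_left (pow_ne_zero _ hf)
    apply hdvd
    rw [Polynomial.X_dvd_iff]
    have h2 : π (q.coeff 0 : A) = 0 := by
      rw [← Polynomial.divX_mul_X_add q, map_add, map_mul, Polynomial.aeval_X,
        Polynomial.aeval_C] at hq0
      have := congrArg π hq0
      rw [map_add, map_mul, hf0, mul_zero, zero_add, map_zero] at this
      exact this
    exact Subtype.ext (hinj _ (q.coeff 0).2 h2)
  have hopt := (hyi.option_iff_transcendental f).mpr htr
  have h3 := hopt.cardinalMk_le_trdeg
  rwa [Cardinal.mk_option, hx.cardinalMk_eq_trdeg] at h3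

theorem trdeg_quotient_lt {ι : Type} {P Q : Ideal (MvPolynomial ι ℂ)} [P.IsPrime] [Q.IsPrime]
    (h : P < Q) : Algebra.trdeg ℂ (MvPolynomial ι ℂ ⧸ Q) + 1 ≤
      Algebra.trdeg ℂ (MvPolynomial ι ℂ ⧸ P) := by
  obtain ⟨f, hfQ, hfP⟩ := SetLike.exists_of_lt h
  refine trdeg_add_one_le (Ideal.Quotient.factorₐ ℂ h.le) (Ideal.Quotient.factor_surjective h.le)
    (f := Ideal.Quotient.mk P f) ?_ ?_
  · rwa [Ne, Ideal.Quotient.eq_zero_iff_mem]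
  · change Ideal.Quotient.factor h.le (Ideal.Quotient.mk P f) = 0
    rw [Ideal.Quotient.factor_mk, Ideal.Quotient.eq_zero_iff_mem]
    exact hfQ

namespace PSpace

theorem krullDim_le_of_strictMono_fin {X : Type*} [Preorder X] (n : ℕ) (d : X → ℕ)
    (hd : StrictMono d) (hn : ∀ x, d x ≤ n) : Order.krullDim X ≤ n := by
  refine iSup_le fun p => ?_
  have h : StrictMono fun x => (⟨d x, Nat.lt_succ_of_le (hn x)⟩ : Fin (n + 1)) :=
    fun x y hxy => hd hxy
  have h1 := (p.map _ h).length_lt_card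
  rw [Fintype.card_fin] at h1
  have h2 : p.length ≤ n := Nat.lt_succ_iff.mp h1
  exact_mod_cast h2

/-- A projective closed set whose affine cone is dominated by an affine space of dimension `n + 1`
has dimension at most `n`. -/
theorem topologicalKrullDim_le_of_param {ι : Type} {n : ℕ} {Z : Set (PSpace ι)}
    (hZ : IsClosed Z)
    (ψ : MvPolynomial ι ℂ →ₐ[ℂ] MvPolynomial (Fin (n + 1)) ℂ)
    (hψ : ∀ f, ψ f = 0 → f ∈ vanishingIdeal Z) : topologicalKrullDim Z ≤ n := by
  let I : TopologicalSpace.IrreducibleCloseds Z → Ideal (MvPolynomial ι ℂ) := fun Y =>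
    vanishingIdeal (Subtype.val '' (Y : Set Z))
  have hcl : ∀ Y : TopologicalSpace.IrreducibleCloseds Z,
      IsClosed (Subtype.val '' (Y : Set Z)) := fun Y =>
    hZ.isClosedEmbedding_subtypeVal.isClosedMap _ Y.isClosed
  have hprime : ∀ Y, (I Y).IsPrime := fun Y => isPrime_vanishingIdeal
    (Y.isIrreducible.image _ continuous_subtype_val.continuousOn)
  let d : TopologicalSpace.IrreducibleCloseds Z → Cardinal := fun Y =>
    Algebra.trdeg ℂ (MvPolynomial ι ℂ ⧸ I Y)
  have hlt : ∀ Y Y' : TopologicalSpace.IrreducibleCloseds Z, Y < Y' → d Y + 1 ≤ d Y' := by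
    intro Y Y' h
    have h1 : (Subtype.val '' (Y : Set Z)) ⊂ Subtype.val '' (Y' : Set Z) :=
      Subtype.val_injective.image_strictMono h
    have := hprime Y
    have := hprime Y'
    exact trdeg_quotient_lt (vanishingIdeal_lt (hcl Y) h1)
  have hle : ∀ Y, d Y ≤ (n + 1 : ℕ) := by
    intro Y
    have hker : RingHom.ker ψ ≤ I Y := fun f hf =>
      vanishingIdeal_anti (Subtype.coe_image_subset _ _) (hψ f hf)
    have h1 : d Y ≤ Algebra.trdeg ℂ (MvPolynomial ι ℂ ⧸ RingHom.ker ψ) :=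
      _root_.trdeg_le_of_surjective (Ideal.Quotient.factorₐ ℂ hker)
        (Ideal.Quotient.factor_surjective hker)
    have h2 : Algebra.trdeg ℂ (MvPolynomial ι ℂ ⧸ RingHom.ker ψ) ≤
        Algebra.trdeg ℂ (MvPolynomial (Fin (n + 1)) ℂ) :=
      _root_.trdeg_le_of_injective (Ideal.kerLiftAlg ψ) (Ideal.kerLiftAlg_injective ψ)
    rw [MvPolynomial.trdeg_of_isDomain, Cardinal.mk_fin, Cardinal.lift_natCast] at h2
    exact h1.trans h2
  have hpos : ∀ Y, 1 ≤ d Y := by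
    intro Y
    have := hprime Y
    have hp0 : (RingHom.ker (eval (0 : ι → ℂ))).IsPrime := RingHom.ker_isPrime _
    obtain ⟨z, hz⟩ := Y.isIrreducible.1
    have hlt0 : I Y < RingHom.ker (eval (0 : ι → ℂ)) := by
      refine lt_of_le_not_ge (fun f hf => ?_) fun hle => ?_
      · simpa using hf z ⟨z, hz, rfl⟩ 0
      · obtain ⟨i, hi⟩ := Function.ne_iff.mp (rep_ne_zero z.1)
        have := hle (show (X i : MvPolynomial ι ℂ) ∈ _ by simp [RingHom.mem_ker])
          z ⟨z, hz, rfl⟩ 1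
        simp only [one_smul, eval_X] at this
        exact hi this
    exact le_trans (by simp) (trdeg_quotient_lt hlt0)
  have hnat : ∀ Y, ∃ k : ℕ, d Y = (k + 1 : ℕ) ∧ k ≤ n := by
    intro Y
    obtain ⟨k, hk⟩ := Cardinal.lt_aleph0.mp ((hle Y).trans_lt (Cardinal.natCast_lt_aleph0))
    have h1 := hle Y
    have h2 := hpos Y
    rw [hk] at h1 h2
    have h1' : k ≤ n + 1 := by exact_mod_cast h1
    have h2' : 1 ≤ k := by exact_mod_cast h2
    exact ⟨k - 1, by rw [hk]; congr 1; omega, by omega⟩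
  choose k hk hkn using hnat
  refine krullDim_le_of_strictMono_fin n k (fun Y Y' h => ?_) hkn
  have := hlt Y Y' h
  rw [hk, hk] at this
  have h3 : k Y + 1 + 1 ≤ k Y' + 1 := by exact_mod_cast this
  omega

/-- An irreducible closed subset of a closed set `Z`, as an irreducible closed subset of the
subspace `Z`. -/
def restrictClosed {X : Type*} [TopologicalSpace X] {Z A : Set X} (hZ : IsClosed Z)
    (hA : IsClosed A) (hirr : IsIrreducible A) (h : A ⊆ Z) :
    TopologicalSpace.IrreducibleCloseds Z where
  carrier := Subtype.val ⁻¹' A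
  isClosed' := hA.preimage continuous_subtype_val
  isIrreducible' := by
    refine ⟨?_, ?_⟩
    · obtain ⟨a, ha⟩ := hirr.1
      exact ⟨⟨a, h ha⟩, ha⟩
    · rw [isPreirreducible_iff_isClosed_union_isClosed]
      intro y z hy hz hyz
      have hm := hZ.isClosedEmbedding_subtypeVal.isClosedMap
      have hsub : A ⊆ Subtype.val '' y ∪ Subtype.val '' z := by
        intro a ha
        rcases hyz (show (⟨a, h ha⟩ : Z) ∈ Subtype.val ⁻¹' A from ha) with h1 | h1
        · exact Or.inl ⟨_, h1, rfl⟩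
        · exact Or.inr ⟨_, h1, rfl⟩
      rcases isPreirreducible_iff_isClosed_union_isClosed.mp hirr.2 _ _ (hm y hy) (hm z hz) hsub
        with h1 | h1
      · left
        intro a ha
        obtain ⟨b, hb, hba⟩ := h1 ha
        rwa [← Subtype.ext hba]
      · right
        intro a ha
        obtain ⟨b, hb, hba⟩ := h1 ha
        rwa [← Subtype.ext hba]

theorem restrictClosed_lt {X : Type*} [TopologicalSpace X] {Z A B : Set X} (hZ : IsClosed Z)
    (hA : IsClosed A) (hAi : IsIrreducible A) (hAZ : A ⊆ Z) (hB : IsClosed B)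
    (hBi : IsIrreducible B) (hBZ : B ⊆ Z) (h : A ⊂ B) :
    restrictClosed hZ hA hAi hAZ < restrictClosed hZ hB hBi hBZ := by
  obtain ⟨b, hb, hbA⟩ := Set.exists_of_ssubset h
  refine lt_of_le_not_ge (fun a ha => h.subset ha) fun hle => hbA ?_
  exact hle (show (⟨b, hBZ hb⟩ : Z) ∈ Subtype.val ⁻¹' B from hb)

theorem two_le_topologicalKrullDim {X : Type*} [TopologicalSpace X] {A B Z : Set X}
    (hZ : IsClosed Z) (hZi : IsIrreducible Z) (hA : IsClosed A) (hAi : IsIrreducible A)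
    (hB : IsClosed B) (hBi : IsIrreducible B) (hAB : A ⊂ B) (hBZ : B ⊂ Z) :
    2 ≤ topologicalKrullDim Z := by
  have h1 := restrictClosed_lt hZ hA hAi (hAB.subset.trans hBZ.subset) hB hBi hBZ.subset hAB
  have h2 := restrictClosed_lt hZ hB hBi hBZ.subset hZ hZi subset_rfl hBZ
  have hmono : StrictMono ![restrictClosed hZ hA hAi (hAB.subset.trans hBZ.subset),
      restrictClosed hZ hB hBi hBZ.subset, restrictClosed hZ hZ hZi subset_rfl] := by
    refine Fin.strictMono_iff_lt_succ.mpr fun i => ?_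
    fin_cases i
    · exact h1
    · exact h2
  exact Order.LTSeries.length_le_krullDim (LTSeries.mk 2 _ hmono)

theorem one_le_topologicalKrullDim {X : Type*} [TopologicalSpace X] {A Z : Set X}
    (hZ : IsClosed Z) (hZi : IsIrreducible Z) (hA : IsClosed A) (hAi : IsIrreducible A)
    (hAZ : A ⊂ Z) : 1 ≤ topologicalKrullDim Z := by
  have h1 := restrictClosed_lt hZ hA hAi hAZ.subset hZ hZi subset_rfl hAZ
  have hmono : StrictMono ![restrictClosed hZ hA hAi hAZ.subset,
      restrictClosed hZ hZ hZi subset_rfl] := by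
    refine Fin.strictMono_iff_lt_succ.mpr fun i => ?_
    fin_cases i
    exact h1
  exact Order.LTSeries.length_le_krullDim (LTSeries.mk 1 _ hmono)

/-! ### Curves -/

theorem eq_singleton_of_finite {X : Type*} [TopologicalSpace X] [T1Space X] {W : Set X}
    (hW : IsIrreducible W) (hfin : W.Finite) : ∃ p, W = {p} := by
  obtain ⟨p, hp⟩ := hW.1
  refine ⟨p, Set.Subset.antisymm ?_ (Set.singleton_subset_iff.mpr hp)⟩
  rcases isPreirreducible_iff_isClosed_union_isClosed.mp hW.2 {p} (W \ {p})
    isClosed_singleton (hfin.subset Set.sdiff_subset).isClosed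
    (fun x hx => by by_cases h : x = p <;> simp [h, hx]) with h | h
  · exact h
  · exact absurd rfl (h hp).2

/-- A closed set is minimal among the infinite ones: in projective space, these are the curves. -/
structure IsMinimalInfinite {X : Type*} [TopologicalSpace X] (C : Set X) : Prop where
  isClosed : IsClosed C
  infinite : C.Infinite
  eq_of_infinite : ∀ A ⊆ C, IsClosed A → A.Infinite → A = C

namespace IsMinimalInfinite

variable {X : Type*} [TopologicalSpace X] {C : Set X}

theorem isIrreducible (h : IsMinimalInfinite C) : IsIrreducible C := by
  refine ⟨h.infinite.nonempty, ?_⟩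
  rw [isPreirreducible_iff_isClosed_union_isClosed]
  intro y z hy hz hC
  have hU : C = C ∩ y ∪ C ∩ z := by
    rw [← Set.inter_union_distrib_left, Set.inter_eq_left.mpr hC]
  have hinf := h.infinite
  rw [hU, Set.infinite_union] at hinf
  rcases hinf with h1 | h1
  · left
    rw [← h.eq_of_infinite _ Set.inter_subset_left (h.isClosed.inter hy) h1]
    exact Set.inter_subset_right
  · right
    rw [← h.eq_of_infinite _ Set.inter_subset_left (h.isClosed.inter hz) h1]
    exact Set.inter_subset_right

theorem eq_singleton_or_eq [T1Space X] (h : IsMinimalInfinite C) {W : Set X} (hW : IsClosed W)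
    (hWi : IsIrreducible W) (hWC : W ⊆ C) : (∃ p, W = {p}) ∨ W = C := by
  by_cases hf : W.Finite
  · exact Or.inl (eq_singleton_of_finite hWi hf)
  · exact Or.inr (h.eq_of_infinite W hWC hW hf)

theorem topologicalKrullDim_eq [T1Space X] (h : IsMinimalInfinite C) :
    topologicalKrullDim C = 1 := by
  apply le_antisymm
  · classical
    refine krullDim_le_of_strictMono_fin 1 (fun Y : TopologicalSpace.IrreducibleCloseds C =>
      if (Y : Set C) = Set.univ then 1 else 0) (fun Y Y' hlt => ?_) (fun Y => by
        split_ifs <;> simp)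
    have hss : (Y : Set C) ⊂ Y' := hlt
    have hY : (Y : Set C) ≠ Set.univ := by
      intro h0
      rw [h0] at hss
      exact hss.not_subset (Set.subset_univ _)
    have hY' : (Y' : Set C) = Set.univ := by
      have hcl : IsClosed (Subtype.val '' (Y' : Set C)) :=
        h.isClosed.isClosedEmbedding_subtypeVal.isClosedMap _ Y'.isClosed
      have hirr := Y'.isIrreducible.image _ continuous_subtype_val.continuousOn
      rcases h.eq_singleton_or_eq hcl hirr (Subtype.coe_image_subset _ _) with ⟨p, hp⟩ | h1
      · exfalso
        obtain ⟨a, ha⟩ := Y.isIrreducible.1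
        obtain ⟨b, hb, hbY⟩ := Set.exists_of_ssubset hss
        have h1 : (a : X) = p := by
          have : (a : X) ∈ Subtype.val '' (Y' : Set C) := ⟨a, hss.subset ha, rfl⟩
          rwa [hp] at this
        have h2 : (b : X) = p := by
          have : (b : X) ∈ Subtype.val '' (Y' : Set C) := ⟨b, hb, rfl⟩
          rwa [hp] at this
        exact hbY (Subtype.ext (h2.trans h1.symm) ▸ ha)
      · ext x
        simp only [Set.mem_univ, iff_true]
        have : (x : X) ∈ Subtype.val '' (Y' : Set C) := by rw [h1]; exact x.2
        obtain ⟨y, hy, hyx⟩ := this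
        rwa [← Subtype.ext hyx]
    simp [hY, hY']
  · obtain ⟨p, hp⟩ := h.infinite.nonempty
    refine one_le_topologicalKrullDim (A := {p}) h.isClosed h.isIrreducible isClosed_singleton
      isIrreducible_singleton ?_
    refine (Set.singleton_subset_iff.mpr hp).ssubset_of_ne fun h0 => h.infinite ?_
    rw [← h0]
    exact Set.finite_singleton p

end IsMinimalInfinite

theorem IsMinimalInfinite.isCurve {ι : Type} {C : Set (PSpace ι)} (h : IsMinimalInfinite C) :
    IsCurve C := ⟨⟨h.isClosed, h.isIrreducible⟩, h.topologicalKrullDim_eq⟩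

/-- An infinite closed subset of a curve has an infinite irreducible component; if it were not the
whole curve, there would be a chain of a point, the component and the curve. -/
theorem eq_of_infinite_of_isCurve {ι : Type} [Finite ι] {V A : Set (PSpace ι)} (hV : IsCurve V)
    (hAV : A ⊆ V) (hA : IsClosed A) (hinf : A.Infinite) : A = V := by
  obtain ⟨S, hSf, hSc, hSi, rfl⟩ :=
    TopologicalSpace.NoetherianSpace.exists_finite_set_isClosed_irreducible hA
  have : ∃ B ∈ S, B.Infinite := by
    by_contra hn
    push Not at hn
    exact hinf (hSf.sUnion hn)
  obtain ⟨B, hB, hBinf⟩ := this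
  have hBV : B ⊆ V := (Set.subset_sUnion_of_mem hB).trans hAV
  by_cases hne : B = V
  · exact Set.Subset.antisymm hAV (hne ▸ Set.subset_sUnion_of_mem hB)
  exfalso
  obtain ⟨p, hp⟩ := hBinf.nonempty
  have h2 := two_le_topologicalKrullDim (A := {p}) hV.1.1 hV.1.2 isClosed_singleton
    isIrreducible_singleton (hSc B hB) (hSi B hB)
    ((Set.singleton_subset_iff.mpr hp).ssubset_of_ne fun h0 => hBinf (h0 ▸ Set.finite_singleton p))
    (hBV.ssubset_of_ne hne)
  rw [hV.2] at h2
  exact absurd h2 (by decide)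

end PSpace

end LineCongruence

namespace LineCongruence

open Module Matrix

/-! ### Factorizations of a scalar cubic into linear operator polynomials -/

section Spectral

variable {V : Type} [AddCommGroup V] [Module ℂ V]

/-- The product of two of the factors of a scalar cubic, at the root `c`, is a polynomial in the
third. -/
theorem mul_sub_eq_of_factorization {T T' N : End ℂ V} {a b c : ℂ}
    (h1 : N + T + T' = (a + b + c) • 1)
    (h2 : N * T + N * T' + T * T' = (a * b + a * c + b * c) • 1) :
    (c • 1 - T) * (c • 1 - T') = (N - a • 1) * (N - b • 1) := by
  have e1 : T + T' = (a + b + c) • 1 - N := by rw [← h1]; abel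
  have e2 : T * T' = (a * b + a * c + b * c) • 1 - N * ((a + b + c) • 1 - N) := by
    rw [← h2, ← e1, mul_add]; abel
  have e3 : (c • 1 - T) * (c • 1 - T') = (c * c) • 1 - c • (T + T') + T * T' := by
    simp only [sub_mul, mul_sub, smul_mul_assoc, mul_smul_comm, one_mul, mul_one]
    module
  rw [e3, e2, e1]
  simp only [sub_mul, mul_sub, smul_mul_assoc, mul_smul_comm, one_mul, mul_one]
  module

variable [FiniteDimensional ℂ V]

theorem finrank_ker_mul_le (f g : End ℂ V) :
    finrank ℂ (LinearMap.ker (f * g)) ≤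
      finrank ℂ (LinearMap.ker f) + finrank ℂ (LinearMap.ker g) := by
  let h : LinearMap.ker (f * g) →ₗ[ℂ] V := g.domRestrict (LinearMap.ker (f * g))
  have h1 := LinearMap.finrank_range_add_finrank_ker h
  have h2 : finrank ℂ (LinearMap.range h) ≤ finrank ℂ (LinearMap.ker f) := by
    apply Submodule.finrank_mono
    rintro _ ⟨x, rfl⟩
    exact x.2
  have h3 : finrank ℂ (LinearMap.ker h) ≤ finrank ℂ (LinearMap.ker g) := by
    let k : LinearMap.ker h →ₗ[ℂ] LinearMap.ker g :=
      LinearMap.codRestrict _ ((Submodule.subtype _).comp (Submodule.subtype _)) fun x => x.2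
    refine LinearMap.finrank_le_finrank_of_injective (f := k) fun x y hxy => ?_
    exact Subtype.ext (Subtype.ext (congrArg (fun z : LinearMap.ker g => (z : V)) hxy))
  omega

theorem mul_comm_of_mul_eq_smul_one {f g : End ℂ V} {c : ℂ} (hc : c ≠ 0) (h : f * g = c • 1) :
    g * f = c • 1 := by
  have h1 : f * (c⁻¹ • g) = 1 := by rw [mul_smul_comm, h, smul_smul, inv_mul_cancel₀ hc, one_smul]
  have h2 := _root_.mul_eq_one_comm.mp h1
  rw [smul_mul_assoc] at h2
  rw [← h2, smul_smul, mul_inv_cancel₀ hc, one_smul]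

/-- An operator-valued quadratic polynomial with infinitely many zeros vanishes. -/
theorem quadratic_eq_zero {A₀ A₁ A₂ : End ℂ V} (s : Set ℂ) (hs : s.Infinite)
    (h : ∀ x ∈ s, x ^ 2 • A₂ + x • A₁ + A₀ = 0) : A₂ = 0 ∧ A₁ = 0 ∧ A₀ = 0 := by
  have key : ∀ (l : Module.Dual ℂ V) (v : V), l (A₂ v) = 0 ∧ l (A₁ v) = 0 ∧ l (A₀ v) = 0 := by
    intro l v
    have hp : Polynomial.C (l (A₂ v)) * Polynomial.X ^ 2 + Polynomial.C (l (A₁ v)) * Polynomial.X +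
        Polynomial.C (l (A₀ v)) = 0 := by
      refine Polynomial.eq_zero_of_infinite_isRoot _ (hs.mono fun x hx => ?_)
      have := congrArg l (congrArg (fun f : End ℂ V => f v) (h x hx))
      simp only [LinearMap.add_apply, LinearMap.smul_apply, map_add, map_smul, smul_eq_mul,
        LinearMap.zero_apply, map_zero] at this
      simp only [Set.mem_ofPred_eq, Polynomial.IsRoot, Polynomial.eval_add, Polynomial.eval_mul,
        Polynomial.eval_C, Polynomial.eval_pow, Polynomial.eval_X]
      linear_combination this
    refine ⟨?_, ?_, ?_⟩
    · simpa using congrArg (fun p => Polynomial.coeff p 2) hp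
    · simpa [Polynomial.coeff_X] using congrArg (fun p => Polynomial.coeff p 1) hp
    · simpa using congrArg (fun p => Polynomial.coeff p 0) hp
  have hz : ∀ f : End ℂ V, (∀ (l : Module.Dual ℂ V) (v : V), l (f v) = 0) → f = 0 := fun f hf =>
    LinearMap.ext fun v => (Module.forall_dual_apply_eq_zero_iff ℂ _).mp fun l => hf l v
  exact ⟨hz _ fun l v => (key l v).1, hz _ fun l v => (key l v).2.1, hz _ fun l v => (key l v).2.2⟩

theorem infinite_cubic_ne_zero (a b c : ℂ) :
    {x : ℂ | (x - a) * (x - b) * (x - c) ≠ 0}.Infinite := by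
  have : ({a, b, c} : Set ℂ)ᶜ.Infinite := Set.Finite.infinite_compl (by simp)
  refine this.mono fun x hx => ?_
  simp only [Set.mem_compl_iff, Set.mem_insert_iff, Set.mem_singleton_iff, not_or] at hx
  exact mul_ne_zero (mul_ne_zero (sub_ne_zero.mpr hx.1) (sub_ne_zero.mpr hx.2.1))
    (sub_ne_zero.mpr hx.2.2)

/-- A factorization of a scalar cubic into linear operator polynomials may be permuted cyclically;
comparing coefficients gives the elementary symmetric relations. -/
theorem cubic_factorization {T T' N : End ℂ V} {a b c : ℂ}
    (H : ∀ x : ℂ, (x • 1 - T') * (x • 1 - N) * (x • 1 - T) =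
      ((x - a) * (x - b) * (x - c)) • (1 : End ℂ V)) :
    N + T + T' = (a + b + c) • 1 ∧ N * T + N * T' + T * T' = (a * b + a * c + b * c) • 1 ∧
      N * T * T' = (a * b * c) • 1 := by
  have hcyc : ∀ x ∈ {x : ℂ | (x - a) * (x - b) * (x - c) ≠ 0},
      x ^ 2 • ((a + b + c) • 1 - (N + T + T')) +
        x • ((N * T + N * T' + T * T') - (a * b + a * c + b * c) • 1) +
        ((a * b * c) • 1 - N * T * T') = 0 := by
    intro x hx
    have h1 := H x
    rw [mul_assoc] at h1
    have h2 := mul_comm_of_mul_eq_smul_one hx h1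
    have h3 : (x • 1 - N) * (x • 1 - T) * (x • 1 - T') - ((x - a) * (x - b) * (x - c)) •
        (1 : End ℂ V) = 0 := sub_eq_zero.mpr h2
    rw [← h3]
    simp only [sub_mul, mul_sub, smul_mul_assoc, mul_smul_comm, one_mul, mul_one, smul_sub]
    module
  obtain ⟨h1, h2, h3⟩ := quadratic_eq_zero _ (infinite_cubic_ne_zero a b c) hcyc
  exact ⟨(sub_eq_zero.mp h1).symm, sub_eq_zero.mp h2, (sub_eq_zero.mp h3).symm⟩

/-- On a four-dimensional space, suppose that `(N - a)(N - b)²` vanishes and `(N - a)(N - b)` does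
not, and that `b` is an eigenvalue of multiplicity at most two or equal to `a`. Then
`(N - a)(N - b)` has rank one. -/
theorem finrank_ker_ge_three (hV : finrank ℂ V = 4) {N : End ℂ V} {a b : ℂ}
    (h0 : (N - a • 1) * (N - b • 1) ≠ 0)
    (h : (N - a • 1) * (N - b • 1) * (N - b • 1) = 0)
    (hmult : N.charpoly.rootMultiplicity b ≤ 2 ∨ a = b) :
    3 ≤ finrank ℂ (LinearMap.ker ((N - a • 1) * (N - b • 1))) := by
  have hle := finrank_ker_mul_le ((N - a • 1) * (N - b • 1)) (N - b • 1)
  rw [h, LinearMap.ker_zero, finrank_top, hV] at hle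
  by_contra hlt
  have hb : 2 ≤ finrank ℂ (LinearMap.ker (N - b • 1)) := by omega
  by_cases hab : a = b
  · subst hab
    set A := N - a • (1 : End ℂ V) with hA
    have h1 := LinearMap.finrank_range_add_finrank_ker A
    have h2 := LinearMap.finrank_range_add_finrank_ker (A * A)
    rw [hV] at h1 h2
    have hsub : LinearMap.range (A * A) ≤ LinearMap.range A := by
      rintro _ ⟨x, rfl⟩
      exact ⟨A x, rfl⟩
    have heq : LinearMap.range (A * A) = LinearMap.range A :=
      Submodule.eq_of_le_of_finrank_le hsub (by omega)
    apply h0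
    ext x
    obtain ⟨y, hy⟩ : A x ∈ LinearMap.range (A * A) := heq ▸ ⟨x, rfl⟩
    change A (A x) = 0
    rw [← hy]
    have := congrArg (fun f : End ℂ V => f y) h
    exact this
  · have hgen : ∀ k : ℕ, finrank ℂ (LinearMap.ker ((N - b • 1) ^ k)) ≤ 2 := by
      intro k
      refine le_trans ?_ (hmult.resolve_right hab)
      have := LinearMap.finrank_genEigenspace_le N b k
      rwa [Module.End.genEigenspace_nat] at this
    have h4 := finrank_ker_mul_le (N - a • 1) ((N - b • 1) ^ 2)
    rw [pow_two, ← mul_assoc, h, LinearMap.ker_zero, finrank_top, hV, ← pow_two] at h4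
    have ha : 2 ≤ finrank ℂ (LinearMap.ker (N - a • 1)) := by have := hgen 2; omega
    have hdisj : LinearMap.ker (N - a • 1) ⊓ LinearMap.ker (N - b • 1) = ⊥ := by
      rw [eq_bot_iff]
      rintro x ⟨hx1, hx2⟩
      simp only [SetLike.mem_coe, LinearMap.mem_ker, LinearMap.sub_apply, LinearMap.smul_apply,
        Module.End.one_apply] at hx1 hx2
      have h5 : (a - b) • x = 0 := by
        rw [sub_smul, ← sub_eq_zero.mp hx1, ← sub_eq_zero.mp hx2, sub_self]
      exact (smul_eq_zero.mp h5).resolve_left (sub_ne_zero.mpr hab)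
    have hsum := Submodule.finrank_sup_add_finrank_inf_eq (LinearMap.ker (N - a • 1))
      (LinearMap.ker (N - b • 1))
    rw [hdisj, finrank_bot] at hsum
    have hcomm : (N - a • 1) * (N - b • 1) = (N - b • 1) * (N - a • 1) := by
      simp only [sub_mul, mul_sub, smul_mul_assoc, mul_smul_comm, one_mul, mul_one]
      module
    have hk : LinearMap.ker (N - a • 1) ⊔ LinearMap.ker (N - b • 1) ≤
        LinearMap.ker ((N - a • 1) * (N - b • 1)) := by
      refine sup_le ?_ ?_
      · intro x hx
        rw [hcomm]
        change (N - b • 1) ((N - a • 1) x) = 0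
        rw [LinearMap.mem_ker.mp hx, map_zero]
      · intro x hx
        change (N - a • 1) ((N - b • 1) x) = 0
        rw [LinearMap.mem_ker.mp hx, map_zero]
    have := Submodule.finrank_mono hk
    omega

/-- Comparing determinants in the factorization of a scalar cubic gives a relation between the
multiplicities of the roots. -/
theorem rootMultiplicity_of_factorization (hV : finrank ℂ V = 4) {T T' N : End ℂ V} {a b c : ℂ}
    (H : ∀ x : ℂ, (x • 1 - T') * (x • 1 - N) * (x • 1 - T) =
      ((x - a) * (x - b) * (x - c)) • (1 : End ℂ V))
    (hT' : T'.charpoly = T.charpoly) (x : ℂ) :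
    N.charpoly.rootMultiplicity x + 2 * T.charpoly.rootMultiplicity x =
      4 * Multiset.count x {a, b, c} := by
  classical
  have hpoly : N.charpoly * (T.charpoly * T.charpoly) =
      ((Polynomial.X - Polynomial.C a) * (Polynomial.X - Polynomial.C b) *
        (Polynomial.X - Polynomial.C c)) ^ 4 := by
    refine Polynomial.funext fun y => ?_
    have h1 := congrArg LinearMap.det (H y)
    rw [map_mul, map_mul, LinearMap.det_smul, hV, map_one, mul_one] at h1
    rw [Polynomial.eval_mul, Polynomial.eval_mul]
    nth_rewrite 2 [← hT']
    simp only [LinearMap.eval_charpoly, Algebra.algebraMap_eq_smul_one]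
    simp only [Polynomial.eval_pow, Polynomial.eval_mul, Polynomial.eval_sub, Polynomial.eval_X,
      Polynomial.eval_C]
    linear_combination h1
  have hN0 := N.charpoly_monic.ne_zero
  have hT0 := T.charpoly_monic.ne_zero
  have hroots := congrArg (fun p => Multiset.count x p.roots) hpoly
  have hK : (Polynomial.X - Polynomial.C a) * (Polynomial.X - Polynomial.C b) *
      (Polynomial.X - Polynomial.C c) =
        (Multiset.map (fun z => Polynomial.X - Polynomial.C z) {a, b, c}).prod := by
    simp [mul_assoc]
  simp only [Polynomial.roots_mul (mul_ne_zero hN0 (mul_ne_zero hT0 hT0)),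
    Polynomial.roots_mul (mul_ne_zero hT0 hT0), Polynomial.roots_pow, hK,
    Polynomial.roots_multiset_prod_X_sub_C, Multiset.count_add, Multiset.count_nsmul,
    Polynomial.count_roots] at hroots
  omega

theorem one_le_rootMultiplicity_of_mul_eq_zero {N P : End ℂ V} {c : ℂ}
    (h : (c • 1 - N) * P = 0) (hP : P ≠ 0) : 1 ≤ N.charpoly.rootMultiplicity c := by
  rw [Nat.one_le_iff_ne_zero, ← Nat.pos_iff_ne_zero,
    Polynomial.rootMultiplicity_pos N.charpoly_monic.ne_zero, Polynomial.IsRoot,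
    LinearMap.eval_charpoly, Algebra.algebraMap_eq_smul_one]
  by_contra hdet
  apply hP
  have hu := (LinearMap.isUnit_iff_isUnit_det (c • 1 - N)).mpr (isUnit_iff_ne_zero.mpr hdet)
  exact hu.mul_right_eq_zero.mp h

/-- The case of a double root: the multiplicities of the roots leave only the double root for
eigenvalues of multiplicity at least two of `T`. -/
theorem exists_root_of_double (hV : finrank ℂ V = 4) {T T' N : End ℂ V} {a b : ℂ}
    (H : ∀ x : ℂ, (x • 1 - T') * (x • 1 - N) * (x • 1 - T) =
      ((x - a) * (x - b) * (x - b)) • (1 : End ℂ V))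
    (hT' : T'.charpoly = T.charpoly)
    (hP : ∀ x : ℂ, (x • 1 - T) * (x • 1 - T') ≠ 0)
    (hroot : ∀ x : ℂ, x = a ∨ x = b → 1 ≤ N.charpoly.rootMultiplicity x) :
    ∃ r : ℂ, 3 ≤ finrank ℂ (LinearMap.ker ((r • 1 - T) * (r • 1 - T'))) ∧
      ∀ x, x ≠ r → T.charpoly.rootMultiplicity x ≤ 1 := by
  classical
  have hm := rootMultiplicity_of_factorization hV H hT'
  obtain ⟨h1, h2, h3⟩ := cubic_factorization H
  have hPb := mul_sub_eq_of_factorization h1 h2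
  refine ⟨b, ?_, fun x hx => ?_⟩
  · rw [hPb]
    refine finrank_ker_ge_three hV (hPb ▸ hP b) ?_ ?_
    · rw [← hPb]
      have : N * ((b • 1 - T) * (b • 1 - T')) = b • ((b • 1 - T) * (b • 1 - T')) := by
        have e : (b • 1 - T) * (b • 1 - T') = (b * b) • 1 - b • (T + T') + T * T' := by
          simp only [sub_mul, mul_sub, smul_mul_assoc, mul_smul_comm, one_mul, mul_one]
          module
        have e1 : T + T' = (a + b + b) • 1 - N := by rw [← h1]; abel
        have e2 : T * T' = (a * b + a * b + b * b) • 1 - (N * T + N * T') := by rw [← h2]; abel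
        have e3 : N * (T * T') = (a * b * b) • 1 := by rw [← mul_assoc, h3]
        have e4 : N * T + N * T' = (a + b + b) • N - N * N := by
          rw [← mul_add, e1, mul_sub, mul_smul_comm, mul_one]
        rw [e, mul_add, e3, e2, e1, e4]
        simp only [mul_sub, mul_smul_comm, mul_one]
        module
      have hcomm : (N - a • 1) * (N - b • 1) * (N - b • 1) =
          (N - b • 1) * ((N - a • 1) * (N - b • 1)) := by
        simp only [sub_mul, mul_sub, smul_mul_assoc, mul_smul_comm, one_mul, mul_one, mul_assoc]
        module
      rw [hPb] at this ⊢
      rw [hcomm, sub_mul, this, smul_mul_assoc, one_mul, sub_self]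
    · by_cases hab : a = b
      · exact Or.inr hab
      · left
        have ha := hroot a (Or.inl rfl)
        have hb := hroot b (Or.inr rfl)
        have hNa := hm a
        have hNb := hm b
        have ca : Multiset.count a {a, b, b} = 1 := by simp [hab]
        have cb : Multiset.count b {a, b, b} = 2 := by simp [Ne.symm hab]
        rw [ca] at hNa
        rw [cb] at hNb
        have hcard : N.charpoly.rootMultiplicity a + N.charpoly.rootMultiplicity b ≤ 4 := by
          have hle : Multiset.replicate (N.charpoly.rootMultiplicity a) a +
              Multiset.replicate (N.charpoly.rootMultiplicity b) b ≤ N.charpoly.roots := by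
            rw [Multiset.le_iff_count]
            intro x
            rw [Multiset.count_add, Multiset.count_replicate, Multiset.count_replicate,
              Polynomial.count_roots]
            split_ifs with h5 h6 h6
            · exact absurd (h5.trans h6.symm) hab
            · simp [h5]
            · simp [h6]
            · simp
          have h7 := Multiset.card_le_card hle
          have h8 := N.charpoly.card_roots'
          rw [LinearMap.charpoly_natDegree, hV] at h8
          simp only [Multiset.card_add, Multiset.card_replicate] at h7
          omega
        omega
  · have h4 := hm x
    by_cases hxa : x = a
    · have := hroot x (Or.inl hxa)
      have hc : Multiset.count x {a, b, b} = 1 := by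
        subst hxa
        simp [hx]
      omega
    · have hc : Multiset.count x {a, b, b} = 0 := by simp [hx, hxa]
      omega

/-- If a scalar cubic factors into linear operator polynomials, the outer two with the same
characteristic polynomial and such that their product never vanishes, then at some root `r` this
product has rank at most one, and the other eigenvalues of `T` are simple. The relation between the
multiplicities excludes that the cubic has three distinct roots. -/
theorem exists_root_of_factorization (hV : finrank ℂ V = 4) {T T' N : End ℂ V} {a b c : ℂ}
    (H : ∀ x : ℂ, (x • 1 - T') * (x • 1 - N) * (x • 1 - T) =
      ((x - a) * (x - b) * (x - c)) • (1 : End ℂ V))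
    (hT' : T'.charpoly = T.charpoly)
    (hP : ∀ x : ℂ, (x • 1 - T) * (x • 1 - T') ≠ 0) :
    ∃ r : ℂ, 3 ≤ finrank ℂ (LinearMap.ker ((r • 1 - T) * (r • 1 - T'))) ∧
      ∀ x, x ≠ r → T.charpoly.rootMultiplicity x ≤ 1 := by
  classical
  have hcyc : ∀ x : ℂ, (x • 1 - N) * ((x • 1 - T) * (x • 1 - T')) =
      ((x - a) * (x - b) * (x - c)) • (1 : End ℂ V) := by
    obtain ⟨h1, h2, h3⟩ := cubic_factorization H
    intro x
    have e : (x • 1 - N) * ((x • 1 - T) * (x • 1 - T')) = (x ^ 3) • (1 : End ℂ V) -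
        x ^ 2 • (N + T + T') + x • (N * T + N * T' + T * T') - N * T * T' := by
      simp only [sub_mul, mul_sub, smul_mul_assoc, mul_smul_comm, one_mul, mul_one, smul_sub,
        mul_assoc]
      module
    rw [e, h1, h2, h3]
    module
  have hroot : ∀ x, (x - a) * (x - b) * (x - c) = 0 → 1 ≤ N.charpoly.rootMultiplicity x := by
    intro x hx
    refine one_le_rootMultiplicity_of_mul_eq_zero (P := (x • 1 - T) * (x • 1 - T')) ?_ (hP x)
    rw [hcyc, hx, zero_smul]
  by_cases hbc : b = c
  · subst hbc
    refine exists_root_of_double hV H hT' hP fun x hx => hroot x ?_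
    rcases hx with rfl | rfl <;> ring
  by_cases hab : a = b
  · subst hab
    refine exists_root_of_double (a := c) (b := a) hV (fun x => ?_) hT' hP fun x hx => hroot x ?_
    · rw [H]; congr 1; ring
    · rcases hx with rfl | rfl <;> ring
  by_cases hac : a = c
  · subst hac
    refine exists_root_of_double (a := b) (b := a) hV (fun x => ?_) hT' hP fun x hx => hroot x ?_
    · rw [H]; congr 1; ring
    · rcases hx with rfl | rfl <;> ring
  exfalso
  -- three distinct roots would be eigenvalues of `N` of even multiplicity
  have hm := rootMultiplicity_of_factorization hV H hT'
  have h2 : ∀ x, x = a ∨ x = b ∨ x = c → 2 ≤ N.charpoly.rootMultiplicity x := by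
    intro x hx
    have h1 := hroot x (by rcases hx with rfl | rfl | rfl <;> ring)
    have := hm x
    omega
  have hle : Multiset.replicate 2 a + Multiset.replicate 2 b + Multiset.replicate 2 c ≤
      N.charpoly.roots := by
    rw [Multiset.le_iff_count]
    intro x
    rw [Multiset.count_add, Multiset.count_add, Multiset.count_replicate,
      Multiset.count_replicate, Multiset.count_replicate, Polynomial.count_roots]
    have h3 := h2 x
    split_ifs with i1 i2 i3 i3 i2 i3 i3
    · exact absurd (i1.trans i2.symm) hab
    · exact absurd (i1.trans i2.symm) hab
    · exact absurd (i1.trans i3.symm) hac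
    · exact h3 (Or.inl i1.symm)
    · exact absurd (i2.trans i3.symm) hbc
    · exact h3 (Or.inr (Or.inl i2.symm))
    · exact h3 (Or.inr (Or.inr i3.symm))
    · simp
  have h7 := Multiset.card_le_card hle
  have h8 := N.charpoly.card_roots'
  rw [LinearMap.charpoly_natDegree, hV] at h8
  simp only [Multiset.card_add, Multiset.card_replicate] at h7
  omega

end Spectral

/-! ### Slices of a trilinear map -/

section Slices

variable {R : Type} [CommRing R] [Algebra ℂ R]

/-- Coefficients of four trilinear forms: `a i j k l` is the coefficient of `s_j t_k u_l` in the
`i`-th form. -/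
abbrev TriCoeff : Type := Fin 4 → Fin 2 → Fin 2 → Fin 2 → ℂ

/-- The values of the four trilinear forms with given coefficients. -/
def tri (a : TriCoeff) (s t u : Fin 2 → R) : Fin 4 → R :=
  fun i => ∑ j, ∑ k, ∑ l, algebraMap ℂ R (a i j k l) * (s j * t k * u l)

/-- The coordinates of the rank one tensor `t ⊗ u`. -/
def tens (t u : Fin 2 → R) : Fin 4 → R := ![t 0 * u 0, t 0 * u 1, t 1 * u 0, t 1 * u 1]

/-- The linear map `t ⊗ u ↦ f(s, t, u)`, for fixed `s`. -/
def slice (a : TriCoeff) (s : Fin 2 → ℂ) : Matrix (Fin 4) (Fin 4) ℂ :=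
  Matrix.of fun i => ![s 0 * a i 0 0 0 + s 1 * a i 1 0 0, s 0 * a i 0 0 1 + s 1 * a i 1 0 1,
    s 0 * a i 0 1 0 + s 1 * a i 1 1 0, s 0 * a i 0 1 1 + s 1 * a i 1 1 1]

/-- The determinant of two vectors of the plane. -/
def det2 (x y : Fin 2 → ℂ) : ℂ := x 0 * y 1 - x 1 * y 0

theorem tri_eq_slice (a : TriCoeff) (s t u : Fin 2 → ℂ) :
    tri a s t u = slice a s *ᵥ tens t u := by
  funext i
  simp only [tri, slice, tens, Matrix.mulVec, dotProduct, Fin.sum_univ_two, Fin.sum_univ_four,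
    Matrix.of_apply, Matrix.cons_val, Algebra.algebraMap_self, RingHom.id_apply]
  ring

theorem slice_add (a : TriCoeff) (s s' : Fin 2 → ℂ) : slice a (s + s') = slice a s + slice a s' := by
  ext i j
  fin_cases j <;> simp [slice] <;> ring

theorem slice_smul (a : TriCoeff) (c : ℂ) (s : Fin 2 → ℂ) : slice a (c • s) = c • slice a s := by
  ext i j
  fin_cases j <;> simp [slice] <;> ring

theorem slice_sub (a : TriCoeff) (s s' : Fin 2 → ℂ) : slice a (s - s') = slice a s - slice a s' := by
  ext i j
  fin_cases j <;> simp [slice] <;> ring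

end Slices

theorem exists_det2_ne_zero {x : Fin 2 → ℂ} (hx : x ≠ 0) : ∃ y, det2 x y ≠ 0 := by
  by_contra! h
  apply hx
  have h0 := h ![0, 1]
  have h1 := h ![1, 0]
  simp [det2] at h0 h1
  ext i
  fin_cases i <;> simp [h0, h1]

theorem exists_eq_smul_of_det2 {x y : Fin 2 → ℂ} (hx : x ≠ 0) (h : det2 x y = 0) :
    ∃ c : ℂ, y = c • x := by
  simp only [det2] at h
  by_cases h0 : x 0 = 0
  · have h1 : x 1 ≠ 0 := by
      intro h1
      apply hx
      ext i
      fin_cases i <;> simp [h0, h1]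
    refine ⟨y 1 / x 1, ?_⟩
    ext i
    fin_cases i
    · have : y 0 = 0 := by
        rw [h0, zero_mul, zero_sub, neg_eq_zero] at h
        exact (mul_eq_zero.mp h).resolve_left h1
      simp [this, h0]
    · simp [h1]
  · refine ⟨y 0 / x 0, ?_⟩
    ext i
    fin_cases i
    · simp [h0]
    · simp only [Fin.mk_one, Pi.smul_apply, smul_eq_mul]
      field_simp
      linear_combination h

theorem exists_combination_of_det2 {x y : Fin 2 → ℂ} (h : det2 x y ≠ 0) (z : Fin 2 → ℂ) :
    ∃ c d : ℂ, z = c • x + d • y := by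
  refine ⟨det2 z y / det2 x y, det2 x z / det2 x y, ?_⟩
  ext i
  simp only [Pi.add_apply, Pi.smul_apply, smul_eq_mul]
  field_simp
  fin_cases i <;> simp [det2] <;> ring

theorem ne_zero_of_det2 {x y : Fin 2 → ℂ} (h : det2 x y ≠ 0) : x ≠ 0 ∧ y ≠ 0 := by
  constructor <;> rintro rfl <;> simp [det2] at h

theorem det2_smul_right (c : ℂ) (x y : Fin 2 → ℂ) : det2 x (c • y) = c * det2 x y := by
  simp [det2]; ring

/-! ### The determinant form on tensors -/

/-- The polar form of the determinant of `2 × 2` matrices. -/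
def polarDet (v w : Fin 4 → ℂ) : ℂ := v 0 * w 3 + v 3 * w 0 - v 1 * w 2 - v 2 * w 1

/-- The Gram matrix of `polarDet`. -/
def gramDet : Matrix (Fin 4) (Fin 4) ℂ :=
  !![0, 0, 0, 1; 0, 0, -1, 0; 0, -1, 0, 0; 1, 0, 0, 0]

theorem gramDet_mul_self : gramDet * gramDet = 1 := by
  ext i j
  fin_cases i <;> fin_cases j <;> simp [gramDet, Matrix.mul_apply, Fin.sum_univ_four]

theorem polarDet_eq (v w : Fin 4 → ℂ) : polarDet v w = v ⬝ᵥ gramDet *ᵥ w := by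
  simp [polarDet, gramDet, dotProduct, Matrix.mulVec, Fin.sum_univ_four]
  ring

theorem polarDet_tens (t u t' u' : Fin 2 → ℂ) :
    polarDet (tens t u) (tens t' u') = det2 t t' * det2 u u' := by
  simp [polarDet, tens, det2]
  ring

theorem exists_tens_of_polarDet {w : Fin 4 → ℂ} (h : polarDet w w = 0) :
    ∃ t u, w = tens t u := by
  have h' : w 0 * w 3 = w 1 * w 2 := by
    simp only [polarDet] at h
    linear_combination h / 2
  by_cases h0 : w 0 = 0
  · by_cases h1 : w 1 = 0
    · refine ⟨![0, 1], ![w 2, w 3], ?_⟩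
      ext i
      fin_cases i <;> simp [tens, h0, h1]
    · have h2 : w 2 = 0 := by
        rw [h0, zero_mul] at h'
        exact (mul_eq_zero.mp h'.symm).resolve_left h1
      refine ⟨![w 1, w 3], ![0, 1], ?_⟩
      ext i
      fin_cases i <;> simp [tens, h0, h2]
  · refine ⟨![1, w 2 / w 0], ![w 0, w 1], ?_⟩
    ext i
    fin_cases i <;> simp [tens]
    · field_simp
    · field_simp
      linear_combination h'

theorem tens_ne_zero {t u : Fin 2 → ℂ} (h : tens t u ≠ 0) : t ≠ 0 ∧ u ≠ 0 := by
  constructor <;> rintro rfl <;> apply h <;> ext i <;> fin_cases i <;> simp [tens]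

theorem tens_ne_zero_iff {t u : Fin 2 → ℂ} : tens t u ≠ 0 ↔ t ≠ 0 ∧ u ≠ 0 := by
  refine ⟨tens_ne_zero, fun ⟨ht, hu⟩ h => ?_⟩
  obtain ⟨t', ht'⟩ := exists_det2_ne_zero ht
  obtain ⟨u', hu'⟩ := exists_det2_ne_zero hu
  have := polarDet_tens t u t' u'
  rw [h] at this
  simp [polarDet] at this
  rcases this with h1 | h1
  · exact ht' h1
  · exact hu' h1

theorem tens_smul_left (c : ℂ) (t u : Fin 2 → ℂ) : tens (c • t) u = c • tens t u := by
  ext i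
  fin_cases i <;> simp [tens] <;> ring

theorem tens_smul_right (c : ℂ) (t u : Fin 2 → ℂ) : tens t (c • u) = c • tens t u := by
  ext i
  fin_cases i <;> simp [tens] <;> ring

theorem tens_add_right (t u u' : Fin 2 → ℂ) : tens t (u + u') = tens t u + tens t u' := by
  ext i
  fin_cases i <;> simp [tens] <;> ring

theorem tens_add_left (t t' u : Fin 2 → ℂ) : tens (t + t') u = tens t u + tens t' u := by
  ext i
  fin_cases i <;> simp [tens] <;> ring

/-- The vectors orthogonal to `t ⊗ u` are tangent to the quadric of rank one tensors there. -/
theorem exists_tangent_of_polarDet {t u : Fin 2 → ℂ} (ht : t ≠ 0) (hu : u ≠ 0) {w : Fin 4 → ℂ}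
    (h : polarDet (tens t u) w = 0) : ∃ x u', w = tens x u + tens t u' := by
  obtain ⟨t', ht'⟩ := exists_det2_ne_zero ht
  obtain ⟨u', hu'⟩ := exists_det2_ne_zero hu
  have h' : t 0 * u 0 * w 3 + t 1 * u 1 * w 0 - t 0 * u 1 * w 2 - t 1 * u 0 * w 1 = 0 := by
    simpa [polarDet, tens] using h
  -- the coordinates of `w` in the basis `t ⊗ u, t ⊗ u', t' ⊗ u, t' ⊗ u'`
  let x : Fin 2 → ℂ := fun i => (w (![0, 2] i) * u' 1 - w (![1, 3] i) * u' 0) / det2 u u'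
  let y : Fin 2 → ℂ := fun j => (t' 1 * (u 0 * w (![1, 1] j) - u 1 * w (![0, 0] j)) -
    t' 0 * (u 0 * w (![3, 3] j) - u 1 * w (![2, 2] j))) / (det2 t t' * det2 u u') * u' j
  refine ⟨x, y, ?_⟩
  ext i
  fin_cases i <;> simp [tens, x, y] <;> field_simp <;> simp only [det2]
  · linear_combination (u' 0 * t' 0) * h'
  · linear_combination (u' 1 * t' 0) * h'
  · linear_combination (u' 0 * t' 1) * h'
  · linear_combination (u' 1 * t' 1) * h'

/-- The quadratic forms vanishing on all rank one tensors are the multiples of the determinant. -/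
theorem eq_smul_gramDet {S : Matrix (Fin 4) (Fin 4) ℂ} (hS : Sᵀ = S)
    (h : ∀ t u : Fin 2 → ℂ, tens t u ⬝ᵥ S *ᵥ tens t u = 0) : ∃ c : ℂ, S = c • gramDet := by
  have hs : ∀ i j, S i j = S j i := fun i j => congrFun (congrFun hS j) i
  have e : ∀ t u : Fin 2 → ℂ, _ := h
  simp only [tens, dotProduct, Matrix.mulVec, Fin.sum_univ_four, Matrix.cons_val] at e
  have a00 := e ![1, 0] ![1, 0]
  have a01 := e ![1, 0] ![0, 1]
  have a10 := e ![0, 1] ![1, 0]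
  have a11 := e ![0, 1] ![0, 1]
  have b1 := e ![1, 0] ![1, 1]
  have b2 := e ![0, 1] ![1, 1]
  have b3 := e ![1, 1] ![1, 0]
  have b4 := e ![1, 1] ![0, 1]
  have b5 := e ![1, 1] ![1, 1]
  simp only [Matrix.cons_val, mul_one, one_mul, mul_zero, zero_mul, add_zero, zero_add]
    at a00 a01 a10 a11 b1 b2 b3 b4 b5
  rw [hs 1 0] at b1
  rw [hs 3 2] at b2
  rw [hs 2 0] at b3
  rw [hs 3 1] at b4
  rw [hs 1 0, hs 2 0, hs 2 1, hs 3 0, hs 3 1, hs 3 2] at b5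
  have c1 : S 0 1 = 0 := by linear_combination (b1 - a00 - a01) / 2
  have c2 : S 2 3 = 0 := by linear_combination (b2 - a10 - a11) / 2
  have c3 : S 0 2 = 0 := by linear_combination (b3 - a00 - a10) / 2
  have c4 : S 1 3 = 0 := by linear_combination (b4 - a01 - a11) / 2
  have c5 : S 1 2 = - S 0 3 := by
    linear_combination b5 / 2 - c1 - c2 - c3 - c4 - (a00 + a01 + a10 + a11) / 2
  refine ⟨S 0 3, ?_⟩
  ext i j
  fin_cases i <;> fin_cases j <;> simp [gramDet, a00, a01, a10, a11, c1, c2, c3, c4, c5,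
    hs 1 0, hs 2 0, hs 3 0, hs 2 1, hs 3 1, hs 3 2]

/-! ### Tangent kernels -/

theorem exists_roots_cubic (e₁ e₂ e₃ : ℂ) :
    ∃ a b c : ℂ, ∀ x : ℂ, x ^ 3 - e₁ * x ^ 2 + e₂ * x - e₃ = (x - a) * (x - b) * (x - c) := by
  have hroot : ∀ p : Polynomial ℂ, p.degree ≠ 0 → ∃ z, p.eval z = 0 :=
    fun p hp => IsAlgClosed.exists_root p hp
  obtain ⟨a, ha⟩ := hroot (Polynomial.X ^ 3 + (Polynomial.C (-e₁) * Polynomial.X ^ 2 +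
    Polynomial.C e₂ * Polynomial.X + Polynomial.C (-e₃)))
    (ne_of_eq_of_ne (b := 3) (by compute_degree!) (by decide))
  obtain ⟨b, hb⟩ := hroot (Polynomial.X ^ 2 + (Polynomial.C (a - e₁) * Polynomial.X +
    Polynomial.C (e₂ - e₁ * a + a ^ 2)))
    (ne_of_eq_of_ne (b := 2) (by compute_degree!) (by decide))
  simp only [Polynomial.eval_add, Polynomial.eval_mul, Polynomial.eval_pow, Polynomial.eval_X,
    Polynomial.eval_C] at ha hb
  exact ⟨a, b, e₁ - a - b, fun x => by linear_combination (x - a) * hb + ha⟩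

/-- A pencil of quadratic forms vanishing on the images of the rank one tensors under a pencil of
linear maps gives a factorization of a scalar cubic into three linear operator polynomials. -/
theorem exists_cubic_factorization {Ms Mp Es Ep : Matrix (Fin 4) (Fin 4) ℂ} (hdet : Ms.det ≠ 0)
    (hEs : Esᵀ = Es) (hEp : Epᵀ = Ep) (hEs0 : Es ≠ 0)
    (hvs : ∀ t u : Fin 2 → ℂ, (Ms *ᵥ tens t u) ⬝ᵥ Es *ᵥ (Ms *ᵥ tens t u) = 0)
    (hv : ∀ (x : ℂ) (t u : Fin 2 → ℂ), ((x • Ms - Mp) *ᵥ tens t u) ⬝ᵥ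
      (x • Es - Ep) *ᵥ ((x • Ms - Mp) *ᵥ tens t u) = 0) :
    ∃ (N : Matrix (Fin 4) (Fin 4) ℂ) (a b c : ℂ), ∀ x : ℂ,
      (x • 1 - gramDet * (Ms⁻¹ * Mp)ᵀ * gramDet) * (x • 1 - N) * (x • 1 - Ms⁻¹ * Mp) =
        ((x - a) * (x - b) * (x - c)) • (1 : Matrix (Fin 4) (Fin 4) ℂ) := by
  have hu : IsUnit Ms.det := isUnit_iff_ne_zero.mpr hdet
  set T := Ms⁻¹ * Mp with hT
  have hJJ := gramDet_mul_self
  have hmove : ∀ (A B : Matrix (Fin 4) (Fin 4) ℂ) (v : Fin 4 → ℂ),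
      (A *ᵥ v) ⬝ᵥ B *ᵥ (A *ᵥ v) = v ⬝ᵥ (Aᵀ * B * A) *ᵥ v := by
    intro A B v
    rw [← Matrix.mulVec_mulVec, ← Matrix.mulVec_mulVec, Matrix.dotProduct_mulVec v Aᵀ,
      Matrix.vecMul_transpose]
  obtain ⟨c, hc⟩ := eq_smul_gramDet (S := Msᵀ * Es * Ms)
    (by simp [Matrix.transpose_mul, hEs, Matrix.mul_assoc]) fun t u => by
      rw [← hmove]; exact hvs t u
  have hc0 : c ≠ 0 := by
    rintro rfl
    rw [zero_smul] at hc
    apply hEs0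
    have h1 : (Msᵀ)⁻¹ * (Msᵀ * Es * Ms) * Ms⁻¹ = Es := by
      rw [Matrix.mul_assoc Msᵀ, Matrix.nonsing_inv_mul_cancel_left _ _
        (by rwa [Matrix.det_transpose]), Matrix.mul_nonsing_inv_cancel_right _ _ hu]
    rw [← h1, hc, Matrix.mul_zero, Matrix.zero_mul]
  set N := c⁻¹ • (gramDet * (Msᵀ * Ep * Ms)) with hN
  have hMT : ∀ x : ℂ, x • Ms - Mp = Ms * (x • 1 - T) := by
    intro x
    rw [Matrix.mul_sub, hT, Matrix.mul_nonsing_inv_cancel_left _ _ hu, Matrix.mul_smul,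
      Matrix.mul_one]
  have hscalar : ∀ x : ℂ, ∃ k : ℂ, (x • 1 - gramDet * Tᵀ * gramDet) * (x • 1 - N) * (x • 1 - T) =
      k • (1 : Matrix (Fin 4) (Fin 4) ℂ) := by
    intro x
    obtain ⟨k, hk⟩ := eq_smul_gramDet (S := (x • Ms - Mp)ᵀ * (x • Es - Ep) * (x • Ms - Mp))
      (by simp [Matrix.transpose_mul, hEs, hEp, Matrix.mul_assoc]) fun t u => by
        rw [← hmove]; exact hv x t u
    refine ⟨c⁻¹ * k, ?_⟩
    have e1 : x • 1 - gramDet * Tᵀ * gramDet = gramDet * (x • 1 - T)ᵀ * gramDet := by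
      rw [Matrix.transpose_sub, Matrix.mul_sub, Matrix.sub_mul, Matrix.transpose_smul,
        Matrix.transpose_one, Matrix.mul_smul, Matrix.mul_one, Matrix.smul_mul, hJJ]
    have e2 : gramDet * (x • 1 - N) = c⁻¹ • (Msᵀ * (x • Es - Ep) * Ms) := by
      rw [Matrix.mul_sub Msᵀ, Matrix.sub_mul, Matrix.mul_smul, Matrix.smul_mul, hc, hN,
        Matrix.mul_sub, Matrix.mul_smul, Matrix.mul_one, Matrix.mul_smul, ← Matrix.mul_assoc,
        hJJ, Matrix.one_mul, smul_sub, smul_smul, smul_smul, mul_right_comm,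
        inv_mul_cancel₀ hc0, one_mul]
    rw [e1, Matrix.mul_assoc (gramDet * (x • 1 - T)ᵀ), e2, Matrix.mul_assoc gramDet,
      Matrix.mul_smul, Matrix.mul_smul, Matrix.smul_mul, Matrix.mul_assoc, mul_smul]
    congr 1
    have e3 : (x • 1 - T)ᵀ * (Msᵀ * (x • Es - Ep) * Ms) * (x • 1 - T) = k • gramDet := by
      rw [← hk, hMT, Matrix.transpose_mul]
      simp only [Matrix.mul_assoc]
    rw [e3, Matrix.mul_smul, hJJ]
  set T' := gramDet * Tᵀ * gramDet with hT'
  obtain ⟨a, b, d, habd⟩ := exists_roots_cubic ((T' + N + T) 0 0)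
    ((T' * N + T' * T + N * T) 0 0) ((T' * N * T) 0 0)
  refine ⟨N, a, b, d, fun x => ?_⟩
  obtain ⟨k, hk⟩ := hscalar x
  rw [hk, ← habd]
  have hexp : (x • 1 - T') * (x • 1 - N) * (x • 1 - T) =
      (x ^ 3) • (1 : Matrix (Fin 4) (Fin 4) ℂ) - x ^ 2 • (T' + N + T) +
        x • (T' * N + T' * T + N * T) - T' * N * T := by
    simp only [sub_mul, mul_sub, smul_mul_assoc, mul_smul_comm, one_mul, mul_one, smul_sub,
      mul_assoc]
    module
  have h00 := congrFun (congrFun hexp 0) 0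
  rw [hk] at h00
  congr 1
  simp only [Matrix.smul_apply, Matrix.sub_apply, Matrix.add_apply, Matrix.one_apply_eq,
    smul_eq_mul, mul_one] at h00 ⊢
  rw [h00]
  ring

theorem finrank_ker_toLin'_transpose (A : Matrix (Fin 4) (Fin 4) ℂ) :
    finrank ℂ (LinearMap.ker (gramDet * Aᵀ * gramDet).toLin') =
      finrank ℂ (LinearMap.ker A.toLin') := by
  have hJ : IsUnit gramDet.det := by
    have := congrArg Matrix.det gramDet_mul_self
    rw [Matrix.det_mul, Matrix.det_one] at this
    exact IsUnit.of_mul_eq_one _ this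
  have h1 := LinearMap.finrank_range_add_finrank_ker (gramDet * Aᵀ * gramDet).toLin'
  have h2 := LinearMap.finrank_range_add_finrank_ker A.toLin'
  have h3 : (gramDet * Aᵀ * gramDet).rank = A.rank := by
    rw [Matrix.rank_mul_eq_left_of_isUnit_det _ _ hJ, Matrix.rank_mul_eq_right_of_isUnit_det _ _ hJ,
      Matrix.rank_transpose]
  have hr : ∀ B : Matrix (Fin 4) (Fin 4) ℂ, finrank ℂ (LinearMap.range B.toLin') = B.rank :=
    fun B => rfl
  rw [hr] at h1 h2
  omega

theorem polarDet_mulVec (A : Matrix (Fin 4) (Fin 4) ℂ) (z w : Fin 4 → ℂ) :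
    polarDet w ((gramDet * Aᵀ * gramDet) *ᵥ z) = polarDet (A *ᵥ w) z := by
  rw [polarDet_eq, polarDet_eq, Matrix.mulVec_mulVec, ← Matrix.mul_assoc, ← Matrix.mul_assoc,
    gramDet_mul_self, Matrix.one_mul, ← Matrix.mulVec_mulVec, Matrix.dotProduct_mulVec,
    Matrix.vecMul_transpose]

/-- If `A A'` has rank at most one, where `A'` is the adjoint of `A` for the determinant form, and
the kernel of `A` is at most two-dimensional and contains no ruling of the quadric of rank one
tensors, then `A A'` is not zero and the kernel is a tangent line of the quadric. -/
theorem exists_tangent_of_finrank_ker {A : Matrix (Fin 4) (Fin 4) ℂ}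
    (h3 : 3 ≤ finrank ℂ (LinearMap.ker (A.toLin' * (gramDet * Aᵀ * gramDet).toLin')))
    (h2 : finrank ℂ (LinearMap.ker A.toLin') ≤ 2)
    (hr1 : ∀ t : Fin 2 → ℂ, t ≠ 0 → ¬ ∀ u, A *ᵥ tens t u = 0)
    (hr2 : ∀ u : Fin 2 → ℂ, u ≠ 0 → ¬ ∀ t, A *ᵥ tens t u = 0) :
    A.toLin' * (gramDet * Aᵀ * gramDet).toLin' ≠ 0 ∧
    ∃ t u x u' : Fin 2 → ℂ, A *ᵥ tens t u = 0 ∧ A *ᵥ (tens x u + tens t u') = 0 ∧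
      det2 t x ≠ 0 ∧ det2 u u' ≠ 0 ∧
      ∀ t₂ u₂, A *ᵥ tens t₂ u₂ = 0 → det2 t t₂ * det2 u u₂ = 0 := by
  set A' := gramDet * Aᵀ * gramDet with hA'
  have hk' : finrank ℂ (LinearMap.ker A'.toLin') = finrank ℂ (LinearMap.ker A.toLin') :=
    finrank_ker_toLin'_transpose A
  have hle := finrank_ker_mul_le A.toLin' A'.toLin'
  have hk2 : finrank ℂ (LinearMap.ker A.toLin') = 2 := by omega
  -- a kernel vector orthogonal to the kernel
  obtain ⟨z, hz, hz0⟩ : ∃ z, A *ᵥ (A' *ᵥ z) = 0 ∧ A' *ᵥ z ≠ 0 := by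
    by_contra! hn
    have hsub : LinearMap.ker (A.toLin' * A'.toLin') ≤ LinearMap.ker A'.toLin' := by
      intro z hz
      exact hn z hz
    have := Submodule.finrank_mono hsub
    omega
  have horth : ∀ w, A *ᵥ w = 0 → ∀ y, polarDet w (A' *ᵥ y) = 0 := by
    intro w hw y
    rw [hA', polarDet_mulVec, hw]
    simp [polarDet]
  obtain ⟨t, u, htu⟩ := exists_tens_of_polarDet (horth _ hz z)
  rw [htu] at hz hz0
  obtain ⟨ht, hu⟩ := tens_ne_zero hz0
  have hcomm : ∀ v w, polarDet v w = polarDet w v := fun v w => by simp only [polarDet]; ring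
  have horth' : ∀ w, A *ᵥ w = 0 → polarDet (tens t u) w = 0 := fun w hw => by
    rw [hcomm, ← htu]
    exact horth w hw z
  have huniq : ∀ t₂ u₂, A *ᵥ tens t₂ u₂ = 0 → det2 t t₂ * det2 u u₂ = 0 := fun t₂ u₂ h => by
    rw [← polarDet_tens]
    exact horth' _ h
  -- a second isotropic vector of the kernel would span a ruling with the first
  have hiso : ∀ w, A *ᵥ w = 0 → polarDet w w = 0 → ∃ c : ℂ, w = c • tens t u := by
    intro w hw hw0
    by_contra hne
    obtain ⟨t₂, u₂, rfl⟩ := exists_tens_of_polarDet hw0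
    rcases mul_eq_zero.mp (huniq t₂ u₂ hw) with h | h
    · obtain ⟨c, rfl⟩ := exists_eq_smul_of_det2 ht h
      by_cases hd : det2 u u₂ = 0
      · obtain ⟨d, rfl⟩ := exists_eq_smul_of_det2 hu hd
        exact hne ⟨c * d, by rw [tens_smul_left, tens_smul_right, smul_smul]⟩
      · refine hr1 t ht fun v => ?_
        obtain ⟨e, f, rfl⟩ := exists_combination_of_det2 hd v
        have hc : c ≠ 0 := by
          rintro rfl
          exact hne ⟨0, by rw [tens_smul_left, zero_smul, zero_smul]⟩
        rw [tens_smul_left, Matrix.mulVec_smul] at hw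
        rw [tens_add_right, tens_smul_right, tens_smul_right, Matrix.mulVec_add,
          Matrix.mulVec_smul, Matrix.mulVec_smul, hz, (smul_eq_zero.mp hw).resolve_left hc]
        simp
    · obtain ⟨c, rfl⟩ := exists_eq_smul_of_det2 hu h
      by_cases hd : det2 t t₂ = 0
      · obtain ⟨d, rfl⟩ := exists_eq_smul_of_det2 ht hd
        exact hne ⟨d * c, by rw [tens_smul_left, tens_smul_right, smul_smul]⟩
      · refine hr2 u hu fun v => ?_
        obtain ⟨e, f, rfl⟩ := exists_combination_of_det2 hd v
        have hc : c ≠ 0 := by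
          rintro rfl
          exact hne ⟨0, by rw [tens_smul_right, zero_smul, zero_smul]⟩
        rw [tens_smul_right, Matrix.mulVec_smul] at hw
        rw [tens_add_left, tens_smul_left, tens_smul_left, Matrix.mulVec_add,
          Matrix.mulVec_smul, Matrix.mulVec_smul, hz, (smul_eq_zero.mp hw).resolve_left hc]
        simp
  obtain ⟨w, hw, hwne⟩ : ∃ w, A *ᵥ w = 0 ∧ ∀ c : ℂ, w ≠ c • tens t u := by
    by_contra! hn
    have hsub : LinearMap.ker A.toLin' ≤ Submodule.span ℂ {tens t u} := by
      intro w hw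
      obtain ⟨c, rfl⟩ := hn w hw
      exact Submodule.smul_mem _ _ (Submodule.mem_span_singleton_self _)
    have h4 := Submodule.finrank_mono hsub
    have h5 := finrank_span_singleton (K := ℂ) hz0
    omega
  refine ⟨fun h0 => ?_, t, u, ?_⟩
  · -- otherwise the kernel is the image of `A'`, and totally isotropic
    have hsub : LinearMap.range A'.toLin' ≤ LinearMap.ker A.toLin' := by
      rintro _ ⟨y, rfl⟩
      exact congrArg (fun f : End ℂ (Fin 4 → ℂ) => f y) h0
    have h6 := LinearMap.finrank_range_add_finrank_ker A'.toLin'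
    rw [finrank_fin_fun] at h6
    have heq := Submodule.eq_of_le_of_finrank_le hsub (by omega)
    obtain ⟨y, hy⟩ : w ∈ LinearMap.range A'.toLin' := heq ▸ hw
    have h7 : polarDet w w = 0 := by
      nth_rewrite 2 [← hy]
      exact horth w hw y
    obtain ⟨c, hc⟩ := hiso w hw h7
    exact hwne c hc
  · obtain ⟨x, u', hxu⟩ := exists_tangent_of_polarDet ht hu (horth' w hw)
    have hq : polarDet w w = -2 * (det2 t x * det2 u u') := by
      rw [hxu]
      simp [polarDet, tens, det2]
      ring
    have hq0 : polarDet w w ≠ 0 := fun h => by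
      obtain ⟨c, hc⟩ := hiso w hw h
      exact hwne c hc
    have hne : det2 t x * det2 u u' ≠ 0 := fun h => hq0 (by rw [hq, h, mul_zero])
    exact ⟨x, u', hz, hxu ▸ hw, left_ne_zero_of_mul hne, right_ne_zero_of_mul hne, huniq⟩

/-- A Jordan chain of length two makes the eigenvalue a multiple root of the characteristic
polynomial. -/
theorem two_le_rootMultiplicity {V : Type*} [AddCommGroup V] [Module ℂ V] [FiniteDimensional ℂ V]
    {T : End ℂ V} {x : ℂ} {v w : V} (hw : w ≠ 0) (h1 : T w = x • w) {k : ℂ} (hk : k ≠ 0)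
    (h2 : T v = x • v + k • w) : 2 ≤ T.charpoly.rootMultiplicity x := by
  refine le_trans ?_ (LinearMap.finrank_genEigenspace_le T x 2)
  have hli : LinearIndependent ℂ ![w, v] := by
    rw [LinearIndependent.pair_iff]
    intro s t hst
    have h3 := congrArg T hst
    rw [map_add, map_smul, map_smul, h1, h2, map_zero] at h3
    have h4 : (t * k) • w = 0 := by
      have : (t * k) • w = s • x • w + t • (x • v + k • w) - x • (s • w + t • v) := by module
      rw [this, h3, hst, smul_zero, sub_zero]
    have ht : t = 0 := by simpa [hk, hw] using h4
    subst ht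
    simpa [hw] using hst
  have hspan : Submodule.span ℂ (Set.range ![w, v]) ≤ T.genEigenspace x (2 : ℕ) := by
    rw [Submodule.span_le]
    rintro _ ⟨i, rfl⟩
    rw [SetLike.mem_coe, End.mem_genEigenspace_nat]
    fin_cases i
    · simp [pow_two, h1]
    · simp [pow_two, h1, h2]
  have := Submodule.finrank_mono hspan
  rw [finrank_span_eq_card hli] at this
  simpa using this

/-- Suppose that a pencil of quadratic forms vanishes on the lines `f(s, ·, ·)` of a trilinear map,
that some slice is invertible, and that the kernels of the slices are at most two-dimensional and
contain no ruling. Then the kernel of some slice is a tangent line of the quadric of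
rank one tensors, and the other slices start no Jordan chain. -/
theorem exists_tangent_kernel {a : TriCoeff} {s₀ : Fin 2 → ℂ} (hdet : (slice a s₀).det ≠ 0)
    {E₀ E₁ : Matrix (Fin 4) (Fin 4) ℂ} (h₀ : E₀ᵀ = E₀) (h₁ : E₁ᵀ = E₁)
    (hE : ∀ s : Fin 2 → ℂ, s ≠ 0 → s 1 • E₀ - s 0 • E₁ ≠ 0)
    (hvan : ∀ s t u : Fin 2 → ℂ, (slice a s *ᵥ tens t u) ⬝ᵥ
      (s 1 • E₀ - s 0 • E₁) *ᵥ (slice a s *ᵥ tens t u) = 0)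
    (h2 : ∀ s : Fin 2 → ℂ, s ≠ 0 → finrank ℂ (LinearMap.ker (slice a s).toLin') ≤ 2)
    (hr1 : ∀ s t : Fin 2 → ℂ, s ≠ 0 → t ≠ 0 → ¬ ∀ u, slice a s *ᵥ tens t u = 0)
    (hr2 : ∀ s u : Fin 2 → ℂ, s ≠ 0 → u ≠ 0 → ¬ ∀ t, slice a s *ᵥ tens t u = 0) :
    ∃ r t u x u' : Fin 2 → ℂ, r ≠ 0 ∧ slice a r *ᵥ tens t u = 0 ∧
      slice a r *ᵥ (tens x u + tens t u') = 0 ∧ det2 t x ≠ 0 ∧ det2 u u' ≠ 0 ∧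
      (∀ t₂ u₂, slice a r *ᵥ tens t₂ u₂ = 0 → det2 t t₂ * det2 u u₂ = 0) ∧
      ∀ (r₂ r₃ : Fin 2 → ℂ) (m₀ m₁ : Fin 4 → ℂ), det2 r₂ r₃ ≠ 0 → m₁ ≠ 0 →
        slice a r₂ *ᵥ m₁ = 0 → slice a r₂ *ᵥ m₀ + slice a r₃ *ᵥ m₁ = 0 → det2 r r₂ = 0 := by
  have hs₀ : s₀ ≠ 0 := by
    rintro rfl
    apply hdet
    have : slice a 0 = 0 := by
      have := slice_smul a 0 0
      simpa using this
    rw [this, Matrix.det_zero]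
  obtain ⟨s', hs'⟩ := exists_det2_ne_zero hs₀
  have hu : IsUnit (slice a s₀).det := isUnit_iff_ne_zero.mpr hdet
  set T := (slice a s₀)⁻¹ * slice a s' with hT
  set T' := gramDet * Tᵀ * gramDet with hT'
  have hsl : ∀ x : ℂ, slice a (x • s₀ - s') = slice a s₀ * (x • 1 - T) := by
    intro x
    rw [slice_sub, slice_smul, Matrix.mul_sub, hT, Matrix.mul_nonsing_inv_cancel_left _ _ hu,
      Matrix.mul_smul, Matrix.mul_one]
  have hker : ∀ (x : ℂ) (v : Fin 4 → ℂ), slice a (x • s₀ - s') *ᵥ v = 0 ↔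
      (x • 1 - T) *ᵥ v = 0 := by
    intro x v
    rw [hsl, ← Matrix.mulVec_mulVec]
    refine ⟨fun h => ?_, fun h => by rw [h, Matrix.mulVec_zero]⟩
    exact Matrix.eq_zero_of_mulVec_eq_zero hdet h
  have hne : ∀ x : ℂ, x • s₀ - s' ≠ 0 := by
    intro x h
    apply hs'
    rw [← sub_eq_zero.mp h, det2_smul_right]
    simp [det2, mul_comm]
  set Es := s₀ 1 • E₀ - s₀ 0 • E₁
  set Ep := s' 1 • E₀ - s' 0 • E₁
  have hEx : ∀ x : ℂ, x • Es - Ep =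
      (x • s₀ - s') 1 • E₀ - (x • s₀ - s') 0 • E₁ := by
    intro x
    simp only [Es, Ep, Pi.sub_apply, Pi.smul_apply, smul_eq_mul]
    module
  obtain ⟨N, α, β, γ, H⟩ := exists_cubic_factorization (Ms := slice a s₀) (Mp := slice a s')
    (Es := Es) (Ep := Ep) hdet (by simp [Es, h₀, h₁]) (by simp [Ep, h₀, h₁]) (hE _ hs₀) (hvan s₀)
    (fun x t u => by rw [hEx, ← slice_smul, ← slice_sub]; exact hvan _ t u)
  have hlin : ∀ (x : ℂ) (A : Matrix (Fin 4) (Fin 4) ℂ), x • (1 : End ℂ (Fin 4 → ℂ)) - A.toLin' =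
      (x • 1 - A).toLin' := by
    intro x A
    rw [map_sub, map_smul, Matrix.toLin'_one]
    rfl
  have hadj : ∀ x : ℂ, x • 1 - T' = gramDet * (x • 1 - T)ᵀ * gramDet := by
    intro x
    rw [Matrix.transpose_sub, Matrix.mul_sub, Matrix.sub_mul, Matrix.transpose_smul,
      Matrix.transpose_one, Matrix.mul_smul, Matrix.mul_one, Matrix.smul_mul, gramDet_mul_self]
  have H' : ∀ x : ℂ, (x • 1 - T'.toLin') * (x • 1 - N.toLin') * (x • 1 - T.toLin') =
      ((x - α) * (x - β) * (x - γ)) • (1 : End ℂ (Fin 4 → ℂ)) := by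
    intro x
    have h := congrArg Matrix.toLin' (H x)
    rw [Matrix.toLin'_mul, Matrix.toLin'_mul, map_smul, Matrix.toLin'_one] at h
    rw [hlin, hlin, hlin]
    exact h
  have hchar : T'.toLin'.charpoly = T.toLin'.charpoly := by
    rw [Matrix.charpoly_toLin', Matrix.charpoly_toLin', hT', Matrix.mul_assoc,
      Matrix.charpoly_mul_comm, Matrix.mul_assoc, gramDet_mul_self, Matrix.mul_one,
      Matrix.charpoly_transpose]
  have hV : finrank ℂ (Fin 4 → ℂ) = 4 := finrank_fin_fun ℂ
  have hdim : ∀ x : ℂ, finrank ℂ (LinearMap.ker (x • 1 - T).toLin') ≤ 2 := by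
    intro x
    refine le_trans (Submodule.finrank_mono ?_) (h2 _ (hne x))
    intro v hv
    exact (hker x v).mpr hv
  have hn1 : ∀ (x : ℂ) (t : Fin 2 → ℂ), t ≠ 0 → ¬ ∀ u, (x • 1 - T) *ᵥ tens t u = 0 :=
    fun x t ht h => hr1 _ t (hne x) ht fun u => (hker x _).mpr (h u)
  have hn2 : ∀ (x : ℂ) (u : Fin 2 → ℂ), u ≠ 0 → ¬ ∀ t, (x • 1 - T) *ᵥ tens t u = 0 :=
    fun x u hu h => hr2 _ u (hne x) hu fun t => (hker x _).mpr (h t)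
  have hP : ∀ x : ℂ, (x • 1 - T.toLin') * (x • 1 - T'.toLin') ≠ 0 := by
    intro x h0
    rw [hlin, hlin, hadj] at h0
    refine (exists_tangent_of_finrank_ker ?_ (hdim x) (hn1 x) (hn2 x)).1 h0
    rw [h0, LinearMap.ker_zero, finrank_top, hV]
    norm_num
  obtain ⟨r, hr3, hmult⟩ := exists_root_of_factorization hV H' hchar hP
  rw [hlin, hlin, hadj] at hr3
  obtain ⟨-, t, u, x, u', e1, e2, e3, e4, e5⟩ :=
    exists_tangent_of_finrank_ker hr3 (hdim r) (hn1 r) (hn2 r)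
  refine ⟨r • s₀ - s', t, u, x, u', hne r, (hker r _).mpr e1, (hker r _).mpr e2, e3, e4,
    fun t₂ u₂ h => e5 t₂ u₂ ((hker r _).mp h), ?_⟩
  intro r₂ r₃ m₀ m₁ hr hm hk1 hk2
  obtain ⟨c, d, rfl⟩ := exists_combination_of_det2 hs' r₂
  have hd : d ≠ 0 := by
    rintro rfl
    rw [zero_smul, add_zero, slice_smul, Matrix.smul_mulVec] at hk1
    have hc : c ≠ 0 := by
      rintro rfl
      simp [det2] at hr
    exact hm (Matrix.eq_zero_of_mulVec_eq_zero hdet ((smul_eq_zero.mp hk1).resolve_left hc))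
  have hr₂ : c • s₀ + d • s' = (-d) • ((-(c / d)) • s₀ - s') := by
    ext i
    simp only [Pi.add_apply, Pi.sub_apply, Pi.smul_apply, smul_eq_mul]
    field_simp
    ring
  set y := -(c / d)
  obtain ⟨e, f, rfl⟩ := exists_combination_of_det2 hs' r₃
  set z := e + f * y with hz
  have hr₃ : e • s₀ + f • s' = z • s₀ + (-f) • (y • s₀ - s') := by
    rw [hz]; module
  have hz0 : z ≠ 0 := by
    intro h0
    apply hr
    rw [hr₃, hr₂, h0]
    simp [det2]
    ring
  rw [hr₂, slice_smul, Matrix.smul_mulVec] at hk1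
  have hk1' := (smul_eq_zero.mp hk1).resolve_left (neg_ne_zero.mpr hd)
  rw [hr₂, hr₃, slice_smul, slice_add, slice_smul, slice_smul, Matrix.add_mulVec,
    Matrix.smul_mulVec, Matrix.smul_mulVec, Matrix.smul_mulVec, hk1', smul_zero, add_zero, hsl,
    ← Matrix.mulVec_mulVec, ← Matrix.mulVec_smul _ (-d), ← Matrix.mulVec_smul _ z,
    ← Matrix.mulVec_add] at hk2
  have hk3 := Matrix.eq_zero_of_mulVec_eq_zero hdet hk2
  rw [hker] at hk1'
  have hyr : y = r := by
    by_contra hyr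
    have h3 := hmult y hyr
    have h4 : 2 ≤ T.toLin'.charpoly.rootMultiplicity y := by
      refine two_le_rootMultiplicity (v := m₀) (w := m₁) (k := -(z / d)) hm ?_ ?_ ?_
      · rw [Matrix.toLin'_apply]
        rw [Matrix.sub_mulVec, Matrix.smul_mulVec, Matrix.one_mulVec] at hk1'
        exact (sub_eq_zero.mp hk1').symm
      · exact neg_ne_zero.mpr (div_ne_zero hz0 hd)
      · rw [Matrix.toLin'_apply]
        rw [Matrix.sub_mulVec, Matrix.smul_mulVec, Matrix.one_mulVec] at hk3
        have h5 : d • (T *ᵥ m₀) = d • (y • m₀ + (-(z / d)) • m₁) := by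
          rw [smul_add, smul_smul d (-(z / d)), show d * -(z / d) = -z by field_simp,
            ← sub_eq_zero, ← hk3]
          module
        exact smul_right_injective _ hd h5
    omega
  rw [hr₂, hyr, det2_smul_right]
  simp [det2]
  right
  ring

/-! ### Quadratic inverses -/

theorem exists_symm_matrix {n : ℕ} {p : MvPolynomial (Fin n) ℂ} (hp : p.IsHomogeneous 2) :
    ∃ E : Matrix (Fin n) (Fin n) ℂ, Eᵀ = E ∧ ∀ y, y ⬝ᵥ E *ᵥ y = eval y p := by
  have hc : ∀ i j, ∃ c : ℂ, pderiv j (pderiv i p) = C c := fun i j => by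
    have h : (pderiv j (pderiv i p)).IsHomogeneous 0 := (hp.pderiv (i := i)).pderiv (i := j)
    exact ⟨_, totalDegree_eq_zero_iff_eq_C.mp ((totalDegree_zero_iff_isHomogeneous _).mpr h)⟩
  choose c hc using hc
  refine ⟨Matrix.of fun i j => (1 / 4) * (c i j + c j i), ?_, fun y => ?_⟩
  · ext i j
    simp [add_comm]
  · have h1 : ∀ i, eval y (pderiv i p) = ∑ j, y j * c i j := fun i => by
      have := congrArg (eval y) (hp.pderiv (i := i)).sum_X_mul_pderiv
      simpa [hc] using this.symm
    have h2 := congrArg (eval y) hp.sum_X_mul_pderiv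
    simp only [map_sum, map_mul, eval_X, h1, map_nsmul] at h2
    have h3 : ∑ i, ∑ j, y i * y j * c i j = 2 * eval y p := by
      rw [nsmul_eq_mul] at h2
      rw [← Nat.cast_ofNat, ← h2]
      refine Finset.sum_congr rfl fun i _ => ?_
      rw [Finset.mul_sum]
      exact Finset.sum_congr rfl fun j _ => by ring
    have h4 : ∑ i, ∑ j, y i * y j * c j i = 2 * eval y p := by
      rw [Finset.sum_comm, ← h3]
      exact Finset.sum_congr rfl fun i _ => Finset.sum_congr rfl fun j _ => by ring
    have h5 : y ⬝ᵥ (Matrix.of fun i j => (1 / 4) * (c i j + c j i)) *ᵥ y =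
        (1 / 4) * (∑ i, ∑ j, y i * y j * c i j + ∑ i, ∑ j, y i * y j * c j i) := by
      simp only [dotProduct, Matrix.mulVec, Matrix.of_apply, Finset.mul_sum,
        ← Finset.sum_add_distrib]
      exact Finset.sum_congr rfl fun i _ => Finset.sum_congr rfl fun j _ => by ring
    rw [h5, h3, h4]
    ring

theorem not_isUnit_of_isHomogeneous {p : MvPolynomial (Fin 4) ℂ} (hp : p.IsHomogeneous 2) :
    ¬ IsUnit p := by
  intro h
  have h1 := (h.map (eval (0 : Fin 4 → ℂ))).ne_zero
  apply h1
  have h2 := IsHomogeneous.coeff_eq_zero hp (d := 0) (by simp)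
  rw [eval_zero, constantCoeff_eq, h2]

/-- The two quadratic forms of a pair without common factor are linearly independent. -/
theorem pencil_ne_zero {σ : Fin 2 → MvPolynomial (Fin 4) ℂ} (h : ∀ i, (σ i).IsHomogeneous 2)
    (hc : NoCommonFactor σ) {s : Fin 2 → ℂ} (hs : s ≠ 0) :
    C (s 1) * σ 0 - C (s 0) * σ 1 ≠ 0 := by
  intro h0
  by_cases h1 : s 1 = 0
  · have h2 : s 0 ≠ 0 := by
      intro h2
      apply hs
      ext i
      fin_cases i
      · exact h2
      · exact h1
    have h3 : σ 1 = 0 := by simpa [h1, h2] using h0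
    refine not_isUnit_of_isHomogeneous (h 0) (hc _ fun i => ?_)
    fin_cases i
    · exact dvd_refl _
    · simp [h3]
  · have h3 : σ 0 = C (s 0 / s 1) * σ 1 := by
      have h4 : σ 0 = C (s 1)⁻¹ * (C (s 1) * σ 0) := by
        rw [← mul_assoc, ← C_mul, inv_mul_cancel₀ h1, C_1, one_mul]
      rw [h4, sub_eq_zero.mp h0, ← mul_assoc, ← C_mul, div_eq_inv_mul]
    refine not_isUnit_of_isHomogeneous (h 1) (hc _ fun i => ?_)
    fin_cases i
    · exact ⟨C (s 0 / s 1), by rw [mul_comm]; exact h3⟩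
    · exact dvd_refl _

/-- Three pairs of quadratic forms without common factor that invert, pointwise, the trilinear
map with coefficients `a`. -/
structure QuadraticInverse (a : TriCoeff) (σ τ υ : Fin 2 → MvPolynomial (Fin 4) ℂ) : Prop where
  hom_s : ∀ i, (σ i).IsHomogeneous 2
  hom_t : ∀ i, (τ i).IsHomogeneous 2
  hom_u : ∀ i, (υ i).IsHomogeneous 2
  coprime_s : NoCommonFactor σ
  coprime_t : NoCommonFactor τ
  coprime_u : NoCommonFactor υ
  left_s : ∀ s t u : Fin 2 → ℂ, eval (tri a s t u) (σ 0) * s 1 = eval (tri a s t u) (σ 1) * s 0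
  left_t : ∀ s t u : Fin 2 → ℂ, eval (tri a s t u) (τ 0) * t 1 = eval (tri a s t u) (τ 1) * t 0
  left_u : ∀ s t u : Fin 2 → ℂ, eval (tri a s t u) (υ 0) * u 1 = eval (tri a s t u) (υ 1) * u 0
  right : ∃ g l : MvPolynomial (Fin 4) ℂ, g ≠ 0 ∧ ∀ (y : Fin 4 → ℂ),
    eval y g • y = eval y l • tri a (fun i => eval y (σ i)) (fun i => eval y (τ i))
      (fun i => eval y (υ i))

/-- The coefficients with the first two groups of variables exchanged. -/
def swapST (a : TriCoeff) : TriCoeff := fun i j k l => a i k j l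

/-- The coefficients with the groups of variables in the order `u, s, t`. -/
def rotU (a : TriCoeff) : TriCoeff := fun i j k l => a i k l j

theorem tri_swapST (a : TriCoeff) (s t u : Fin 2 → ℂ) : tri (swapST a) t s u = tri a s t u := by
  funext i
  simp only [tri, swapST, Fin.sum_univ_two]
  ring

theorem tri_rotU (a : TriCoeff) (s t u : Fin 2 → ℂ) : tri (rotU a) u s t = tri a s t u := by
  funext i
  simp only [tri, rotU, Fin.sum_univ_two]
  ring

namespace QuadraticInverse

variable {a : TriCoeff} {σ τ υ : Fin 2 → MvPolynomial (Fin 4) ℂ}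

theorem swapST (h : QuadraticInverse a σ τ υ) :
    QuadraticInverse (LineCongruence.swapST a) τ σ υ where
  hom_s := h.hom_t
  hom_t := h.hom_s
  hom_u := h.hom_u
  coprime_s := h.coprime_t
  coprime_t := h.coprime_s
  coprime_u := h.coprime_u
  left_s s t u := by rw [tri_swapST]; exact h.left_t t s u
  left_t s t u := by rw [tri_swapST]; exact h.left_s t s u
  left_u s t u := by rw [tri_swapST]; exact h.left_u t s u
  right := by
    obtain ⟨g, l, hg, H⟩ := h.right
    exact ⟨g, l, hg, fun y => by rw [tri_swapST]; exact H y⟩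

theorem rotU (h : QuadraticInverse a σ τ υ) :
    QuadraticInverse (LineCongruence.rotU a) υ σ τ where
  hom_s := h.hom_u
  hom_t := h.hom_s
  hom_u := h.hom_t
  coprime_s := h.coprime_u
  coprime_t := h.coprime_s
  coprime_u := h.coprime_t
  left_s s t u := by rw [tri_rotU]; exact h.left_u t u s
  left_t s t u := by rw [tri_rotU]; exact h.left_s t u s
  left_u s t u := by rw [tri_rotU]; exact h.left_t t u s
  right := by
    obtain ⟨g, l, hg, H⟩ := h.right
    exact ⟨g, l, hg, fun y => by rw [tri_rotU]; exact H y⟩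

/-- A row vector annihilating all slices of the map would give, after substituting the inverse,
a relation `∑ σ₀ ^ (d - j) σ₁ ^ j vⱼ = 0` with linear forms `vⱼ`; then `σ₀` divides `v_d`. -/
theorem exists_det_slice_ne_zero (h : QuadraticInverse a σ τ υ) :
    ∃ s, (slice a s).det ≠ 0 := by
  by_contra! hdet
  let M : Matrix (Fin 4) (Fin 4) (Polynomial ℂ) := Matrix.of fun i j =>
    Polynomial.C (slice a ![1, 0] i j) + Polynomial.X * Polynomial.C (slice a ![0, 1] i j)
  have hMx : ∀ x : ℂ, M.map (Polynomial.eval x) = slice a ![1, x] := by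
    intro x
    have : (![1, x] : Fin 2 → ℂ) = ![1, 0] + x • ![0, 1] := by simp
    rw [this, slice_add, slice_smul]
    ext i j
    simp [M, mul_comm x]
  have hM : M.det = 0 := by
    refine Polynomial.funext fun x => ?_
    rw [← Polynomial.coe_evalRingHom, RingHom.map_det (Polynomial.evalRingHom x), map_zero]
    exact (congrArg Matrix.det (hMx x)).trans (hdet _)
  obtain ⟨v, hv0, hv⟩ := Matrix.exists_vecMul_eq_zero_iff.mpr hM
  have hvx : ∀ (x : ℂ) (t u : Fin 2 → ℂ),
      (fun i => Polynomial.eval x (v i)) ⬝ᵥ tri a ![1, x] t u = 0 := by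
    intro x t u
    rw [tri_eq_slice, Matrix.dotProduct_mulVec]
    have : (fun i => Polynomial.eval x (v i)) ᵥ* slice a ![1, x] = 0 := by
      rw [← hMx]
      funext j
      have := congrArg (Polynomial.eval x) (congrFun hv j)
      simpa [Matrix.vecMul, dotProduct, Polynomial.eval_finsetSum] using this
    rw [this, zero_dotProduct]
  -- the maximal degree of the entries
  obtain ⟨d, hd, i₀, hi₀⟩ : ∃ d : ℕ, (∀ i, (v i).natDegree ≤ d) ∧ ∃ i, (v i).coeff d ≠ 0 := by
    obtain ⟨i₁, hi₁⟩ := Function.ne_iff.mp hv0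
    have hs : (Finset.univ.filter fun i => v i ≠ 0).Nonempty := ⟨i₁, by simpa using hi₁⟩
    obtain ⟨i₀, hm, hmax⟩ := Finset.exists_max_image _ (fun i => (v i).natDegree) hs
    refine ⟨(v i₀).natDegree, fun i => ?_, i₀, ?_⟩
    · by_cases hi : v i = 0
      · simp [hi]
      · exact hmax i (by simpa using hi)
    · rw [Polynomial.coeff_natDegree]
      simpa using hm
  let L : ℕ → MvPolynomial (Fin 4) ℂ := fun j => ∑ i, C ((v i).coeff j) * X i
  obtain ⟨g, l, hg, hgl⟩ := h.right
  have hσ0 : σ 0 ≠ 0 := by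
    have := pencil_ne_zero h.hom_s h.coprime_s (s := ![0, 1]) (by simp)
    simpa using this
  have hsum : ∑ j ∈ Finset.range (d + 1), σ 0 ^ (d - j) * σ 1 ^ j * L j = 0 := by
    have hprod : (σ 0 * g) * ∑ j ∈ Finset.range (d + 1), σ 0 ^ (d - j) * σ 1 ^ j * L j = 0 := by
      refine MvPolynomial.funext fun y => ?_
      rw [map_zero, map_mul, map_mul]
      by_cases hy : eval y (σ 0) = 0
      · simp [hy]
      set p := eval y (σ 0) with hp
      set x := eval y (σ 1) / p with hx
      have e1 : eval y (∑ j ∈ Finset.range (d + 1), σ 0 ^ (d - j) * σ 1 ^ j * L j) =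
          p ^ d * ((fun i => Polynomial.eval x (v i)) ⬝ᵥ y) := by
        have e2 : ∀ i, Polynomial.eval x (v i) =
            ∑ j ∈ Finset.range (d + 1), (v i).coeff j * x ^ j := fun i =>
          Polynomial.eval_eq_sum_range' (Nat.lt_succ_of_le (hd i)) x
        have e3 : ∀ j ∈ Finset.range (d + 1), p ^ (d - j) * eval y (σ 1) ^ j = p ^ d * x ^ j := by
          intro j hj
          have hj' : j ≤ d := Nat.lt_succ_iff.mp (Finset.mem_range.mp hj)
          have h6 : eval y (σ 1) = p * x := by rw [hx]; field_simp
          rw [h6, mul_pow, ← mul_assoc, ← pow_add, Nat.sub_add_cancel hj']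
        simp only [dotProduct, e2, map_sum, map_mul, map_pow, L, eval_C, eval_X, Finset.sum_mul]
        rw [Finset.sum_comm, Finset.mul_sum]
        refine Finset.sum_congr rfl fun j hj => ?_
        rw [← hp, e3 j hj, Finset.mul_sum, Finset.mul_sum]
        exact Finset.sum_congr rfl fun i _ => by ring
      have e4 : tri a (fun i => eval y (σ i)) (fun i => eval y (τ i)) (fun i => eval y (υ i)) =
          p • tri a ![1, x] (fun i => eval y (τ i)) (fun i => eval y (υ i)) := by
        have : (fun i => eval y (σ i)) = p • ![1, x] := by
          ext i
          fin_cases i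
          · simp [hp]
          · simp [hx]
            field_simp
        rw [tri_eq_slice, tri_eq_slice, this, slice_smul, Matrix.smul_mulVec]
      have e5 : eval y g * ((fun i => Polynomial.eval x (v i)) ⬝ᵥ y) = 0 := by
        rw [← smul_eq_mul, ← dotProduct_smul, hgl, e4, dotProduct_smul, dotProduct_smul, hvx]
        simp
      rw [e1]
      linear_combination p * p ^ d * e5
    exact (mul_eq_zero.mp hprod).resolve_left (mul_ne_zero hσ0 hg)
  have hLd : L d ≠ 0 := by
    intro h0
    apply hi₀
    have := congrArg (eval (Pi.single i₀ 1)) h0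
    simpa [L, Pi.single_apply] using this
  have hdvd : σ 0 ∣ σ 1 ^ d * L d := by
    rw [Finset.sum_range_succ, Nat.sub_self, pow_zero, one_mul] at hsum
    rw [eq_neg_of_add_eq_zero_right hsum]
    refine (Finset.dvd_sum fun j hj => ?_).neg_right
    have : d - j ≠ 0 := by
      have := Finset.mem_range.mp hj
      omega
    exact ((dvd_pow_self _ this).mul_right _).mul_right _
  have hrel : IsRelPrime (σ 0) (σ 1) := fun q h0 h1 => h.coprime_s q fun i => by
    fin_cases i
    · exact h0
    · exact h1
  have hdvd' := (hrel.pow_right (n := d)).dvd_of_dvd_mul_left hdvd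
  obtain ⟨q, hq⟩ := hdvd'
  have hq0 : q ≠ 0 := by
    rintro rfl
    exact hLd (by rw [hq, mul_zero])
  have hLdeg : (L d).IsHomogeneous 1 := by
    refine IsHomogeneous.sum _ _ _ fun i _ => ?_
    simpa using (isHomogeneous_C (Fin 4) ((v i).coeff d)).mul (isHomogeneous_X ℂ i)
  have h1 := hLdeg.totalDegree hLd
  rw [hq, totalDegree_mul_of_isDomain hσ0 hq0, (h.hom_s 0).totalDegree hσ0] at h1
  omega

/-- A kernel of dimension three would meet `t ⊗ ℂ²` for all `t`, so no slice in the second direction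
would be invertible. -/
theorem finrank_ker_slice_le (h : QuadraticInverse a σ τ υ) {s : Fin 2 → ℂ} (hs : s ≠ 0) :
    finrank ℂ (LinearMap.ker (slice a s).toLin') ≤ 2 := by
  by_contra! h3
  obtain ⟨t, ht⟩ := h.swapST.exists_det_slice_ne_zero
  have ht0 : t ≠ 0 := by
    rintro rfl
    apply ht
    have : slice (LineCongruence.swapST a) 0 = 0 := by
      simpa using slice_smul (LineCongruence.swapST a) 0 0
    rw [this, Matrix.det_zero]
  -- the kernel contains some `t ⊗ u`
  let F : (Fin 2 → ℂ) →ₗ[ℂ] (Fin 4 → ℂ) :=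
    { toFun := tens t
      map_add' := tens_add_right t
      map_smul' := fun c u => tens_smul_right c t u }
  have hF : Function.Injective F := by
    rw [injective_iff_map_eq_zero]
    intro u hu
    by_contra hu0
    exact tens_ne_zero_iff.mpr ⟨ht0, hu0⟩ hu
  have h1 := LinearMap.finrank_range_of_inj hF
  have h2 := Submodule.finrank_sup_add_finrank_inf_eq (LinearMap.ker (slice a s).toLin')
    (LinearMap.range F)
  have h4 := Submodule.finrank_le (LinearMap.ker (slice a s).toLin' ⊔ LinearMap.range F)
  rw [finrank_fin_fun] at h1 h4
  have h5 : LinearMap.ker (slice a s).toLin' ⊓ LinearMap.range F ≠ ⊥ := by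
    intro h0
    rw [h0, finrank_bot] at h2
    omega
  obtain ⟨w, ⟨hw, u, rfl⟩, hw0⟩ := (Submodule.ne_bot_iff _).mp h5
  have hu0 : u ≠ 0 := by
    rintro rfl
    exact hw0 (map_zero F)
  have h6 : slice a s *ᵥ tens t u = 0 := hw
  rw [← tri_eq_slice, ← tri_swapST, tri_eq_slice] at h6
  exact tens_ne_zero_iff.mpr ⟨hs, hu0⟩ (Matrix.eq_zero_of_mulVec_eq_zero ht h6)

/-- The kernel of a slice contains no ruling `t ⊗ ℂ²`: the slices in the third direction would all
be singular. -/
theorem not_forall_tri_left (h : QuadraticInverse a σ τ υ) {s t : Fin 2 → ℂ} (hs : s ≠ 0)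
    (ht : t ≠ 0) : ¬ ∀ u, tri a s t u = 0 := by
  intro h0
  obtain ⟨u, hu⟩ := h.rotU.exists_det_slice_ne_zero
  have h6 := h0 u
  rw [← tri_rotU, tri_eq_slice] at h6
  exact tens_ne_zero_iff.mpr ⟨hs, ht⟩ (Matrix.eq_zero_of_mulVec_eq_zero hu h6)

/-- The kernel of a slice contains no ruling `ℂ² ⊗ u`: the slices in the second direction would all
be singular. -/
theorem not_forall_tri_mid (h : QuadraticInverse a σ τ υ) {s u : Fin 2 → ℂ} (hs : s ≠ 0)
    (hu : u ≠ 0) : ¬ ∀ t, tri a s t u = 0 := by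
  intro h0
  obtain ⟨t, ht⟩ := h.swapST.exists_det_slice_ne_zero
  have h6 := h0 t
  rw [← tri_swapST, tri_eq_slice] at h6
  exact tens_ne_zero_iff.mpr ⟨hs, hu⟩ (Matrix.eq_zero_of_mulVec_eq_zero ht h6)

/-- For a map with a quadratic inverse, the kernel of the slice at some parameter `r` is a tangent
line of the quadric of rank one tensors, and Jordan chains start at no other parameter. -/
theorem exists_tangent (h : QuadraticInverse a σ τ υ) :
    ∃ r t u x u' : Fin 2 → ℂ, r ≠ 0 ∧ tri a r t u = 0 ∧
      tri a r x u + tri a r t u' = 0 ∧ det2 t x ≠ 0 ∧ det2 u u' ≠ 0 ∧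
      ∀ (r₂ r₃ : Fin 2 → ℂ) (m₀ m₁ : Fin 4 → ℂ), det2 r₂ r₃ ≠ 0 → m₁ ≠ 0 →
        slice a r₂ *ᵥ m₁ = 0 → slice a r₂ *ᵥ m₀ + slice a r₃ *ᵥ m₁ = 0 → det2 r r₂ = 0 := by
  obtain ⟨s₀, hs₀⟩ := h.exists_det_slice_ne_zero
  obtain ⟨E₀, h₀, e₀⟩ := exists_symm_matrix (h.hom_s 0)
  obtain ⟨E₁, h₁, e₁⟩ := exists_symm_matrix (h.hom_s 1)
  have he : ∀ (s : Fin 2 → ℂ) (y : Fin 4 → ℂ), y ⬝ᵥ (s 1 • E₀ - s 0 • E₁) *ᵥ y =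
      s 1 * eval y (σ 0) - s 0 * eval y (σ 1) := by
    intro s y
    rw [Matrix.sub_mulVec, Matrix.smul_mulVec, Matrix.smul_mulVec, dotProduct_sub,
      dotProduct_smul, dotProduct_smul, e₀, e₁, smul_eq_mul, smul_eq_mul]
  obtain ⟨r, t, u, x, u', h1, h2, h3, h4, h5, -, h6⟩ := exists_tangent_kernel hs₀ h₀ h₁
    (fun s hs h0 => pencil_ne_zero h.hom_s h.coprime_s hs <| MvPolynomial.funext fun y => by
      have := he s y
      rw [h0] at this
      simpa using this.symm)
    (fun s t u => by
      rw [he, ← tri_eq_slice]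
      linear_combination h.left_s s t u)
    (fun s hs => h.finrank_ker_slice_le hs)
    (fun s t hs ht h0 => h.not_forall_tri_left hs ht fun u => by rw [tri_eq_slice]; exact h0 u)
    (fun s u hs hu h0 => h.not_forall_tri_mid hs hu fun t => by rw [tri_eq_slice]; exact h0 t)
  refine ⟨r, t, u, x, u', h1, ?_, ?_, h4, h5, h6⟩
  · rw [tri_eq_slice, h2]
  · rw [tri_eq_slice, tri_eq_slice, ← Matrix.mulVec_add, h3]

/-- In suitable bases of the three planes, the map vanishes at the point `(0, 0, 0)` of the cube
and takes the same value at its three neighbours. -/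
theorem exists_bases (h : QuadraticInverse a σ τ υ) :
    ∃ s₀ s₁ t₀ t₁ u₀ u₁ : Fin 2 → ℂ, det2 s₀ s₁ ≠ 0 ∧ det2 t₀ t₁ ≠ 0 ∧ det2 u₀ u₁ ≠ 0 ∧
      tri a s₀ t₀ u₀ = 0 ∧ tri a s₀ t₁ u₀ = tri a s₁ t₀ u₀ ∧
      tri a s₀ t₀ u₁ = tri a s₁ t₀ u₀ := by
  obtain ⟨r, t, u, x, u', hr, e1, e2, hx, hu', Cr⟩ := h.exists_tangent
  obtain ⟨p, s₂, u₂, x₂, u₂', hp, f1, f2, hx₂, hu₂', Cs⟩ := h.swapST.exists_tangent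
  rw [tri_swapST] at f1
  rw [tri_swapST, tri_swapST] at f2
  have add_s : ∀ s s' t u : Fin 2 → ℂ, tri a (s + s') t u = tri a s t u + tri a s' t u := fun s s' t u => by
    simp only [tri_eq_slice, slice_add, Matrix.add_mulVec]
  have smul_s : ∀ (c : ℂ) (s t u : Fin 2 → ℂ), tri a (c • s) t u = c • tri a s t u := fun c s t u => by
    simp only [tri_eq_slice, slice_smul, Matrix.smul_mulVec]
  have smul_t : ∀ (c : ℂ) (s t u : Fin 2 → ℂ), tri a s (c • t) u = c • tri a s t u := fun c s t u => by
    simp only [tri_eq_slice, tens_smul_left, Matrix.mulVec_smul]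
  have add_u : ∀ s t u u' : Fin 2 → ℂ, tri a s t (u + u') = tri a s t u + tri a s t u' := fun s t u u' => by
    simp only [tri_eq_slice, tens_add_right, Matrix.mulVec_add]
  have smul_u : ∀ (c : ℂ) (s t u : Fin 2 → ℂ), tri a s t (c • u) = c • tri a s t u := fun c s t u => by
    simp only [tri_eq_slice, tens_smul_right, Matrix.mulVec_smul]
  have ht := (ne_zero_of_det2 hx).1
  have hu := (ne_zero_of_det2 hu').1
  have hu₂ := (ne_zero_of_det2 hu₂').1
  have hs₂ := (ne_zero_of_det2 hx₂).1
  -- the special parameter of each direction starts a Jordan chain in the other direction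
  obtain ⟨c, rfl⟩ : ∃ c : ℂ, t = c • p := by
    refine exists_eq_smul_of_det2 hp (Cs t x (tens r u') (tens r u) hx
      (tens_ne_zero_iff.mpr ⟨hr, hu⟩) ?_ ?_)
    · rw [← tri_eq_slice, tri_swapST, e1]
    · rw [← tri_eq_slice, ← tri_eq_slice, tri_swapST, tri_swapST, add_comm, e2]
  obtain ⟨d, rfl⟩ : ∃ d : ℂ, s₂ = d • r := by
    refine exists_eq_smul_of_det2 hr (Cr s₂ x₂ (tens p u₂') (tens p u₂) hx₂
      (tens_ne_zero_iff.mpr ⟨hp, hu₂⟩) ?_ ?_)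
    · rw [← tri_eq_slice, f1]
    · rw [← tri_eq_slice, ← tri_eq_slice, add_comm, f2]
  have hd : d ≠ 0 := by
    rintro rfl
    exact hs₂ (zero_smul _ _)
  have f3 : tri a r (c • p) u₂ = 0 := by
    rw [smul_s] at f1
    rw [smul_t, (smul_eq_zero.mp f1).resolve_left hd, smul_zero]
  obtain ⟨e, rfl⟩ : ∃ e : ℂ, u₂ = e • u := by
    refine exists_eq_smul_of_det2 hu ?_
    by_contra hne
    refine h.not_forall_tri_left hr ht fun v => ?_
    obtain ⟨k, l, rfl⟩ := exists_combination_of_det2 hne v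
    rw [add_u, smul_u, smul_u, e1, f3]
    simp
  have he : e ≠ 0 := by
    rintro rfl
    exact hu₂ (zero_smul _ _)
  obtain ⟨k, l, rfl⟩ := exists_combination_of_det2 hu' u₂'
  have hl : l ≠ 0 := by
    rintro rfl
    apply hu₂'
    simp [det2]
    ring
  have f4 : e • tri a x₂ (c • p) u + (d * l) • tri a r (c • p) u' = 0 := by
    rw [smul_t] at e1
    have f5 := congrArg (fun v => c • v) f2
    simp only [smul_s, smul_u, add_u, smul_add, smul_zero] at f5
    rw [smul_t, smul_t, ← f5, smul_comm c d (k • _), smul_comm c k, e1]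
    module
  refine ⟨r, (e / (d * l)) • x₂, c • p, x, u, (-1 : ℂ) • u', ?_, hx, ?_, e1, ?_, ?_⟩
  · rw [det2_smul_right]
    refine mul_ne_zero (div_ne_zero he (mul_ne_zero hd hl)) fun h0 => hx₂ ?_
    have : det2 (d • r) x₂ = d * det2 r x₂ := by
      simp [det2]
      ring
    rw [this, h0, mul_zero]
  · rw [det2_smul_right]
    exact mul_ne_zero (by norm_num) hu'
  all_goals
    have f6 : (e / (d * l)) • tri a x₂ (c • p) u = (-1 : ℂ) • tri a r (c • p) u' := by
      have f7 : tri a x₂ (c • p) u = (-(d * l) / e) • tri a r (c • p) u' := by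
        rw [← smul_right_injective _ he |>.eq_iff]
        rw [smul_smul, mul_div_cancel₀ _ he, eq_neg_of_add_eq_zero_left f4, neg_smul]
      rw [f7, smul_smul]
      congr 1
      field_simp
    rw [smul_s, f6]
  · rw [eq_neg_of_add_eq_zero_left e2, neg_one_smul]
  · rw [smul_u]

end QuadraticInverse

/-! ### Values on the vertices of a cube -/

/-- The array of coefficients of a point of `ℙ³¹`. -/
def coeffs (v : Fin 4 × Fin 2 × Fin 2 × Fin 2 → ℂ) : TriCoeff := fun i j k l => v (i, j, k, l)

theorem eval_value {κ : Type} (φ : TrilinearTuple) (σ τ υ : Fin 2 → MvPolynomial κ ℂ) (y : κ → ℂ)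
    (i : Fin 4) : eval y (value φ σ τ υ i) =
      tri (coeffs φ.rep) (fun j => eval y (σ j)) (fun j => eval y (τ j)) (fun j => eval y (υ j))
        i := by
  simp [value, tri, coeffs]

theorem eval_aeval_form (φ : TrilinearTuple) (p : MvPolynomial (Fin 4) ℂ) (y : Fin 3 × Fin 2 → ℂ) :
    eval y (aeval (form φ) p) = eval (tri (coeffs φ.rep) (fun j => y (0, j)) (fun j => y (1, j))
      fun j => y (2, j)) p := by
  have h : (eval y).comp (aeval (form φ)).toRingHom =
      eval (tri (coeffs φ.rep) (fun j => y (0, j)) (fun j => y (1, j)) fun j => y (2, j)) := by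
    refine MvPolynomial.ringHom_ext (fun c => ?_) fun i => ?_
    · simp
    · have := eval_value φ (fun j => (X (0, j) : CoordRing)) (fun j => X (1, j))
        (fun j => X (2, j)) y i
      simp only [eval_X] at this
      simpa [form] using this
  exact congrArg (fun g => g p) h

/-- The coordinates on the coordinate ring of `ℙ¹ × ℙ¹ × ℙ¹` of a triple of vectors. -/
def cubePoint (s t u : Fin 2 → ℂ) : Fin 3 × Fin 2 → ℂ := fun p => ![s, t, u] p.1 p.2

/-- An inverse rational map inverts the trilinear map pointwise, up to scalar factors. -/
theorem quadraticInverse_of_isInverse {φ : TrilinearTuple}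
    {σ τ υ : Fin 2 → MvPolynomial (Fin 4) ℂ} (h1 : ∀ i, (σ i).IsHomogeneous 2)
    (h2 : ∀ i, (τ i).IsHomogeneous 2) (h3 : ∀ i, (υ i).IsHomogeneous 2) (c1 : NoCommonFactor σ)
    (c2 : NoCommonFactor τ) (c3 : NoCommonFactor υ) (h : IsInverse φ σ τ υ) :
    QuadraticInverse (coeffs φ.rep) σ τ υ where
  hom_s := h1
  hom_t := h2
  hom_u := h3
  coprime_s := c1
  coprime_t := c2
  coprime_u := c3
  left_s s t u := by
    have := congrArg (eval (cubePoint s t u)) (h.left_s.2 0 1)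
    simp only [map_mul, eval_aeval_form, eval_X] at this
    exact this
  left_t s t u := by
    have := congrArg (eval (cubePoint s t u)) (h.left_t.2 0 1)
    simp only [map_mul, eval_aeval_form, eval_X] at this
    exact this
  left_u s t u := by
    have := congrArg (eval (cubePoint s t u)) (h.left_u.2 0 1)
    simp only [map_mul, eval_aeval_form, eval_X] at this
    exact this
  right := by
    obtain ⟨i, hi⟩ := h.right.1
    refine ⟨_, X i, hi, fun y => ?_⟩
    ext j
    have := congrArg (eval y) (h.right.2 i j)
    rw [map_mul, map_mul, eval_X, eval_X, eval_value φ σ τ υ y j] at this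
    rw [Pi.smul_apply, Pi.smul_apply, eval_X, smul_eq_mul, smul_eq_mul, this, mul_comm]

theorem exists_common_ne_zero {κ : Type} {P Q : MvPolynomial κ ℂ} (hP : P ≠ 0) (hQ : Q ≠ 0) :
    ∃ y, eval y P ≠ 0 ∧ eval y Q ≠ 0 := by
  by_contra! h
  refine mul_ne_zero hP hQ (MvPolynomial.funext fun y => ?_)
  rw [map_mul, map_zero]
  by_cases hy : eval y P = 0
  · rw [hy, zero_mul]
  · rw [h y hy, mul_zero]

theorem tri_combination (a : TriCoeff) (s₀ s₁ t₀ t₁ u₀ u₁ x y z : Fin 2 → ℂ) :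
    tri a (x 0 • s₀ + x 1 • s₁) (y 0 • t₀ + y 1 • t₁) (z 0 • u₀ + z 1 • u₁) =
      (x 0 * y 0 * z 0) • tri a s₀ t₀ u₀ + (x 1 * y 0 * z 0) • tri a s₁ t₀ u₀ +
      (x 0 * y 1 * z 0) • tri a s₀ t₁ u₀ + (x 0 * y 0 * z 1) • tri a s₀ t₀ u₁ +
      (x 0 * y 1 * z 1) • tri a s₀ t₁ u₁ + (x 1 * y 0 * z 1) • tri a s₁ t₀ u₁ +
      (x 1 * y 1 * z 0) • tri a s₁ t₁ u₀ + (x 1 * y 1 * z 1) • tri a s₁ t₁ u₁ := by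
  funext i
  simp only [tri, Fin.sum_univ_two, Pi.add_apply, Pi.smul_apply, smul_eq_mul,
    Algebra.algebraMap_self, RingHom.id_apply]
  ring

/-- The values of the trilinear map on the vertices of the cube given by three bases: it vanishes
at one vertex, takes the value `A` at the neighbours, `Bᵢ` at the next vertices, and `C` at the
opposite vertex. -/
structure CubeValues (a : TriCoeff) (s₀ s₁ t₀ t₁ u₀ u₁ : Fin 2 → ℂ)
    (A B₁ B₂ B₃ C : Fin 4 → ℂ) : Prop where
  det_s : det2 s₀ s₁ ≠ 0
  det_t : det2 t₀ t₁ ≠ 0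
  det_u : det2 u₀ u₁ ≠ 0
  e000 : tri a s₀ t₀ u₀ = 0
  e100 : tri a s₁ t₀ u₀ = A
  e010 : tri a s₀ t₁ u₀ = A
  e001 : tri a s₀ t₀ u₁ = A
  e011 : tri a s₀ t₁ u₁ = B₁
  e101 : tri a s₁ t₀ u₁ = B₂
  e110 : tri a s₁ t₁ u₀ = B₃
  e111 : tri a s₁ t₁ u₁ = C

namespace CubeValues

variable {a : TriCoeff} {s₀ s₁ t₀ t₁ u₀ u₁ : Fin 2 → ℂ} {A B₁ B₂ B₃ C : Fin 4 → ℂ}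

theorem swapST (h : CubeValues a s₀ s₁ t₀ t₁ u₀ u₁ A B₁ B₂ B₃ C) :
    CubeValues (LineCongruence.swapST a) t₀ t₁ s₀ s₁ u₀ u₁ A B₂ B₁ B₃ C where
  det_s := h.det_t
  det_t := h.det_s
  det_u := h.det_u
  e000 := by rw [tri_swapST]; exact h.e000
  e100 := by rw [tri_swapST]; exact h.e010
  e010 := by rw [tri_swapST]; exact h.e100
  e001 := by rw [tri_swapST]; exact h.e001
  e011 := by rw [tri_swapST]; exact h.e101
  e101 := by rw [tri_swapST]; exact h.e011
  e110 := by rw [tri_swapST]; exact h.e110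
  e111 := by rw [tri_swapST]; exact h.e111

theorem rotU (h : CubeValues a s₀ s₁ t₀ t₁ u₀ u₁ A B₁ B₂ B₃ C) :
    CubeValues (LineCongruence.rotU a) u₀ u₁ s₀ s₁ t₀ t₁ A B₃ B₁ B₂ C where
  det_s := h.det_u
  det_t := h.det_s
  det_u := h.det_t
  e000 := by rw [tri_rotU]; exact h.e000
  e100 := by rw [tri_rotU]; exact h.e001
  e010 := by rw [tri_rotU]; exact h.e100
  e001 := by rw [tri_rotU]; exact h.e010
  e011 := by rw [tri_rotU]; exact h.e110
  e101 := by rw [tri_rotU]; exact h.e011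
  e110 := by rw [tri_rotU]; exact h.e101
  e111 := by rw [tri_rotU]; exact h.e111

theorem tri_eq (h : CubeValues a s₀ s₁ t₀ t₁ u₀ u₁ A B₁ B₂ B₃ C) (x y z : Fin 2 → ℂ) :
    tri a (x 0 • s₀ + x 1 • s₁) (y 0 • t₀ + y 1 • t₁) (z 0 • u₀ + z 1 • u₁) =
      (x 1 * y 0 * z 0 + x 0 * y 1 * z 0 + x 0 * y 0 * z 1) • A + (x 0 * y 1 * z 1) • B₁ +
      (x 1 * y 0 * z 1) • B₂ + (x 1 * y 1 * z 0) • B₃ + (x 1 * y 1 * z 1) • C := by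
  rw [tri_combination, h.e000, h.e100, h.e010, h.e001, h.e011, h.e101, h.e110, h.e111]
  module

theorem exists_coords {s₀ s₁ : Fin 2 → ℂ} (h : det2 s₀ s₁ ≠ 0) (s : Fin 2 → ℂ) :
    ∃ x : Fin 2 → ℂ, s = x 0 • s₀ + x 1 • s₁ := by
  obtain ⟨c, d, rfl⟩ := exists_combination_of_det2 h s
  exact ⟨![c, d], rfl⟩

/-- The values on the vertices of the cube span `ℂ⁴`, since some slice is invertible. -/
theorem span_eq_top (h : CubeValues a s₀ s₁ t₀ t₁ u₀ u₁ A B₁ B₂ B₃ C) {s : Fin 2 → ℂ}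
    (hs : (slice a s).det ≠ 0) {W : Submodule ℂ (Fin 4 → ℂ)} (hA : A ∈ W) (h1 : B₁ ∈ W)
    (h2 : B₂ ∈ W) (h3 : B₃ ∈ W) (hC : C ∈ W) : W = ⊤ := by
  have hmem : ∀ s t u : Fin 2 → ℂ, tri a s t u ∈ W := by
    intro s t u
    obtain ⟨x, rfl⟩ := exists_coords h.det_s s
    obtain ⟨y, rfl⟩ := exists_coords h.det_t t
    obtain ⟨z, rfl⟩ := exists_coords h.det_u u
    rw [h.tri_eq]
    exact W.add_mem (W.add_mem (W.add_mem (W.add_mem (W.smul_mem _ hA) (W.smul_mem _ h1))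
      (W.smul_mem _ h2)) (W.smul_mem _ h3)) (W.smul_mem _ hC)
  rw [eq_top_iff]
  intro w _
  have hu : IsUnit (slice a s).det := isUnit_iff_ne_zero.mpr hs
  have hw : w = slice a s *ᵥ ((slice a s)⁻¹ *ᵥ w) := by
    rw [Matrix.mulVec_mulVec, Matrix.mul_nonsing_inv _ hu, Matrix.one_mulVec]
  set v := (slice a s)⁻¹ *ᵥ w
  have hv : v = v 0 • tens ![1, 0] ![1, 0] + v 1 • tens ![1, 0] ![0, 1] +
      v 2 • tens ![0, 1] ![1, 0] + v 3 • tens ![0, 1] ![0, 1] := by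
    ext i
    fin_cases i <;> simp [tens]
  rw [hw, hv]
  simp only [Matrix.mulVec_add, Matrix.mulVec_smul, ← tri_eq_slice]
  exact W.add_mem (W.add_mem (W.add_mem (W.smul_mem _ (hmem _ _ _)) (W.smul_mem _ (hmem _ _ _)))
    (W.smul_mem _ (hmem _ _ _))) (W.smul_mem _ (hmem _ _ _))

/-- The determinant of the slices is, in the coordinates of the basis `s₀, s₁`, a binary quartic
with the triple root `s₀`. -/
theorem det_slice (h : CubeValues a s₀ s₁ t₀ t₁ u₀ u₁ A B₁ B₂ B₃ C) (x : Fin 2 → ℂ) :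
    (slice a (x 0 • s₀ + x 1 • s₁)).det * (det2 t₀ t₁ * det2 u₀ u₁) ^ 2 =
      x 1 ^ 3 * (x 0 * (Matrix.of ![A, B₂, B₃, B₁]).det +
        x 1 * (Matrix.of ![A, B₂, B₃, C]).det) := by
  have h1 : slice a (x 0 • s₀ + x 1 • s₁) *
      (Matrix.of ![tens t₀ u₀, tens t₀ u₁, tens t₁ u₀, tens t₁ u₁])ᵀ =
      (Matrix.of ![x 1 • A, x 0 • A + x 1 • B₂, x 0 • A + x 1 • B₃, x 0 • B₁ + x 1 • C])ᵀ := by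
    have e : ∀ y z : Fin 2 → ℂ, slice a (x 0 • s₀ + x 1 • s₁) *ᵥ
        tens (y 0 • t₀ + y 1 • t₁) (z 0 • u₀ + z 1 • u₁) = _ := fun y z =>
      (tri_eq_slice _ _ _ _).symm.trans (h.tri_eq x y z)
    have e0 := e ![1, 0] ![1, 0]
    have e1 := e ![1, 0] ![0, 1]
    have e2 := e ![0, 1] ![1, 0]
    have e3 := e ![0, 1] ![0, 1]
    simp only [Matrix.cons_val_zero, Matrix.cons_val_one, one_smul, zero_smul, add_zero, zero_add,
      mul_one, mul_zero] at e0 e1 e2 e3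
    ext i j
    fin_cases j
    · exact congrFun e0 i
    · exact congrFun e1 i
    · exact congrFun e2 i
    · exact congrFun e3 i
  have h2 : (Matrix.of ![tens t₀ u₀, tens t₀ u₁, tens t₁ u₀, tens t₁ u₁]).det =
      (det2 t₀ t₁ * det2 u₀ u₁) ^ 2 := by
    simp [Matrix.det_succ_row_zero, Fin.sum_univ_succ, tens, det2, Fin.succAbove]
    ring
  have h3 := congrArg Matrix.det h1
  rw [Matrix.det_mul, Matrix.det_transpose, Matrix.det_transpose, h2] at h3
  rw [h3]
  simp [Matrix.det_succ_row_zero, Fin.sum_univ_succ, Fin.succAbove]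
  ring

end CubeValues

/-! ### The quadric of relations -/

theorem QuadraticInverse.exists_eval_ne_zero {a : TriCoeff}
    {σ τ υ : Fin 2 → MvPolynomial (Fin 4) ℂ} (h : QuadraticInverse a σ τ υ) :
    ∃ s t u : Fin 2 → ℂ, eval (tri a s t u) (σ 0) ≠ 0 := by
  obtain ⟨g, l, hg, H⟩ := h.right
  have hσ0 : σ 0 ≠ 0 := by
    simpa using pencil_ne_zero h.hom_s h.coprime_s (s := ![0, 1]) (by simp)
  obtain ⟨y, hy, hy'⟩ := exists_common_ne_zero hg hσ0
  by_contra! h0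
  refine mul_ne_zero (pow_ne_zero 2 hy) hy' ?_
  rw [← PSpace.eval_smul (h.hom_s 0), H y, PSpace.eval_smul (h.hom_s 0), h0, mul_zero]

/-- The reflection in a non-isotropic vector preserves the quadric
`e m = n₁ n₂ + n₁ n₃ + n₂ n₃`. -/
theorem reflection_mem_quadric {m n₁ n₂ n₃ e ym y₁ y₂ y₃ ye Q β : ℂ}
    (hy : ye * ym = y₁ * y₂ + y₁ * y₃ + y₂ * y₃)
    (hQ : Q = e * m - (n₁ * n₂ + n₁ * n₃ + n₂ * n₃))
    (hβ : β = m * ye + e * ym - (n₂ + n₃) * y₁ - (n₁ + n₃) * y₂ - (n₁ + n₂) * y₃) :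
    (Q * y₂ - β * n₂) * (Q * y₃ - β * n₃) + (Q * y₁ - β * n₁) * (Q * y₃ - β * n₃) +
      (Q * y₁ - β * n₁) * (Q * y₂ - β * n₂) = (Q * ye - e * β) * (Q * ym - β * m) := by
  subst hQ hβ
  linear_combination (-(e * m - (n₁ * n₂ + n₁ * n₃ + n₂ * n₃)) ^ 2) * hy

/-- The coordinates `(m, n₁, n₂, n₃, e)` of a linear relation between the five values of the map
on the vertices of the cube satisfy `e m = n₁ n₂ + n₁ n₃ + n₂ n₃`: otherwise the reflection of the
relation in this quadric would give two distinct points with the same image. -/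
theorem CubeValues.quadric_of_ne_zero {a : TriCoeff} {σ τ υ : Fin 2 → MvPolynomial (Fin 4) ℂ}
    (h : QuadraticInverse a σ τ υ) {s₀ s₁ t₀ t₁ u₀ u₁ : Fin 2 → ℂ} {A B₁ B₂ B₃ D : Fin 4 → ℂ}
    (hc : CubeValues a s₀ s₁ t₀ t₁ u₀ u₁ A B₁ B₂ B₃ D) {m n₁ n₂ n₃ e : ℂ}
    (hrel : m • A + n₁ • B₁ + n₂ • B₂ + n₃ • B₃ + e • D = 0) (hne : e ≠ 0 ∨ n₁ ≠ 0) :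
    e * m = n₁ * n₂ + n₁ * n₃ + n₂ * n₃ := by
  by_contra hQ
  set Q := e * m - (n₁ * n₂ + n₁ * n₃ + n₂ * n₃) with hQdef
  have hQ0 : Q ≠ 0 := sub_ne_zero.mpr hQ
  -- the coordinates of the parameters, as polynomials
  let x : Fin 2 → CoordRing := fun j => X (0, j)
  let y : Fin 2 → CoordRing := fun j => X (1, j)
  let z : Fin 2 → CoordRing := fun j => X (2, j)
  let ym : CoordRing := x 1 * y 0 * z 0 + x 0 * y 1 * z 0 + x 0 * y 0 * z 1
  let y1 : CoordRing := x 0 * y 1 * z 1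
  let y2 : CoordRing := x 1 * y 0 * z 1
  let y3 : CoordRing := x 1 * y 1 * z 0
  let ye : CoordRing := x 1 * y 1 * z 1
  let b : CoordRing := C m * ye + C e * ym - C (n₂ + n₃) * y1 - C (n₁ + n₃) * y2 - C (n₁ + n₂) * y3
  let e' : CoordRing := C Q * ye - C e * b
  let L : CoordRing := C e * x 0 - C n₁ * x 1
  let F : Fin 4 → CoordRing := fun i => C (A i) * ym + C (B₁ i) * y1 + C (B₂ i) * y2 +
    C (B₃ i) * y3 + C (D i) * ye
  have hex : ∀ (p : Fin 3 × Fin 2 → ℂ) (j : Fin 2), eval p (x j) = p (0, j) := fun p j => by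
    simp [x]
  have hey : ∀ (p : Fin 3 × Fin 2 → ℂ) (j : Fin 2), eval p (y j) = p (1, j) := fun p j => by
    simp [y]
  have hez : ∀ (p : Fin 3 × Fin 2 → ℂ) (j : Fin 2), eval p (z j) = p (2, j) := fun p j => by
    simp [z]
  have hF : ∀ (p : Fin 3 × Fin 2 → ℂ), (fun i => eval p (F i)) =
      tri a (p (0, 0) • s₀ + p (0, 1) • s₁) (p (1, 0) • t₀ + p (1, 1) • t₁)
        (p (2, 0) • u₀ + p (2, 1) • u₁) := by
    intro p
    rw [hc.tri_eq (fun j => p (0, j)) (fun j => p (1, j)) (fun j => p (2, j))]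
    funext i
    simp only [F, ym, y1, y2, y3, ye, map_add, map_mul, eval_C, hex, hey, hez, Pi.add_apply,
      Pi.smul_apply, smul_eq_mul]
    ring
  have hFσ : ∀ (p : Fin 3 × Fin 2 → ℂ) (q : MvPolynomial (Fin 4) ℂ),
      eval p (aeval F q) = eval (fun i => eval p (F i)) q := by
    intro p q
    have : (eval p).comp (aeval F).toRingHom = eval fun i => eval p (F i) := by
      refine MvPolynomial.ringHom_ext (fun c => ?_) fun i => ?_ <;> simp
    exact congrArg (fun g => g q) this
  have hP : aeval F (σ 0) ≠ 0 := by
    obtain ⟨s, t, u, hstu⟩ := h.exists_eval_ne_zero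
    obtain ⟨x, rfl⟩ := CubeValues.exists_coords hc.det_s s
    obtain ⟨y, rfl⟩ := CubeValues.exists_coords hc.det_t t
    obtain ⟨z, rfl⟩ := CubeValues.exists_coords hc.det_u u
    intro h0
    have h1 := congrArg (eval (cubePoint x y z)) h0
    rw [hFσ, hF, map_zero] at h1
    exact hstu h1
  have hb : b ≠ 0 := by
    intro h0
    have hev : ∀ p q r, eval (cubePoint p q r) b = 0 := fun p q r => by rw [h0, map_zero]
    simp only [b, ym, y1, y2, y3, ye, map_add, map_sub, map_mul, eval_C, hex, hey, hez,
      cubePoint] at hev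
    have i1 := hev ![0, 1] ![1, 0] ![1, 0]
    have i2 := hev ![1, 0] ![0, 1] ![0, 1]
    have i3 := hev ![0, 1] ![1, 0] ![0, 1]
    have i4 := hev ![0, 1] ![0, 1] ![1, 0]
    simp at i1 i2 i3 i4
    have k1 : n₁ = 0 := by linear_combination (i2 - i3 - i4) / 2
    have k2 : n₂ = 0 := by linear_combination (i3 - i2 - i4) / 2
    apply hQ0
    rw [hQdef, i1, k1, k2]
    ring
  have he' : e' ≠ 0 := by
    intro h0
    have hev : ∀ p q r, eval (cubePoint p q r) e' = 0 := fun p q r => by rw [h0, map_zero]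
    simp only [e', b, ym, y1, y2, y3, ye, map_add, map_sub, map_mul, eval_C, hex, hey, hez,
      cubePoint] at hev
    have i1 := hev ![0, 1] ![1, 0] ![1, 0]
    have i2 := hev ![0, 1] ![0, 1] ![0, 1]
    simp at i1 i2
    rw [i1] at i2
    simp [hQ0] at i2
  have hL : L ≠ 0 := by
    intro h0
    have hev : ∀ p q r, eval (cubePoint p q r) L = 0 := fun p q r => by rw [h0, map_zero]
    simp only [L, map_sub, map_mul, eval_C, hex, cubePoint] at hev
    have i1 := hev ![0, 1] 0 0
    have i2 := hev ![1, 0] 0 0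
    simp at i1 i2
    rcases hne with hne | hne
    · exact hne i2
    · exact hne i1
  obtain ⟨p, hp1, hp2⟩ := exists_common_ne_zero hP (mul_ne_zero (mul_ne_zero hb he') hL)
  rw [map_mul, map_mul] at hp2
  have hpL := right_ne_zero_of_mul hp2
  have hpb := left_ne_zero_of_mul (left_ne_zero_of_mul hp2)
  have hpe := right_ne_zero_of_mul (left_ne_zero_of_mul hp2)
  rw [hFσ, hF] at hp1
  set v := tri a (p (0, 0) • s₀ + p (0, 1) • s₁) (p (1, 0) • t₀ + p (1, 1) • t₁)
        (p (2, 0) • u₀ + p (2, 1) • u₁) with hv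
  -- the parameters of the reflected point
  let r : ℂ := eval p e'
  let β : ℂ := eval p b
  let x' : Fin 2 → ℂ := ![Q * eval p y1 - β * n₁, r]
  let y' : Fin 2 → ℂ := ![Q * eval p y2 - β * n₂, r]
  let z' : Fin 2 → ℂ := ![Q * eval p y3 - β * n₃, r]
  have hv' : tri a (x' 0 • s₀ + x' 1 • s₁) (y' 0 • t₀ + y' 1 • t₁) (z' 0 • u₀ + z' 1 • u₁) =
      (r ^ 2 * Q) • v := by
    rw [hv, hc.tri_eq, hc.tri_eq (fun j => p (0, j)) (fun j => p (1, j)) (fun j => p (2, j))]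
    funext i
    have hi : m * A i + n₁ * B₁ i + n₂ * B₂ i + n₃ * B₃ i + e * D i = 0 := congrFun hrel i
    have hy : eval p ye * eval p ym =
        eval p y1 * eval p y2 + eval p y1 * eval p y3 + eval p y2 * eval p y3 := by
      simp only [ym, y1, y2, y3, ye, map_add, map_mul]
      ring
    have hβ : β = m * eval p ye + e * eval p ym - (n₂ + n₃) * eval p y1 -
        (n₁ + n₃) * eval p y2 - (n₁ + n₂) * eval p y3 := by
      simp only [β, b, map_add, map_sub, map_mul, eval_C]
    have hr : r = Q * eval p ye - e * β := by
      simp only [r, e', β, map_sub, map_mul, eval_C]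
    have hq := reflection_mem_quadric hy hQdef hβ
    rw [← hr] at hq
    simp only [x', y', z', Matrix.cons_val_zero, Matrix.cons_val_one, Pi.add_apply, Pi.smul_apply,
      smul_eq_mul]
    simp only [ym, y1, y2, y3, ye, map_add, map_mul, hex, hey, hez] at hq hr ⊢
    linear_combination (-(r ^ 2 * β)) * hi + r * A i * hq + r ^ 2 * D i * hr
  have h1 := h.left_s (x' 0 • s₀ + x' 1 • s₁) (y' 0 • t₀ + y' 1 • t₁) (z' 0 • u₀ + z' 1 • u₁)
  have h2 := h.left_s (p (0, 0) • s₀ + p (0, 1) • s₁) (p (1, 0) • t₀ + p (1, 1) • t₁)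
    (p (2, 0) • u₀ + p (2, 1) • u₁)
  rw [hv', PSpace.eval_smul (h.hom_s 0), PSpace.eval_smul (h.hom_s 1)] at h1
  rw [← hv] at h2
  have h3 : (r ^ 2 * Q) ^ 2 * eval v (σ 0) * (β * eval p L * det2 s₀ s₁) = 0 := by
    have hr : r = Q * eval p ye - e * β := by
      simp only [r, e', β, map_sub, map_mul, eval_C]
    have hL' : eval p L = e * p (0, 0) - n₁ * p (0, 1) := by
      simp only [L, map_sub, map_mul, eval_C, hex]
    have hx : p (0, 0) * r - p (0, 1) * (Q * eval p y1 - β * n₁) = -(β * eval p L) := by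
      rw [hL', hr]
      simp only [y1, ye, map_mul, hex, hey, hez]
      ring
    simp only [x', Matrix.cons_val_zero, Matrix.cons_val_one, Pi.add_apply, Pi.smul_apply,
      smul_eq_mul] at h1 h2
    simp only [det2]
    linear_combination ((r ^ 2 * Q) ^ 2 * eval v (σ 0) * (s₀ 0 * s₁ 1 - s₀ 1 * s₁ 0)) * hx -
      (p (0, 0) * s₀ 0 + p (0, 1) * s₁ 0) * h1 +
      (r ^ 2 * Q) ^ 2 * ((Q * eval p y1 - β * n₁) * s₀ 0 + r * s₁ 0) * h2
  exact mul_ne_zero (mul_ne_zero (pow_ne_zero _ (mul_ne_zero (pow_ne_zero _ hpe) hQ0)) hp1)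
    (mul_ne_zero (mul_ne_zero hpb hpL) hc.det_s) h3

/-! ### Normal forms -/

theorem det2_smul_add_self (k : ℂ) (x y : Fin 2 → ℂ) : det2 x (k • x + y) = det2 x y := by
  simp [det2]
  ring

/-- The trilinear map is, in suitable bases of the three planes and of `ℂ⁴`, the map
`A (s₁t₀u₀ + s₀t₁u₀ + s₀t₀u₁) + B₁ s₀t₁u₁ + B₂ s₁t₀u₁ + B₃ s₁t₁u₀`. -/
def IsNormal (a : TriCoeff) : Prop :=
  ∃ (s₀ s₁ t₀ t₁ u₀ u₁ : Fin 2 → ℂ) (A B₁ B₂ B₃ : Fin 4 → ℂ),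
    CubeValues a s₀ s₁ t₀ t₁ u₀ u₁ A B₁ B₂ B₃ 0 ∧ LinearIndependent ℂ ![B₁, B₂, B₃, A]

/-- The polynomial `det (M(s) + X M(s'))`, for the slices `M` of a trilinear map. -/
def detPencil (a : TriCoeff) (s s' : Fin 2 → ℂ) : Polynomial ℂ :=
  (Matrix.of fun i j => Polynomial.C (slice a s i j) +
    Polynomial.X * Polynomial.C (slice a s' i j)).det

theorem eval_detPencil (a : TriCoeff) (s s' : Fin 2 → ℂ) (x : ℂ) :
    (detPencil a s s').eval x = (slice a (s + x • s')).det := by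
  rw [detPencil, ← Polynomial.coe_evalRingHom, RingHom.map_det (Polynomial.evalRingHom x)]
  congr 1
  rw [slice_add, slice_smul]
  ext i j
  simp [mul_comm x]

/-- A covariant of the binary quartic `det M(s)` that vanishes identically on fourth powers of
linear forms: a multiple of its Hessian. -/
def hess (a : TriCoeff) (s s' : Fin 2 → ℂ) : ℂ :=
  8 * (detPencil a s s').coeff 0 * (detPencil a s s').coeff 2 - 3 * (detPencil a s s').coeff 1 ^ 2

namespace CubeValues

variable {a : TriCoeff} {s₀ s₁ t₀ t₁ u₀ u₁ : Fin 2 → ℂ} {A B₁ B₂ B₃ D : Fin 4 → ℂ}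

/-- A relation with `e ≠ 0` becomes trivial after a translation of the parameters. -/
theorem isNormal (h : CubeValues a s₀ s₁ t₀ t₁ u₀ u₁ A B₁ B₂ B₃ D) {m n₁ n₂ n₃ e : ℂ}
    (hrel : m • A + n₁ • B₁ + n₂ • B₂ + n₃ • B₃ + e • D = 0) (he : e ≠ 0)
    (hQ : e * m = n₁ * n₂ + n₁ * n₃ + n₂ * n₃)
    (hspan : ∀ W : Submodule ℂ (Fin 4 → ℂ), A ∈ W → B₁ ∈ W → B₂ ∈ W → B₃ ∈ W → D ∈ W → W = ⊤) :
    IsNormal a := by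
  set k₁ := n₁ / e with hk₁
  set k₂ := n₂ / e with hk₂
  set k₃ := n₃ / e with hk₃
  have hD : D + k₁ • B₁ + k₂ • B₂ + k₃ • B₃ + (k₁ * k₂ + k₁ * k₃ + k₂ * k₃) • A = 0 := by
    have h1 : k₁ * k₂ + k₁ * k₃ + k₂ * k₃ = e⁻¹ * m := by
      rw [hk₁, hk₂, hk₃]
      field_simp
      linear_combination -hQ
    have h2 : e⁻¹ • (m • A + n₁ • B₁ + n₂ • B₂ + n₃ • B₃ + e • D) = 0 := by rw [hrel, smul_zero]
    rw [← h2, h1, hk₁, hk₂, hk₃]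
    simp only [smul_add, smul_smul, inv_mul_cancel₀ he, one_smul, div_eq_inv_mul]
    abel
  have hx := h.tri_eq
  refine ⟨s₀, k₁ • s₀ + s₁, t₀, k₂ • t₀ + t₁, u₀, k₃ • u₀ + u₁, A, B₁ + (k₂ + k₃) • A,
    B₂ + (k₁ + k₃) • A, B₃ + (k₁ + k₂) • A, ?_, ?_⟩
  · refine ⟨?_, ?_, ?_, h.e000, ?_, ?_, ?_, ?_, ?_, ?_, ?_⟩
    · rw [det2_smul_add_self]; exact h.det_s
    · rw [det2_smul_add_self]; exact h.det_t
    · rw [det2_smul_add_self]; exact h.det_u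
    · simpa using hx ![k₁, 1] ![1, 0] ![1, 0]
    · simpa using hx ![1, 0] ![k₂, 1] ![1, 0]
    · simpa using hx ![1, 0] ![1, 0] ![k₃, 1]
    · have := hx ![1, 0] ![k₂, 1] ![k₃, 1]
      simp at this
      rw [this]; module
    · have := hx ![k₁, 1] ![1, 0] ![k₃, 1]
      simp at this
      rw [this]; module
    · have := hx ![k₁, 1] ![k₂, 1] ![1, 0]
      simp at this
      rw [this]; module
    · have := hx ![k₁, 1] ![k₂, 1] ![k₃, 1]
      simp at this
      rw [this, ← hD]; module
  · refine linearIndependent_of_top_le_span_of_card_eq_finrank (ge_of_eq (hspan _ ?_ ?_ ?_ ?_ ?_))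
      (by simp)
    all_goals
      set W := Submodule.span ℂ (Set.range ![B₁ + (k₂ + k₃) • A, B₂ + (k₁ + k₃) • A,
        B₃ + (k₁ + k₂) • A, A])
      have m1 : B₁ + (k₂ + k₃) • A ∈ W := Submodule.subset_span ⟨0, rfl⟩
      have m2 : B₂ + (k₁ + k₃) • A ∈ W := Submodule.subset_span ⟨1, rfl⟩
      have m3 : B₃ + (k₁ + k₂) • A ∈ W := Submodule.subset_span ⟨2, rfl⟩
      have m0 : A ∈ W := Submodule.subset_span ⟨3, rfl⟩
      replace m1 := (Submodule.add_mem_iff_left _ (W.smul_mem _ m0)).mp m1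
      replace m2 := (Submodule.add_mem_iff_left _ (W.smul_mem _ m0)).mp m2
      replace m3 := (Submodule.add_mem_iff_left _ (W.smul_mem _ m0)).mp m3
      first
        | assumption
        | skip
    have h4 : D = -(k₁ • B₁ + k₂ • B₂ + k₃ • B₃ + (k₁ * k₂ + k₁ * k₃ + k₂ * k₃) • A) := by
      rw [← sub_eq_zero, ← hD]; module
    rw [h4]
    exact W.neg_mem (W.add_mem (W.add_mem (W.add_mem (W.smul_mem _ m1) (W.smul_mem _ m2))
      (W.smul_mem _ m3)) (W.smul_mem _ m0))

theorem exists_relation (A B₁ B₂ B₃ D : Fin 4 → ℂ) : ∃ m n₁ n₂ n₃ e : ℂ,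
    m • A + n₁ • B₁ + n₂ • B₂ + n₃ • B₃ + e • D = 0 ∧
      ¬ (m = 0 ∧ n₁ = 0 ∧ n₂ = 0 ∧ n₃ = 0 ∧ e = 0) := by
  let M : Matrix (Fin 4) (Fin 5) ℂ := Matrix.of fun i => ![A i, B₁ i, B₂ i, B₃ i, D i]
  have hk := LinearMap.ker_ne_bot_of_finrank_lt (f := M.toLin') (by simp)
  obtain ⟨v, hv, hv0⟩ := (Submodule.ne_bot_iff _).mp hk
  refine ⟨v 0, v 1, v 2, v 3, v 4, ?_, ?_⟩
  · funext i
    have h1 := congrFun (show M *ᵥ v = 0 from hv) i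
    simp [M, Matrix.mulVec, dotProduct, Fin.sum_univ_succ] at h1
    simp
    linear_combination h1
  · rintro ⟨h0, h1, h2, h3, h4⟩
    apply hv0
    ext i
    fin_cases i <;> assumption

theorem det_eq_zero_of_relation {v₀ v₁ v₂ v₃ : Fin 4 → ℂ} {c₀ c₁ c₂ c₃ : ℂ}
    (h : c₀ • v₀ + c₁ • v₁ + c₂ • v₂ + c₃ • v₃ = 0)
    (hc : ¬ (c₀ = 0 ∧ c₁ = 0 ∧ c₂ = 0 ∧ c₃ = 0)) : (Matrix.of ![v₀, v₁, v₂, v₃]).det = 0 := by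
  refine Matrix.exists_vecMul_eq_zero_iff.mp ⟨![c₀, c₁, c₂, c₃], ?_, ?_⟩
  · intro h0
    exact hc ⟨congrFun h0 0, congrFun h0 1, congrFun h0 2, congrFun h0 3⟩
  · funext j
    have := congrFun h j
    simp at this
    simp [Matrix.vecMul, dotProduct, Fin.sum_univ_four]
    exact this

/-- The determinant of the slices is a multiple of the fourth power of a linear form, since the
coefficient of `x 0` in `det_slice` vanishes. -/
theorem hess_eq_zero (h : CubeValues a s₀ s₁ t₀ t₁ u₀ u₁ A B₁ B₂ B₃ D)
    (hdet : (Matrix.of ![A, B₂, B₃, B₁]).det = 0) (s s' : Fin 2 → ℂ) : hess a s s' = 0 := by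
  obtain ⟨x, rfl⟩ := exists_coords h.det_s s
  obtain ⟨y, rfl⟩ := exists_coords h.det_s s'
  set K := (Matrix.of ![A, B₂, B₃, D]).det
  set κ := (det2 t₀ t₁ * det2 u₀ u₁) ^ 2
  have hκ : κ ≠ 0 := pow_ne_zero 2 (mul_ne_zero h.det_t h.det_u)
  have hP : detPencil a (x 0 • s₀ + x 1 • s₁) (y 0 • s₀ + y 1 • s₁) =
      Polynomial.C (K / κ) * (Polynomial.C (x 1 ^ 4) +
        Polynomial.C (4 * x 1 ^ 3 * y 1) * Polynomial.X +
        Polynomial.C (6 * x 1 ^ 2 * y 1 ^ 2) * Polynomial.X ^ 2 +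
        Polynomial.C (4 * x 1 * y 1 ^ 3) * Polynomial.X ^ 3 +
        Polynomial.C (y 1 ^ 4) * Polynomial.X ^ 4) := by
    refine Polynomial.funext fun ε => ?_
    rw [eval_detPencil]
    have h1 := h.det_slice (x + ε • y)
    rw [hdet] at h1
    have h2 : x 0 • s₀ + x 1 • s₁ + ε • (y 0 • s₀ + y 1 • s₁) =
        (x + ε • y) 0 • s₀ + (x + ε • y) 1 • s₁ := by
      simp only [Pi.add_apply, Pi.smul_apply, smul_eq_mul]
      module
    rw [h2]
    simp only [Polynomial.eval_mul, Polynomial.eval_add, Polynomial.eval_C, Polynomial.eval_X,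
      Polynomial.eval_pow]
    rw [eq_div_of_mul_eq hκ h1]
    simp only [Pi.add_apply, Pi.smul_apply, smul_eq_mul]
    field_simp
    ring
  rw [hess, hP]
  simp only [Polynomial.coeff_C_mul, Polynomial.coeff_add,
    Polynomial.coeff_X_pow, Polynomial.coeff_X, Polynomial.coeff_C]
  norm_num
  ring

/-- The determinant of the slices is a nonzero multiple of `x₁³ x₀`. -/
theorem hess_ne_zero (h : CubeValues a s₀ s₁ t₀ t₁ u₀ u₁ A B₁ B₂ B₃ 0)
    (hli : LinearIndependent ℂ ![B₁, B₂, B₃, A]) : hess a (s₀ + s₁) s₁ ≠ 0 := by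
  set K := (Matrix.of ![A, B₂, B₃, B₁]).det with hK
  set κ := (det2 t₀ t₁ * det2 u₀ u₁) ^ 2
  have hκ : κ ≠ 0 := pow_ne_zero 2 (mul_ne_zero h.det_t h.det_u)
  have hK0 : K ≠ 0 := by
    have h1 : (Matrix.of ![B₁, B₂, B₃, A]).det ≠ 0 := by
      have := Matrix.linearIndependent_rows_iff_isUnit (A := Matrix.of ![B₁, B₂, B₃, A])
      exact ((Matrix.isUnit_iff_isUnit_det _).mp (this.mp hli)).ne_zero
    have h2 : K = -(Matrix.of ![B₁, B₂, B₃, A]).det := by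
      rw [hK]
      simp [Matrix.det_succ_row_zero, Fin.sum_univ_succ, Fin.succAbove]
      ring
    rw [h2]
    exact neg_ne_zero.mpr h1
  have hP : detPencil a (s₀ + s₁) s₁ =
      Polynomial.C (K / κ) * (Polynomial.C 1 + Polynomial.C 3 * Polynomial.X +
        Polynomial.C 3 * Polynomial.X ^ 2 + Polynomial.C 1 * Polynomial.X ^ 3) := by
    refine Polynomial.funext fun ε => ?_
    rw [eval_detPencil]
    have h1 := h.det_slice ![1, 1 + ε]
    have h2 : (Matrix.of ![A, B₂, B₃, 0]).det = 0 := Matrix.det_eq_zero_of_row_eq_zero 3 (by simp)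
    rw [h2] at h1
    have h3 : s₀ + s₁ + ε • s₁ = (![1, 1 + ε] : Fin 2 → ℂ) 0 • s₀ +
        (![1, 1 + ε] : Fin 2 → ℂ) 1 • s₁ := by
      simp only [Matrix.cons_val_zero, Matrix.cons_val_one]
      module
    rw [h3]
    simp only [Polynomial.eval_mul, Polynomial.eval_add, Polynomial.eval_C, Polynomial.eval_X,
      Polynomial.eval_pow]
    rw [eq_div_of_mul_eq hκ h1]
    simp only [Matrix.cons_val_zero, Matrix.cons_val_one]
    field_simp
    ring
  rw [hess, hP]
  simp only [Polynomial.coeff_C_mul, Polynomial.coeff_add,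
    Polynomial.coeff_X_pow, Polynomial.coeff_X, Polynomial.coeff_C]
  norm_num
  ring_nf
  simp [hK0, hκ]

end CubeValues

theorem IsNormal.exists_hess_ne_zero {a : TriCoeff} (h : IsNormal a) :
    ∃ s s', hess a s s' ≠ 0 := by
  obtain ⟨s₀, s₁, t₀, t₁, u₀, u₁, A, B₁, B₂, B₃, h, hli⟩ := h
  exact ⟨_, _, h.hess_ne_zero hli⟩

/-- A trilinear map with a quadratic inverse has a normal form, or is a degenerate map for which
the opposite vertex of the cube does not take part in the relation. -/
theorem QuadraticInverse.isNormal_or {a : TriCoeff} {σ τ υ : Fin 2 → MvPolynomial (Fin 4) ℂ}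
    (h : QuadraticInverse a σ τ υ) : IsNormal a ∨ (∀ s s', hess a s s' = 0) ∧
      ∃ (s₀ s₁ t₀ t₁ u₀ u₁ : Fin 2 → ℂ) (A B₁ B₂ B₃ D : Fin 4 → ℂ) (m n₁ n₂ n₃ : ℂ),
        CubeValues a s₀ s₁ t₀ t₁ u₀ u₁ A B₁ B₂ B₃ D ∧ n₁ ≠ 0 ∧ n₂ ≠ 0 ∧ n₃ ≠ 0 ∧
        m • A + n₁ • B₁ + n₂ • B₂ + n₃ • B₃ = 0 ∧ n₁ * n₂ + n₁ * n₃ + n₂ * n₃ = 0 ∧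
        ∀ W : Submodule ℂ (Fin 4 → ℂ), A ∈ W → B₁ ∈ W → B₂ ∈ W → B₃ ∈ W → D ∈ W → W = ⊤ := by
  obtain ⟨s₀, s₁, t₀, t₁, u₀, u₁, hs, ht, hu, e0, e1, e2⟩ := h.exists_bases
  have hc : CubeValues a s₀ s₁ t₀ t₁ u₀ u₁ (tri a s₁ t₀ u₀) (tri a s₀ t₁ u₁) (tri a s₁ t₀ u₁)
      (tri a s₁ t₁ u₀) (tri a s₁ t₁ u₁) := ⟨hs, ht, hu, e0, rfl, e1, e2, rfl, rfl, rfl, rfl⟩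
  generalize tri a s₁ t₀ u₀ = A, tri a s₀ t₁ u₁ = B₁, tri a s₁ t₀ u₁ = B₂,
    tri a s₁ t₁ u₀ = B₃, tri a s₁ t₁ u₁ = D at hc
  obtain ⟨s, hds⟩ := h.exists_det_slice_ne_zero
  obtain ⟨t, hdt⟩ := h.swapST.exists_det_slice_ne_zero
  obtain ⟨u, hdu⟩ := h.rotU.exists_det_slice_ne_zero
  obtain ⟨m, n₁, n₂, n₃, e, hrel, hne⟩ := CubeValues.exists_relation A B₁ B₂ B₃ D
  have hspan := fun (W : Submodule ℂ (Fin 4 → ℂ)) (hA : A ∈ W) (h1 : B₁ ∈ W) (h2 : B₂ ∈ W)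
    (h3 : B₃ ∈ W) (hD : D ∈ W) => hc.span_eq_top hds hA h1 h2 h3 hD
  have hQ : e * m = n₁ * n₂ + n₁ * n₃ + n₂ * n₃ := by
    by_cases h1 : e ≠ 0 ∨ n₁ ≠ 0
    · exact hc.quadric_of_ne_zero h hrel h1
    by_cases h2 : n₂ ≠ 0
    · have := hc.swapST.quadric_of_ne_zero h.swapST (m := m) (n₁ := n₂) (n₂ := n₁) (n₃ := n₃)
        (e := e) (by rw [← hrel]; module) (Or.inr h2)
      rw [this]; ring
    · push Not at h1 h2
      rw [h1.1, h1.2, h2]; ring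
  by_cases he : e = 0
  · right
    subst he
    rw [zero_smul, add_zero] at hrel
    have key : ∀ {a' : TriCoeff} {p₀ p₁ q₀ q₁ r₀ r₁ : Fin 2 → ℂ} {C₁ C₂ C₃ : Fin 4 → ℂ} {k₁ k₂ k₃ : ℂ}
        {p : Fin 2 → ℂ}, CubeValues a' p₀ p₁ q₀ q₁ r₀ r₁ A C₁ C₂ C₃ D → (slice a' p).det ≠ 0 →
        m • A + k₁ • C₁ + k₂ • C₂ + k₃ • C₃ = 0 →
        ¬ (m = 0 ∧ k₁ = 0 ∧ k₂ = 0 ∧ k₃ = 0) →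
        (Matrix.of ![A, C₂, C₃, C₁]).det = 0 ∧ k₁ ≠ 0 := by
      intro a' p₀ p₁ q₀ q₁ r₀ r₁ C₁ C₂ C₃ k₁ k₂ k₃ p hc' hd hr hn
      have h1 : (Matrix.of ![A, C₂, C₃, C₁]).det = 0 :=
        CubeValues.det_eq_zero_of_relation (c₀ := m) (c₁ := k₂) (c₂ := k₃) (c₃ := k₁)
          (by rw [← hr]; module) (by tauto)
      refine ⟨h1, fun hk => ?_⟩
      obtain ⟨x, rfl⟩ := CubeValues.exists_coords hc'.det_s p
      have h2 := hc'.det_slice x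
      have h3 : (Matrix.of ![A, C₂, C₃, D]).det = 0 :=
        CubeValues.det_eq_zero_of_relation (c₀ := m) (c₁ := k₂) (c₂ := k₃) (c₃ := 0)
          (by rw [← hr, hk]; module) (by tauto)
      rw [h1, h3, mul_zero, mul_zero, add_zero, mul_zero] at h2
      exact mul_ne_zero hd (pow_ne_zero 2 (mul_ne_zero hc'.det_t hc'.det_u)) h2
    obtain ⟨d1, hn1⟩ := key hc hds hrel (by tauto)
    obtain ⟨-, hn2⟩ := key hc.swapST hdt (k₁ := n₂) (k₂ := n₁) (k₃ := n₃)
      (by rw [← hrel]; module) (by tauto)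
    obtain ⟨-, hn3⟩ := key hc.rotU hdu (k₁ := n₃) (k₂ := n₁) (k₃ := n₂)
      (by rw [← hrel]; module) (by tauto)
    refine ⟨hc.hess_eq_zero d1, s₀, s₁, t₀, t₁, u₀, u₁, A, B₁, B₂, B₃, D, m, n₁, n₂, n₃, hc,
      hn1, hn2, hn3, hrel, ?_, hspan⟩
    rw [← hQ, zero_mul]
  · exact Or.inl (hc.isNormal hrel he hQ hspan)

/-! ### Linear forms and common factors -/

theorem prime_of_isHomogeneous_one {κ : Type} {p : MvPolynomial κ ℂ} (hp : p.IsHomogeneous 1)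
    (h0 : p ≠ 0) : Prime p := by
  refine UniqueFactorizationMonoid.irreducible_iff_prime.mp
    (irreducible_of_totalDegree_eq_one (hp.totalDegree h0) fun c hc => ?_)
  obtain ⟨m, hm⟩ := MvPolynomial.ne_zero_iff.mp h0
  rw [isUnit_iff_ne_zero]
  rintro rfl
  exact hm (zero_dvd_iff.mp (hc m))

theorem isHomogeneous_linear {κ : Type} [Fintype κ] (c : κ → ℂ) :
    (∑ i, C (c i) * X i : MvPolynomial κ ℂ).IsHomogeneous 1 := by
  refine IsHomogeneous.sum _ _ _ fun i _ => ?_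
  simpa using (isHomogeneous_C κ (c i)).mul (isHomogeneous_X ℂ i)

theorem not_dvd_of_eval {κ : Type} {p q : MvPolynomial κ ℂ} {y : κ → ℂ} (hp : eval y p = 0)
    (hq : eval y q ≠ 0) : ¬ p ∣ q := by
  rintro ⟨r, rfl⟩
  rw [map_mul, hp, zero_mul] at hq
  exact hq rfl

theorem isRelPrime_of_prime {κ : Type} {p q : MvPolynomial κ ℂ} (hp : Prime p) (h : ¬ p ∣ q) :
    IsRelPrime p q := hp.irreducible.isRelPrime_iff_not_dvd.mpr h

/-- A pair of forms without common factor remains so after a change of basis. -/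
theorem noCommonFactor_of_isRelPrime {s₀ s₁ : Fin 2 → ℂ} (hs : det2 s₀ s₁ ≠ 0)
    {p q : MvPolynomial (Fin 4) ℂ} (h : IsRelPrime p q) :
    NoCommonFactor fun j => C (s₀ j) * p + C (s₁ j) * q := by
  intro d hd
  have h0 := hd 0
  have h1 := hd 1
  have hu : IsUnit (C (det2 s₀ s₁) : MvPolynomial (Fin 4) ℂ) := (isUnit_iff_ne_zero.mpr hs).map C
  refine h ?_ ?_
  · rw [← hu.dvd_mul_left]
    have : C (det2 s₀ s₁) * p =
        C (s₁ 1) * (C (s₀ 0) * p + C (s₁ 0) * q) - C (s₁ 0) * (C (s₀ 1) * p + C (s₁ 1) * q) := by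
      simp only [det2, C_sub, C_mul]
      ring
    rw [this]
    exact dvd_sub (h0.mul_left _) (h1.mul_left _)
  · rw [← hu.dvd_mul_left]
    have : C (det2 s₀ s₁) * q =
        C (s₀ 0) * (C (s₀ 1) * p + C (s₁ 1) * q) - C (s₀ 1) * (C (s₀ 0) * p + C (s₁ 0) * q) := by
      simp only [det2, C_sub, C_mul]
      ring
    rw [this]
    exact dvd_sub (h1.mul_left _) (h0.mul_left _)

/-- A pointwise left inverse is a left inverse as a rational map. -/
theorem samePoint_of_left {φ : TrilinearTuple} {σ : Fin 2 → MvPolynomial (Fin 4) ℂ} (m : Fin 3)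
    (h : ∀ p : Fin 3 → Fin 2 → ℂ, ∃ k, ∀ j,
      eval (tri (coeffs φ.rep) (p 0) (p 1) (p 2)) (σ j) = k * p m j)
    (hne : ∃ (p : Fin 3 → Fin 2 → ℂ) (j : Fin 2),
      eval (tri (coeffs φ.rep) (p 0) (p 1) (p 2)) (σ j) ≠ 0) :
    SamePoint (fun i => aeval (form φ) (σ i)) (fun i => (X (m, i) : CoordRing)) := by
  constructor
  · obtain ⟨p, j, hj⟩ := hne
    refine ⟨j, fun h0 => hj ?_⟩
    have := congrArg (eval fun q => p q.1 q.2) h0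
    rw [eval_aeval_form, map_zero] at this
    exact this
  · intro i j
    refine MvPolynomial.funext fun y => ?_
    obtain ⟨k, hk⟩ := h fun a b => y (a, b)
    rw [map_mul, map_mul, eval_aeval_form, eval_aeval_form, eval_X, eval_X, hk, hk]
    ring

/-- The dual coordinates of a basis of the plane. -/
def dualCoord (s₀ s₁ s : Fin 2 → ℂ) : Fin 2 → ℂ := ![det2 s s₁ / det2 s₀ s₁, det2 s₀ s / det2 s₀ s₁]

theorem eq_dualCoord {s₀ s₁ : Fin 2 → ℂ} (h : det2 s₀ s₁ ≠ 0) (s : Fin 2 → ℂ) :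
    s = dualCoord s₀ s₁ s 0 • s₀ + dualCoord s₀ s₁ s 1 • s₁ := by
  ext i
  simp only [dualCoord, Matrix.cons_val_zero, Matrix.cons_val_one, Pi.add_apply, Pi.smul_apply,
    smul_eq_mul]
  field_simp
  fin_cases i <;> simp [det2] <;> ring

theorem dualCoord_combination {s₀ s₁ : Fin 2 → ℂ} (h : det2 s₀ s₁ ≠ 0) (x : Fin 2 → ℂ) :
    dualCoord s₀ s₁ (x 0 • s₀ + x 1 • s₁) = x := by
  have h1 : det2 (x 0 • s₀ + x 1 • s₁) s₁ = x 0 * det2 s₀ s₁ := by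
    simp [det2]
    ring
  have h2 : det2 s₀ (x 0 • s₀ + x 1 • s₁) = x 1 * det2 s₀ s₁ := by
    simp [det2]
    ring
  rw [dualCoord, h1, h2]
  ext i
  fin_cases i <;> simp [h]

/-- The dual coordinates of a basis of the `m`-th plane, as linear forms on `(ℂ²)³`. -/
def dualForm (m : Fin 3) (s₀ s₁ : Fin 2 → ℂ) : Fin 2 → CoordRing :=
  ![C (s₁ 1 / det2 s₀ s₁) * X (m, 0) - C (s₁ 0 / det2 s₀ s₁) * X (m, 1),
    C (s₀ 0 / det2 s₀ s₁) * X (m, 1) - C (s₀ 1 / det2 s₀ s₁) * X (m, 0)]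

theorem eval_dualForm (m : Fin 3) (s₀ s₁ : Fin 2 → ℂ) (j : Fin 2) (y : Fin 3 × Fin 2 → ℂ) :
    eval y (dualForm m s₀ s₁ j) = dualCoord s₀ s₁ (fun i => y (m, i)) j := by
  fin_cases j <;> simp [dualForm, dualCoord, det2] <;> ring

theorem prime_dualForm (m : Fin 3) {s₀ s₁ : Fin 2 → ℂ} (h : det2 s₀ s₁ ≠ 0) (j : Fin 2) :
    Prime (dualForm m s₀ s₁ j) := by
  refine prime_of_isHomogeneous_one ?_ fun h0 => ?_
  · have e : ∀ (c : ℂ) (i : Fin 2), (C c * X (m, i) : CoordRing).IsHomogeneous 1 := fun c i => by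
      simpa using (isHomogeneous_C (Fin 3 × Fin 2) c).mul (isHomogeneous_X ℂ (m, i))
    fin_cases j
    · exact (e _ _).sub (e _ _)
    · exact (e _ _).sub (e _ _)
  · have h1 := congrArg (eval fun q => (s₀ + s₁) q.2) h0
    rw [eval_dualForm, map_zero] at h1
    have h2 := dualCoord_combination h ![1, 1]
    simp only [Matrix.cons_val_zero, Matrix.cons_val_one, one_smul] at h2
    rw [show (fun i => (s₀ + s₁) ((m, i) : Fin 3 × Fin 2).2) = s₀ + s₁ from rfl, h2] at h1
    fin_cases j <;> simp at h1

/-! ### Maps in normal form are birational -/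

theorem exists_coordinates {v : Fin 4 → Fin 4 → ℂ} (h : LinearIndependent ℂ v) :
    ∃ c : Matrix (Fin 4) (Fin 4) ℂ, (∀ y, y = ∑ i, (c *ᵥ y) i • v i) ∧
      ∀ z : Fin 4 → ℂ, c *ᵥ (∑ i, z i • v i) = z := by
  have hu : IsUnit (Matrix.of v) := Matrix.linearIndependent_rows_iff_isUnit.mp h
  have hd := (Matrix.isUnit_iff_isUnit_det _).mp hu
  have hsum : ∀ z : Fin 4 → ℂ, ∑ i, z i • v i = (Matrix.of v)ᵀ *ᵥ z := by
    intro z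
    funext j
    simp [Matrix.mulVec, dotProduct, Finset.sum_apply, mul_comm]
  have hd' : IsUnit (Matrix.of v)ᵀ.det := by rwa [Matrix.det_transpose]
  refine ⟨((Matrix.of v)ᵀ)⁻¹, fun y => ?_, fun z => ?_⟩
  · rw [hsum, Matrix.mulVec_mulVec, Matrix.mul_nonsing_inv _ hd', Matrix.one_mulVec]
  · rw [hsum, Matrix.mulVec_mulVec, Matrix.nonsing_inv_mul _ hd', Matrix.one_mulVec]

/-- The linear form with given coefficients. -/
def linForm (c : Fin 4 → ℂ) : MvPolynomial (Fin 4) ℂ := ∑ i, C (c i) * X i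

theorem eval_linForm (c y : Fin 4 → ℂ) : eval y (linForm c) = c ⬝ᵥ y := by
  simp [linForm, dotProduct]

namespace CubeValues

variable {φ : TrilinearTuple} {s₀ s₁ t₀ t₁ u₀ u₁ : Fin 2 → ℂ} {A B₁ B₂ B₃ : Fin 4 → ℂ}

/-- A common factor divides the four coordinates of the normal form. Three of these are monomials in
the coordinates of the three planes, and evaluations exclude each of their prime factors. -/
theorem noCommonFactor (h : CubeValues (coeffs φ.rep) s₀ s₁ t₀ t₁ u₀ u₁ A B₁ B₂ B₃ 0)
    (hli : LinearIndependent ℂ ![B₁, B₂, B₃, A]) : NoCommonFactor (form φ) := by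
  obtain ⟨c, -, hc⟩ := exists_coordinates hli
  set x := dualForm 0 s₀ s₁
  set y := dualForm 1 t₀ t₁
  set z := dualForm 2 u₀ u₁
  let e : Fin 4 → CoordRing := ![x 0 * y 1 * z 1, x 1 * y 0 * z 1, x 1 * y 1 * z 0,
    x 1 * y 0 * z 0 + x 0 * y 1 * z 0 + x 0 * y 0 * z 1]
  have he : ∀ i, e i = ∑ j, C (c i j) * form φ j := by
    intro i
    refine MvPolynomial.funext fun p => ?_
    have h1 : (fun j => eval p (form φ j)) = ∑ i, (fun i => eval p (e i)) i • ![B₁, B₂, B₃, A] i := by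
      have h2 : (fun j => eval p (form φ j)) = tri (coeffs φ.rep) (fun j => p (0, j))
          (fun j => p (1, j)) fun j => p (2, j) := by
        funext j
        have := eval_value φ (fun j => (X (0, j) : CoordRing)) (fun j => X (1, j))
          (fun j => X (2, j)) p j
        simpa [form] using this
      rw [h2, eq_dualCoord h.det_s fun j => p (0, j), eq_dualCoord h.det_t fun j => p (1, j),
        eq_dualCoord h.det_u fun j => p (2, j), h.tri_eq]
      simp only [Fin.sum_univ_four, Matrix.cons_val, e, x, y, z, map_add, map_mul, eval_dualForm]
      module
    have h3 := congrFun (hc fun i => eval p (e i)) i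
    rw [← h1] at h3
    rw [← h3, map_sum]
    simp [Matrix.mulVec, dotProduct]
  intro d hd
  have hde : ∀ i, d ∣ e i := fun i => by
    rw [he]
    exact Finset.dvd_sum fun j _ => (hd j).mul_left _
  have hx : ∀ j, Prime (x j) := prime_dualForm 0 h.det_s
  have hy : ∀ j, Prime (y j) := prime_dualForm 1 h.det_t
  have hz : ∀ j, Prime (z j) := prime_dualForm 2 h.det_u
  have hev : ∀ (x' y' z' : Fin 2 → ℂ), ∃ p, ∀ j, eval p (x j) = x' j ∧ eval p (y j) = y' j ∧
      eval p (z j) = z' j := by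
    intro x' y' z'
    refine ⟨cubePoint (x' 0 • s₀ + x' 1 • s₁) (y' 0 • t₀ + y' 1 • t₁) (z' 0 • u₀ + z' 1 • u₁),
      fun j => ⟨?_, ?_, ?_⟩⟩
    · rw [eval_dualForm]
      exact congrFun (dualCoord_combination h.det_s x') j
    · rw [eval_dualForm]
      exact congrFun (dualCoord_combination h.det_t y') j
    · rw [eval_dualForm]
      exact congrFun (dualCoord_combination h.det_u z') j
  have hd0 : d ≠ 0 := by
    rintro rfl
    have := zero_dvd_iff.mp (hde 0)
    exact mul_ne_zero (mul_ne_zero (hx 0).ne_zero (hy 1).ne_zero) (hz 1).ne_zero this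
  by_contra hu
  obtain ⟨q, hq, hqd⟩ := WfDvdMonoid.exists_irreducible_factor hu hd0
  have hqp := hq.prime
  have hq0 : q ∣ x 0 * y 1 * z 1 := hqd.trans (hde 0)
  have hq1 : q ∣ x 1 * y 0 * z 1 := hqd.trans (hde 1)
  have hq2 : q ∣ x 1 * y 1 * z 0 := hqd.trans (hde 2)
  rcases hqp.dvd_or_dvd hq0 with hq3 | hq3
  · rcases hqp.dvd_or_dvd hq3 with hq4 | hq4
    · have h5 := (hq.dvd_symm (hx 0).irreducible hq4).trans hq1
      obtain ⟨p, hp⟩ := hev ![0, 1] ![1, 1] ![1, 1]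
      exact not_dvd_of_eval (y := p) (by simp [hp]) (by simp [hp]) h5
    · have h5 := (hq.dvd_symm (hy 1).irreducible hq4).trans hq1
      obtain ⟨p, hp⟩ := hev ![1, 1] ![1, 0] ![1, 1]
      exact not_dvd_of_eval (y := p) (by simp [hp]) (by simp [hp]) h5
  · have h5 := (hq.dvd_symm (hz 1).irreducible hq3).trans hq2
    obtain ⟨p, hp⟩ := hev ![1, 1] ![1, 1] ![1, 0]
    exact not_dvd_of_eval (y := p) (by simp [hp]) (by simp [hp]) h5

/-- The inverse of the normal form, in the coordinates `ℓ₀, ℓ₁, ℓ₂, ℓ₃` for `B₁, B₂, B₃, A`, is `(ℓ₃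
ℓ₀ : q) × (ℓ₃ ℓ₁ : q) × (ℓ₃ ℓ₂ : q)` with `q = ℓ₀ ℓ₁ + ℓ₁ ℓ₂ + ℓ₂ ℓ₀`. -/
theorem mem_bir (h : CubeValues (coeffs φ.rep) s₀ s₁ t₀ t₁ u₀ u₁ A B₁ B₂ B₃ 0)
    (hli : LinearIndependent ℂ ![B₁, B₂, B₃, A]) : φ ∈ Bir 2 2 2 := by
  obtain ⟨c, hc', hc⟩ := exists_coordinates hli
  let ℓ : Fin 4 → MvPolynomial (Fin 4) ℂ := fun i => linForm (c i)
  let q : MvPolynomial (Fin 4) ℂ := ℓ 0 * ℓ 1 + ℓ 1 * ℓ 2 + ℓ 2 * ℓ 0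
  have hℓ : ∀ (v : Fin 4 → ℂ) i, eval v (ℓ i) = (c *ᵥ v) i := fun v i => by
    simp only [ℓ, eval_linForm]
    rfl
  have hℓz : ∀ z : Fin 4 → ℂ, ∃ v, ∀ i, eval v (ℓ i) = z i := fun z =>
    ⟨_, fun i => (hℓ _ i).trans (congrFun (hc z) i)⟩
  have hprime : ∀ i, Prime (ℓ i) := fun i => by
    refine prime_of_isHomogeneous_one (isHomogeneous_linear _) fun h0 => ?_
    obtain ⟨v, hv⟩ := hℓz 1
    have := hv i
    rw [h0] at this
    simp at this
  have hrel : ∀ i : Fin 3, IsRelPrime (ℓ 3 * ℓ i.castSucc) q := by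
    intro i
    refine (isRelPrime_of_prime (hprime 3) ?_).mul_left (isRelPrime_of_prime (hprime _) ?_)
    · obtain ⟨v, hv⟩ := hℓz ![1, 1, 1, 0]
      exact not_dvd_of_eval (y := v) (by simp [hv]) (by simp [hv, q]; norm_num)
    · fin_cases i
      · obtain ⟨v, hv⟩ := hℓz ![0, 1, 1, 0]
        exact not_dvd_of_eval (y := v) (by simp [hv]) (by simp [hv, q])
      · obtain ⟨v, hv⟩ := hℓz ![1, 0, 1, 0]
        exact not_dvd_of_eval (y := v) (by simp [hv]) (by simp [hv, q])
      · obtain ⟨v, hv⟩ := hℓz ![1, 1, 0, 0]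
        exact not_dvd_of_eval (y := v) (by simp [hv]) (by simp [hv, q])
  let σ : Fin 2 → MvPolynomial (Fin 4) ℂ := fun j => C (s₀ j) * (ℓ 3 * ℓ 0) + C (s₁ j) * q
  let τ : Fin 2 → MvPolynomial (Fin 4) ℂ := fun j => C (t₀ j) * (ℓ 3 * ℓ 1) + C (t₁ j) * q
  let υ : Fin 2 → MvPolynomial (Fin 4) ℂ := fun j => C (u₀ j) * (ℓ 3 * ℓ 2) + C (u₁ j) * q
  have h1 : ∀ i, (ℓ i).IsHomogeneous 1 := fun i => isHomogeneous_linear _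
  have h2 : ∀ i j, (ℓ i * ℓ j).IsHomogeneous 2 := fun i j => (h1 i).mul (h1 j)
  have hq : q.IsHomogeneous 2 := ((h2 0 1).add (h2 1 2)).add (h2 2 0)
  have hhom : ∀ (a b : ℂ) i, (C a * (ℓ 3 * ℓ i) + C b * q).IsHomogeneous 2 := fun a b i => by
    refine IsHomogeneous.add ?_ ?_
    · simpa using (isHomogeneous_C (Fin 4) a).mul (h2 3 i)
    · simpa using (isHomogeneous_C (Fin 4) b).mul hq
  -- the coordinates of the values of the map
  have hval : ∀ x y z : Fin 2 → ℂ, ∀ i, eval (tri (coeffs φ.rep) (x 0 • s₀ + x 1 • s₁)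
      (y 0 • t₀ + y 1 • t₁) (z 0 • u₀ + z 1 • u₁)) (ℓ i) =
      ![x 0 * y 1 * z 1, x 1 * y 0 * z 1, x 1 * y 1 * z 0,
        x 1 * y 0 * z 0 + x 0 * y 1 * z 0 + x 0 * y 0 * z 1] i := by
    intro x y z i
    rw [hℓ, ← congrFun (hc ![x 0 * y 1 * z 1, x 1 * y 0 * z 1, x 1 * y 1 * z 0,
        x 1 * y 0 * z 0 + x 0 * y 1 * z 0 + x 0 * y 0 * z 1]) i, h.tri_eq]
    refine congrArg (fun w => (c *ᵥ w) i) ?_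
    simp only [Fin.sum_univ_four, Matrix.cons_val]
    module
  have hleft : ∀ s t u : Fin 2 → ℂ, ∃ ks kt ku : ℂ, ∀ j,
      eval (tri (coeffs φ.rep) s t u) (σ j) = ks * s j ∧
      eval (tri (coeffs φ.rep) s t u) (τ j) = kt * t j ∧
      eval (tri (coeffs φ.rep) s t u) (υ j) = ku * u j := by
    intro s t u
    obtain ⟨x, rfl⟩ := exists_coords h.det_s s
    obtain ⟨y, rfl⟩ := exists_coords h.det_t t
    obtain ⟨z, rfl⟩ := exists_coords h.det_u u
    set w := x 1 * y 0 * z 0 + x 0 * y 1 * z 0 + x 0 * y 0 * z 1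
    refine ⟨y 1 * z 1 * w, x 1 * z 1 * w, x 1 * y 1 * w, fun j => ⟨?_, ?_, ?_⟩⟩ <;>
      simp only [σ, τ, υ, q, map_add, map_mul, eval_C, hval, Matrix.cons_val, Pi.add_apply,
        Pi.smul_apply, smul_eq_mul] <;> simp only [w] <;> ring
  have hne : ∀ {p₀ p₁ : Fin 2 → ℂ}, det2 p₀ p₁ ≠ 0 → ∃ j, p₀ j + p₁ j ≠ 0 := by
    intro p₀ p₁ hp
    by_contra! h0
    apply hp
    simp only [det2]
    linear_combination p₀ 0 * h0 1 - p₀ 1 * h0 0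
  have hone : ∀ i, eval (tri (coeffs φ.rep) (s₀ + s₁) (t₀ + t₁) (u₀ + u₁)) (ℓ i) =
      ![1, 1, 1, 3] i := by
    intro i
    have := hval ![1, 1] ![1, 1] ![1, 1] i
    simp only [Matrix.cons_val_zero, Matrix.cons_val_one, one_smul] at this
    rw [this]
    norm_num
  refine ⟨h.noCommonFactor hli, σ, τ, υ, fun i => hhom _ _ 0, fun i => hhom _ _ 1,
    fun i => hhom _ _ 2, noCommonFactor_of_isRelPrime h.det_s (hrel 0),
    noCommonFactor_of_isRelPrime h.det_t (hrel 1), noCommonFactor_of_isRelPrime h.det_u (hrel 2),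
    ?_, ?_, ?_, ?_⟩
  · refine samePoint_of_left 0 (fun p => ?_) ?_
    · obtain ⟨k, _, _, hk⟩ := hleft (p 0) (p 1) (p 2)
      exact ⟨k, fun j => (hk j).1⟩
    · obtain ⟨j, hj⟩ := hne h.det_s
      refine ⟨![s₀ + s₁, t₀ + t₁, u₀ + u₁], j, ?_⟩
      simp only [Matrix.cons_val, σ, q, map_add, map_mul, eval_C, hone]
      intro h0
      apply hj
      linear_combination h0 / 3
  · refine samePoint_of_left 1 (fun p => ?_) ?_
    · obtain ⟨_, k, _, hk⟩ := hleft (p 0) (p 1) (p 2)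
      exact ⟨k, fun j => (hk j).2.1⟩
    · obtain ⟨j, hj⟩ := hne h.det_t
      refine ⟨![s₀ + s₁, t₀ + t₁, u₀ + u₁], j, ?_⟩
      simp only [Matrix.cons_val, τ, q, map_add, map_mul, eval_C, hone]
      intro h0
      apply hj
      linear_combination h0 / 3
  · refine samePoint_of_left 2 (fun p => ?_) ?_
    · obtain ⟨_, _, k, hk⟩ := hleft (p 0) (p 1) (p 2)
      exact ⟨k, fun j => (hk j).2.2⟩
    · obtain ⟨j, hj⟩ := hne h.det_u
      refine ⟨![s₀ + s₁, t₀ + t₁, u₀ + u₁], j, ?_⟩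
      simp only [Matrix.cons_val, υ, q, map_add, map_mul, eval_C, hone]
      intro h0
      apply hj
      linear_combination h0 / 3
  · have hr : ∀ (v : Fin 4 → ℂ) i, eval v (value φ σ τ υ i) =
        eval v (ℓ 3) * eval v q ^ 2 * v i := by
      intro v i
      have e1 : ∀ (p₀ p₁ : Fin 2 → ℂ) (k : Fin 4), (fun j => eval v (C (p₀ j) * (ℓ 3 * ℓ k) +
          C (p₁ j) * q)) = (![eval v (ℓ 3) * eval v (ℓ k), eval v q] : Fin 2 → ℂ) 0 • p₀ +
          (![eval v (ℓ 3) * eval v (ℓ k), eval v q] : Fin 2 → ℂ) 1 • p₁ := by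
        intro p₀ p₁ k
        funext j
        simp
        ring
      rw [eval_value, e1, e1, e1, h.tri_eq]
      have e2 := congrFun (hc' v) i
      simp only [Fin.sum_univ_four, Matrix.cons_val, ← hℓ, Pi.add_apply, Pi.smul_apply,
        smul_eq_mul] at e2
      simp only [Matrix.cons_val_zero, Matrix.cons_val_one, Pi.add_apply, Pi.smul_apply,
        smul_eq_mul, Pi.zero_apply]
      rw [e2]
      have e3 : eval v q = eval v (ℓ 0) * eval v (ℓ 1) + eval v (ℓ 1) * eval v (ℓ 2) +
          eval v (ℓ 2) * eval v (ℓ 0) := by simp only [q, map_add, map_mul]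
      linear_combination (-(eval v (ℓ 3)) ^ 2 * eval v q * A i) * e3
    constructor
    · obtain ⟨v, hv⟩ := hℓz ![1, 1, 1, 1]
      have hv0 : v ≠ 0 := by
        rintro rfl
        have := hv 0
        rw [hℓ] at this
        simp at this
      obtain ⟨i, hi⟩ := Function.ne_iff.mp hv0
      refine ⟨i, fun h0 => ?_⟩
      have := hr v i
      rw [h0] at this
      simp [q, hv] at this
      norm_num at this
      exact hi this
    · intro i j
      refine MvPolynomial.funext fun v => ?_
      rw [map_mul, map_mul, hr, hr, eval_X, eval_X]
      ring

end CubeValues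

/-! ### The open set of general maps -/

theorem tri_smul_add (c d : ℂ) (a b : TriCoeff) (s t u : Fin 2 → ℂ) :
    tri (c • a + d • b) s t u = c • tri a s t u + d • tri b s t u := by
  funext i
  simp only [tri, Fin.sum_univ_two, Pi.add_apply, Pi.smul_apply, smul_eq_mul,
    Algebra.algebraMap_self, RingHom.id_apply]
  ring

theorem tri_smul (c : ℂ) (a : TriCoeff) (s t u : Fin 2 → ℂ) :
    tri (c • a) s t u = c • tri a s t u := by
  simpa using tri_smul_add c 0 a a s t u

theorem IsNormal.smul {a : TriCoeff} (h : IsNormal a) {c : ℂ} (hc : c ≠ 0) : IsNormal (c • a) := by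
  obtain ⟨s₀, s₁, t₀, t₁, u₀, u₁, A, B₁, B₂, B₃, h, hli⟩ := h
  refine ⟨s₀, s₁, t₀, t₁, u₀, u₁, c • A, c • B₁, c • B₂, c • B₃,
    ⟨h.det_s, h.det_t, h.det_u, ?_, ?_, ?_, ?_, ?_, ?_, ?_, ?_⟩, ?_⟩
  · rw [tri_smul, h.e000, smul_zero]
  · rw [tri_smul, h.e100]
  · rw [tri_smul, h.e010]
  · rw [tri_smul, h.e001]
  · rw [tri_smul, h.e011]
  · rw [tri_smul, h.e101]
  · rw [tri_smul, h.e110]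
  · rw [tri_smul, h.e111, smul_zero]
  · convert hli.units_smul fun _ => Units.mk0 c hc using 1
    ext i j
    fin_cases i <;> rfl

theorem detPencil_smul (c : ℂ) (a : TriCoeff) (s s' : Fin 2 → ℂ) :
    detPencil (c • a) s s' = Polynomial.C (c ^ 4) * detPencil a s s' := by
  have h1 : ∀ r, slice (c • a) r = c • slice a r := by
    intro r
    ext i j
    fin_cases j <;> simp [slice] <;> ring
  have h2 : (Matrix.of fun i j => Polynomial.C (slice (c • a) s i j) +
      Polynomial.X * Polynomial.C (slice (c • a) s' i j)) = Polynomial.C c •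
      Matrix.of fun i j => Polynomial.C (slice a s i j) +
        Polynomial.X * Polynomial.C (slice a s' i j) := by
    ext1 i j
    simp only [h1, Matrix.smul_apply, Matrix.of_apply, smul_eq_mul, Polynomial.C_mul]
    ring
  rw [detPencil, h2, Matrix.det_smul, Fintype.card_fin, detPencil, Polynomial.C_pow]

theorem hess_smul (c : ℂ) (a : TriCoeff) (s s' : Fin 2 → ℂ) :
    hess (c • a) s s' = c ^ 8 * hess a s s' := by
  rw [hess, hess, detPencil_smul, Polynomial.coeff_C_mul, Polynomial.coeff_C_mul,
    Polynomial.coeff_C_mul]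
  ring

/-- The maps for which the determinant of the slices is not a fourth power. -/
def generalMaps : Set TrilinearTuple := {φ | ∃ s s', hess (coeffs φ.rep) s s' ≠ 0}

theorem exists_poly_hess (s s' : Fin 2 → ℂ) :
    ∃ F : MvPolynomial (Fin 4 × Fin 2 × Fin 2 × Fin 2) ℂ,
      ∀ v, eval v F = hess (coeffs v) s s' := by
  let gen : (Fin 2 → ℂ) → Matrix (Fin 4) (Fin 4) (MvPolynomial (Fin 4 × Fin 2 × Fin 2 × Fin 2) ℂ) :=
    fun r => Matrix.of fun i => ![C (r 0) * X (i, 0, 0, 0) + C (r 1) * X (i, 1, 0, 0),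
      C (r 0) * X (i, 0, 0, 1) + C (r 1) * X (i, 1, 0, 1),
      C (r 0) * X (i, 0, 1, 0) + C (r 1) * X (i, 1, 1, 0),
      C (r 0) * X (i, 0, 1, 1) + C (r 1) * X (i, 1, 1, 1)]
  have hgen : ∀ v r i j, eval v (gen r i j) = slice (coeffs v) r i j := by
    intro v r i j
    fin_cases j <;> simp [gen, slice, coeffs]
  let P : Polynomial (MvPolynomial (Fin 4 × Fin 2 × Fin 2 × Fin 2) ℂ) :=
    (Matrix.of fun i j => Polynomial.C (gen s i j) + Polynomial.X * Polynomial.C (gen s' i j)).det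
  have hP : ∀ v, P.map (eval v) = detPencil (coeffs v) s s' := by
    intro v
    rw [← Polynomial.coe_mapRingHom, RingHom.map_det (Polynomial.mapRingHom (eval v)), detPencil]
    congr 1
    ext1 i j
    simp [hgen]
  refine ⟨8 * P.coeff 0 * P.coeff 2 - 3 * P.coeff 1 ^ 2, fun v => ?_⟩
  rw [hess, ← hP, Polynomial.coeff_map, Polynomial.coeff_map, Polynomial.coeff_map]
  simp only [map_sub, map_mul, map_pow, map_ofNat]

theorem isOpen_generalMaps : IsOpen generalMaps := by
  choose F hF using exists_poly_hess
  have h := PSpace.isClosed_setOf_eval (Set.range fun p : (Fin 2 → ℂ) × (Fin 2 → ℂ) => F p.1 p.2) (by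
    rintro _ ⟨p, rfl⟩
    refine ⟨8, fun c v => ?_⟩
    rw [hF, hF, ← hess_smul]
    rfl)
  rw [← isClosed_compl_iff]
  convert h using 1
  ext φ
  simp only [generalMaps, Set.mem_compl_iff, Set.mem_ofPred_eq, Set.forall_mem_range, hF,
    not_exists, not_not, Prod.forall]

theorem isNormal_of_mem {φ : TrilinearTuple} (hG : φ ∈ generalMaps) (hB : φ ∈ Bir 2 2 2) :
    IsNormal (coeffs φ.rep) := by
  obtain ⟨s, s', hs⟩ := hG
  obtain ⟨-, σ, τ, υ, h1, h2, h3, c1, c2, c3, hi⟩ := hB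
  rcases (quadraticInverse_of_isInverse h1 h2 h3 c1 c2 c3 hi).isNormal_or with h | h
  · exact h
  · exact absurd (h.1 s s') hs

theorem mem_of_isNormal {φ : TrilinearTuple} (h : IsNormal (coeffs φ.rep)) :
    φ ∈ generalMaps ∩ Bir 2 2 2 := by
  refine ⟨h.exists_hess_ne_zero, ?_⟩
  obtain ⟨s₀, s₁, t₀, t₁, u₀, u₁, A, B₁, B₂, B₃, h, hli⟩ := h
  exact h.mem_bir hli

theorem mem_cone_of_isNormal {v : Fin 4 × Fin 2 × Fin 2 × Fin 2 → ℂ} (h : IsNormal (coeffs v)) :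
    v ∈ PSpace.cone (generalMaps ∩ Bir 2 2 2) := by
  intro hv
  obtain ⟨c, hc, hr⟩ := PSpace.exists_rep_mk v hv
  refine mem_of_isNormal ?_
  rw [hr]
  exact h.smul hc

theorem bir_nonempty : (Bir 2 2 2).Nonempty := by
  let e : Fin 4 → Fin 4 → ℂ := fun i => Pi.single i 1
  let F : Fin 2 → Fin 2 → Fin 2 → Fin 4 → ℂ :=
    ![![![0, e 3], ![e 3, e 0]], ![![e 3, e 1], ![e 2, 0]]]
  let v : Fin 4 × Fin 2 × Fin 2 × Fin 2 → ℂ := fun p => F p.2.1 p.2.2.1 p.2.2.2 p.1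
  have hv : v ≠ 0 := by
    intro h0
    have := congrFun h0 (3, 0, 0, 1)
    simp [v, F, e] at this
  have hF : ∀ x y z : Fin 2 → ℂ, tri (coeffs v) x y z = ∑ j, ∑ k, ∑ l, (x j * y k * z l) • F j k l := by
    intro x y z
    funext i
    simp [tri, coeffs, v, mul_comm]
  have hn : IsNormal (coeffs v) := by
    refine ⟨![1, 0], ![0, 1], ![1, 0], ![0, 1], ![1, 0], ![0, 1], e 3, e 0, e 1, e 2,
      ⟨?_, ?_, ?_, ?_, ?_, ?_, ?_, ?_, ?_, ?_, ?_⟩, ?_⟩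
    any_goals simp [det2]
    any_goals rw [hF]; simp [F]
    have : (![e 0, e 1, e 2, e 3] : Fin 4 → Fin 4 → ℂ) = Pi.basisFun ℂ (Fin 4) := by
      ext i j
      fin_cases i <;> simp [e]
    rw [this]
    exact (Pi.basisFun ℂ (Fin 4)).linearIndependent
  exact ⟨_, (mem_cone_of_isNormal hn hv).2⟩

/-- The degenerate maps are limits of maps in normal form: perturb the coefficient of `C`, zero in
the relation, to `ε`, and move `B₁` so that the relation stays on the quadric. -/
theorem bir_subset_closure : Bir 2 2 2 ⊆ closure (generalMaps ∩ Bir 2 2 2) := by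
  intro φ hφ
  obtain ⟨-, σ, τ, υ, h1, h2, h3, c1, c2, c3, hi⟩ := id hφ
  rcases (quadraticInverse_of_isInverse h1 h2 h3 c1 c2 c3 hi).isNormal_or with
    h | ⟨-, s₀, s₁, t₀, t₁, u₀, u₁, A, B₁, B₂, B₃, D, m, n₁, n₂, n₃, hc, hn1, hn2, hn3, hrel, hQ,
      hspan⟩
  · exact subset_closure (mem_of_isNormal h)
  set a := coeffs φ.rep
  have hn23 : n₂ + n₃ ≠ 0 := by
    intro h0
    apply mul_ne_zero hn2 hn3
    linear_combination hQ - n₁ * h0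
  -- moving the value at one vertex gives a path of maps in normal form
  set k := m / (n₂ + n₃) with hk
  set w := D + k • B₁ with hw
  let L₀ : Fin 2 → ℂ := ![s₁ 1 / det2 s₀ s₁, -s₁ 0 / det2 s₀ s₁]
  let L₁ : Fin 2 → ℂ := ![-t₀ 1 / det2 t₀ t₁, t₀ 0 / det2 t₀ t₁]
  let L₂ : Fin 2 → ℂ := ![-u₀ 1 / det2 u₀ u₁, u₀ 0 / det2 u₀ u₁]
  let δ : TriCoeff := fun i p q r => L₀ p * L₁ q * L₂ r * w i
  have hδ : ∀ s t u : Fin 2 → ℂ, tri δ s t u =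
      ((L₀ 0 * s 0 + L₀ 1 * s 1) * (L₁ 0 * t 0 + L₁ 1 * t 1) * (L₂ 0 * u 0 + L₂ 1 * u 1)) • w := by
    intro s t u
    funext i
    simp only [tri, δ, Fin.sum_univ_two, Pi.smul_apply, smul_eq_mul, Algebra.algebraMap_self,
      RingHom.id_apply]
    ring
  have l00 : L₀ 0 * s₀ 0 + L₀ 1 * s₀ 1 = 1 := by
    have := hc.det_s
    simp only [L₀, Matrix.cons_val_zero, Matrix.cons_val_one]
    field_simp
    simp only [det2]; ring
  have l01 : L₀ 0 * s₁ 0 + L₀ 1 * s₁ 1 = 0 := by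
    simp only [L₀, Matrix.cons_val_zero, Matrix.cons_val_one]
    ring
  have l10 : L₁ 0 * t₀ 0 + L₁ 1 * t₀ 1 = 0 := by
    simp only [L₁, Matrix.cons_val_zero, Matrix.cons_val_one]
    ring
  have l11 : L₁ 0 * t₁ 0 + L₁ 1 * t₁ 1 = 1 := by
    have := hc.det_t
    simp only [L₁, Matrix.cons_val_zero, Matrix.cons_val_one]
    field_simp
    simp only [det2]; ring
  have l20 : L₂ 0 * u₀ 0 + L₂ 1 * u₀ 1 = 0 := by
    simp only [L₂, Matrix.cons_val_zero, Matrix.cons_val_one]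
    ring
  have l21 : L₂ 0 * u₁ 0 + L₂ 1 * u₁ 1 = 1 := by
    have := hc.det_u
    simp only [L₂, Matrix.cons_val_zero, Matrix.cons_val_one]
    field_simp
    simp only [det2]; ring
  have hnormal : ∀ ε : ℂ, ε ≠ 0 → n₁ + ε * k ≠ 0 → IsNormal ((n₁ + ε * k) • a + (-ε) • δ) := by
    intro ε hε hκ
    set κ := n₁ + ε * k with hκdef
    have hcv : CubeValues (κ • a + (-ε) • δ) s₀ s₁ t₀ t₁ u₀ u₁ (κ • A) (κ • B₁ + (-ε) • w) (κ • B₂)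
        (κ • B₃) (κ • D) := by
      refine ⟨hc.det_s, hc.det_t, hc.det_u, ?_, ?_, ?_, ?_, ?_, ?_, ?_, ?_⟩ <;>
        rw [tri_smul_add, hδ] <;> simp only [l00, l01, l10, l11, l20, l21, hc.e000, hc.e100,
          hc.e010, hc.e001, hc.e011, hc.e101, hc.e110, hc.e111] <;> simp
    refine hcv.isNormal (m := m) (n₁ := κ) (n₂ := n₂) (n₃ := n₃) (e := ε) ?_ hε ?_ ?_
    · have : m • κ • A + κ • (κ • B₁ + (-ε) • w) + n₂ • κ • B₂ + n₃ • κ • B₃ + ε • κ • D =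
          κ • (m • A + n₁ • B₁ + n₂ • B₂ + n₃ • B₃) := by
        rw [hw, hκdef]
        module
      rw [this, hrel, smul_zero]
    · have : k * (n₂ + n₃) = m := by rw [hk]; field_simp
      rw [hκdef, ← this]
      linear_combination -hQ
    · intro W hA _ h2 h3 hD
      have hs : ∀ v : Fin 4 → ℂ, κ • v ∈ W → v ∈ W := fun v hv => (W.smul_mem_iff hκ).mp hv
      refine hspan W (hs _ hA) ((W.smul_mem_iff hn1).mp ?_) (hs _ h2) (hs _ h3) (hs _ hD)
      have : n₁ • B₁ = -(m • A + n₂ • B₂ + n₃ • B₃) := by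
        rw [← sub_eq_zero, ← hrel]; module
      rw [this]
      exact W.neg_mem (W.add_mem (W.add_mem (W.smul_mem _ (hs _ hA)) (W.smul_mem _ (hs _ h2)))
        (W.smul_mem _ (hs _ h3)))
  let path : Fin 4 × Fin 2 × Fin 2 × Fin 2 → Polynomial ℂ := fun p =>
    (Polynomial.C n₁ + Polynomial.X * Polynomial.C k) * Polynomial.C (φ.rep p) -
      Polynomial.X * Polynomial.C (δ p.1 p.2.1 p.2.2.1 p.2.2.2)
  have hpath : ∀ ε, coeffs (PSpace.pathAt path ε) = (n₁ + ε * k) • a + (-ε) • δ := by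
    intro ε
    funext i p q r
    simp [coeffs, PSpace.pathAt, path, a]
    ring
  have hfin : {ε | PSpace.pathAt path ε ∉ PSpace.cone (generalMaps ∩ Bir 2 2 2)}.Finite := by
    refine (Set.toFinite {0, -n₁ / k}).subset fun ε hε => ?_
    by_contra hn
    simp only [Set.mem_insert_iff, Set.mem_singleton_iff, not_or] at hn
    apply hε
    refine mem_cone_of_isNormal ?_
    rw [hpath]
    refine hnormal ε hn.1 fun h0 => hn.2 ?_
    have hk0 : k ≠ 0 := by
      intro h1
      rw [h1, mul_zero, add_zero] at h0
      exact hn1 h0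
    field_simp
    linear_combination h0
  have hmem := PSpace.mem_cone_closure_of_path path hfin 0
  have h0 : PSpace.pathAt path 0 = n₁ • φ.rep := by
    funext p
    simp [PSpace.pathAt, path]
  rw [h0, PSpace.smul_mem_cone_iff hn1, PSpace.rep_mem_cone] at hmem
  exact hmem

end LineCongruence

namespace LineCongruence

/-! ### Plücker coordinates and incidence -/

/-- The point `p` lies on the line with Plücker coordinates `c`: the equations `p ∧ c = 0`. -/
def Incident (p : Fin 4 → ℂ) (c : Fin 6 → ℂ) : Prop :=
  p 0 * c 5 - p 1 * c 1 + p 2 * c 0 = 0 ∧ -p 0 * c 4 - p 1 * c 2 + p 3 * c 0 = 0 ∧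
    p 0 * c 3 - p 2 * c 2 + p 3 * c 1 = 0 ∧ p 1 * c 3 + p 2 * c 4 + p 3 * c 5 = 0

theorem Incident.smul_right {p : Fin 4 → ℂ} {c : Fin 6 → ℂ} (h : Incident p c) (k : ℂ) :
    Incident p (k • c) := by
  obtain ⟨h1, h2, h3, h4⟩ := h
  refine ⟨?_, ?_, ?_, ?_⟩ <;> simp only [Pi.smul_apply, smul_eq_mul]
  · linear_combination k * h1
  · linear_combination k * h2
  · linear_combination k * h3
  · linear_combination k * h4

theorem Incident.smul_left {p : Fin 4 → ℂ} {c : Fin 6 → ℂ} (h : Incident p c) (k : ℂ) :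
    Incident (k • p) c := by
  obtain ⟨h1, h2, h3, h4⟩ := h
  refine ⟨?_, ?_, ?_, ?_⟩ <;> simp only [Pi.smul_apply, smul_eq_mul]
  · linear_combination k * h1
  · linear_combination k * h2
  · linear_combination k * h3
  · linear_combination k * h4

theorem incident_plucker_iff {a b p : Fin 4 → ℂ} (h : plucker a b ≠ 0) :
    Incident p (plucker a b) ↔ p ∈ Submodule.span ℂ {a, b} := by
  rw [Submodule.mem_span_pair]
  constructor
  · rintro ⟨h1, h2, h3, h4⟩
    simp only [plucker, Matrix.cons_val] at h1 h2 h3 h4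
    have key : ∀ i j k, p k * (a i * b j - a j * b i) =
        (p i * b j - p j * b i) * a k + (a i * p j - a j * p i) * b k := by
      intro i j k
      fin_cases i <;> fin_cases j <;> fin_cases k <;> simp only [Fin.mk_one, Fin.zero_eta,
        Fin.reduceFinMk, Fin.isValue] <;>
        first
        | ring1
        | linear_combination h1
        | linear_combination -h1
        | linear_combination h2
        | linear_combination -h2
        | linear_combination h3
        | linear_combination -h3
        | linear_combination h4
        | linear_combination -h4
    obtain ⟨i, j, hij⟩ : ∃ i j, a i * b j - a j * b i ≠ 0 := by
      by_contra! h0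
      apply h
      ext m
      fin_cases m <;> simp only [plucker] <;> exact h0 _ _
    refine ⟨(p i * b j - p j * b i) / (a i * b j - a j * b i),
      (a i * p j - a j * p i) / (a i * b j - a j * b i), ?_⟩
    funext k
    simp only [Pi.add_apply, Pi.smul_apply, smul_eq_mul]
    rw [div_mul_eq_mul_div, div_mul_eq_mul_div, ← add_div, div_eq_iff hij]
    linear_combination -key i j k
  · rintro ⟨x, y, rfl⟩
    refine ⟨?_, ?_, ?_, ?_⟩ <;> simp only [plucker, Matrix.cons_val, Pi.add_apply, Pi.smul_apply,
      smul_eq_mul] <;> ring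

theorem exists_plucker_eq {c : Fin 6 → ℂ} (hc : c ≠ 0)
    (h : c 0 * c 3 + c 1 * c 4 + c 2 * c 5 = 0) : ∃ a b, plucker a b = c := by
  by_cases h0 : c 0 = 0
  · by_cases h1 : c 1 = 0
    · by_cases h2 : c 2 = 0
      · by_cases h3 : c 3 = 0
        · by_cases h4 : c 4 = 0
          · have h5 : c 5 ≠ 0 := by
              intro h5
              apply hc
              ext i
              fin_cases i <;> assumption
            refine ⟨![0, 0, 1, 0], ![0, -c 5, 0, 0], ?_⟩
            ext i
            fin_cases i <;> simp [plucker, *]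
          · refine ⟨![0, 1, -c 3 / c 4, 0], ![0, 0, c 5, -c 4], ?_⟩
            ext i
            fin_cases i <;> simp [plucker, *]
        · refine ⟨![0, -c 5 / c 3, 0, 1], ![0, c 4, -c 3, 0], ?_⟩
          ext i
          fin_cases i <;> simp [plucker, *]
      · have h5 : c 5 = 0 := by simpa [h0, h1, h2] using h
        refine ⟨![0, 0, 0, 1], ![-c 2, c 4, -c 3, 0], ?_⟩
        ext i
        fin_cases i <;> simp [plucker, h0, h1, h5]
    · refine ⟨![0, c 0 / c 1, 1, c 2 / c 1], ![-c 1, -c 5, 0, c 3], ?_⟩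
      ext i
      fin_cases i <;> simp [plucker, *] <;> field_simp
      simp only [h0] at h
      linear_combination -h
  · refine ⟨![0, 1, c 1 / c 0, c 2 / c 0], ![-c 0, 0, c 5, -c 4], ?_⟩
    ext i
    fin_cases i <;> simp [plucker, *] <;> field_simp
    linear_combination -h

theorem mem_lineOf_of_incident {ω : PSpace (Fin 6)} (hω : ω ∈ kleinQuadric) {p : PSpace (Fin 4)}
    (h : Incident p.rep ω.rep) : p ∈ lineOf ω := by
  obtain ⟨a, b, hab⟩ := exists_plucker_eq ω.rep_ne_zero hω
  have h0 : plucker a b ≠ 0 := by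
    rw [hab]
    exact ω.rep_ne_zero
  refine ⟨a, b, h0, ?_, ?_⟩
  · have := ω.mk_rep
    simp only [← hab] at this
    exact this
  · rwa [← incident_plucker_iff h0, hab]

theorem plucker_mem_klein {a b : Fin 4 → ℂ} (h : plucker a b ≠ 0) :
    PSpace.mk (plucker a b) h ∈ kleinQuadric := by
  obtain ⟨k, -, hk⟩ := PSpace.exists_rep_mk _ h
  change (PSpace.mk _ h).rep 0 * (PSpace.mk _ h).rep 3 + (PSpace.mk _ h).rep 1 *
    (PSpace.mk _ h).rep 4 + (PSpace.mk _ h).rep 2 * (PSpace.mk _ h).rep 5 = 0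
  rw [hk]
  simp only [Pi.smul_apply, smul_eq_mul, plucker, Matrix.cons_val]
  ring

theorem incident_rep_right {p : Fin 4 → ℂ} {c : Fin 6 → ℂ} (h : c ≠ 0) :
    Incident p (PSpace.mk c h).rep ↔ Incident p c := by
  obtain ⟨k, hk0, hk⟩ := PSpace.exists_rep_mk c h
  rw [hk]
  refine ⟨fun hi => ?_, fun hi => hi.smul_right k⟩
  have := hi.smul_right k⁻¹
  rwa [smul_smul, inv_mul_cancel₀ hk0, one_smul] at this

theorem incident_rep_left {p : Fin 4 → ℂ} {c : Fin 6 → ℂ} (h : p ≠ 0) :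
    Incident (PSpace.mk p h).rep c ↔ Incident p c := by
  obtain ⟨k, hk0, hk⟩ := PSpace.exists_rep_mk p h
  rw [hk]
  refine ⟨fun hi => ?_, fun hi => hi.smul_left k⟩
  have := hi.smul_left k⁻¹
  rwa [smul_smul, inv_mul_cancel₀ hk0, one_smul] at this

theorem incident_of_mem_lineOf {ω : PSpace (Fin 6)} {p : PSpace (Fin 4)} (h : p ∈ lineOf ω) :
    Incident p.rep ω.rep := by
  obtain ⟨a, b, hab, rfl, hp⟩ := h
  rwa [incident_rep_right, incident_plucker_iff hab]

namespace PSpace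

variable {ι : Type}

theorem isClosed_setOf_eval_eq_zero (f : MvPolynomial ι ℂ) (d : ℕ)
    (hf : ∀ (c : ℂ) (v : ι → ℂ), eval (c • v) f = c ^ d * eval v f) :
    IsClosed {p : PSpace ι | eval p.rep f = 0} := by
  have := isClosed_setOf_eval {f} (by rintro _ rfl; exact ⟨d, hf⟩)
  simpa using this

/-- A closed set covered by a polynomial path and by the limit of the path at infinity is minimal
among the infinite closed sets. -/
theorem isMinimalInfinite_of_path {C : Set (PSpace ι)} (hC : IsClosed C) (hinf : C.Infinite)
    (w w' : ι → Polynomial ℂ) (hcov : ∀ p ∈ C, (∃ x hx, mk (pathAt w x) hx = p) ∨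
      ∃ h, mk (pathAt w' 0) h = p)
    (hrev : ∀ y ≠ 0, ∃ c x : ℂ, pathAt w' y = c • pathAt w x) : IsMinimalInfinite C := by
  refine ⟨hC, hinf, fun A hAC hA hAinf => Set.Subset.antisymm hAC fun p hp => ?_⟩
  have h1 : {x | pathAt w x ∈ cone A}.Infinite := by
    intro hfin
    classical
    have hf2 := (hfin.image fun x => if h : pathAt w x ≠ 0 then mk (pathAt w x) h else p).union
      (Set.finite_singleton (if h : pathAt w' 0 ≠ 0 then mk (pathAt w' 0) h else p))
    refine hAinf (hf2.subset fun q hq => ?_)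
    rcases hcov q (hAC hq) with ⟨x, hx, rfl⟩ | ⟨h, rfl⟩
    · left
      exact ⟨x, fun _ => hq, by simp [hx]⟩
    · right
      simp [h]
  have h2 := mem_cone_of_path hA w h1
  have h3 : {y | pathAt w' y ∈ cone A}.Infinite := by
    refine (Set.finite_singleton (0 : ℂ)).infinite_compl.mono fun y hy => ?_
    obtain ⟨c, x, hcx⟩ := hrev y hy
    change pathAt w' y ∈ cone A
    rw [hcx]
    exact smul_mem_cone (h2 x) c
  rcases hcov p hp with ⟨x, hx, rfl⟩ | ⟨h, rfl⟩
  · exact h2 x hx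
  · exact mem_cone_of_path hA w' h3 0 h

end PSpace

/-! ### The focal line and the focal conic in normal coordinates -/

/-- The line `b = c = 0` in the coordinates `(a, b, c, w)`. -/
def modelAxis : Set (PSpace (Fin 4)) := {p | p.rep 1 = 0 ∧ p.rep 2 = 0}

/-- The conic `a b + b c + c a = 0` in the plane `w = 0`, in the coordinates `(a, b, c, w)`. -/
def modelConic : Set (PSpace (Fin 4)) :=
  {p | p.rep 3 = 0 ∧ p.rep 0 * p.rep 1 + p.rep 1 * p.rep 2 + p.rep 2 * p.rep 0 = 0}

theorem mk_mem_modelAxis {v : Fin 4 → ℂ} (h : v ≠ 0) :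
    PSpace.mk v h ∈ modelAxis ↔ v 1 = 0 ∧ v 2 = 0 := by
  obtain ⟨k, hk0, hk⟩ := PSpace.exists_rep_mk v h
  change (PSpace.mk v h).rep 1 = 0 ∧ (PSpace.mk v h).rep 2 = 0 ↔ _
  rw [hk]
  simp [hk0]

theorem mk_mem_modelConic {v : Fin 4 → ℂ} (h : v ≠ 0) :
    PSpace.mk v h ∈ modelConic ↔ v 3 = 0 ∧ v 0 * v 1 + v 1 * v 2 + v 2 * v 0 = 0 := by
  obtain ⟨k, hk0, hk⟩ := PSpace.exists_rep_mk v h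
  change (PSpace.mk v h).rep 3 = 0 ∧ (PSpace.mk v h).rep 0 * (PSpace.mk v h).rep 1 +
    (PSpace.mk v h).rep 1 * (PSpace.mk v h).rep 2 +
    (PSpace.mk v h).rep 2 * (PSpace.mk v h).rep 0 = 0 ↔ _
  rw [hk]
  simp only [Pi.smul_apply, smul_eq_mul, mul_eq_zero, hk0, false_or]
  rw [show k * v 0 * (k * v 1) + k * v 1 * (k * v 2) + k * v 2 * (k * v 0) =
    k * k * (v 0 * v 1 + v 1 * v 2 + v 2 * v 0) by ring]
  simp [hk0]

theorem isMinimalInfinite_modelAxis : PSpace.IsMinimalInfinite modelAxis := by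
  have hval : ∀ x, PSpace.pathAt ![Polynomial.X, 0, 0, 1] x = ![x, 0, 0, 1] := by
    intro x
    ext i
    fin_cases i <;> simp [PSpace.pathAt]
  have hval' : ∀ x, PSpace.pathAt ![1, 0, 0, Polynomial.X] x = ![1, 0, 0, x] := by
    intro x
    ext i
    fin_cases i <;> simp [PSpace.pathAt]
  have hne : ∀ x : ℂ, (![x, 0, 0, 1] : Fin 4 → ℂ) ≠ 0 := fun x h => by
    simpa using congrFun h 3
  refine PSpace.isMinimalInfinite_of_path ?_ ?_ ![Polynomial.X, 0, 0, 1]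
    ![1, 0, 0, Polynomial.X] ?_ ?_
  · have h1 := PSpace.isClosed_setOf_eval_eq_zero (X 1 : MvPolynomial (Fin 4) ℂ) 1 (by simp)
    have h2 := PSpace.isClosed_setOf_eval_eq_zero (X 2 : MvPolynomial (Fin 4) ℂ) 1 (by simp)
    convert h1.inter h2 using 1
    ext p
    simp [modelAxis]
  · refine Set.infinite_of_injective_forall_mem (f := fun x : ℂ => PSpace.mk _ (hne x)) ?_ ?_
    · intro x y hxy
      obtain ⟨k, hk⟩ := (PSpace.mk_eq_mk_iff _ _).mp hxy
      have h0 := congrFun hk 0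
      have h3 := congrFun hk 3
      simp at h0 h3
      rw [← h0, h3, one_mul]
    · intro x
      simp [mk_mem_modelAxis]
  · rintro p ⟨h1, h2⟩
    by_cases h3 : p.rep 3 = 0
    · right
      rw [hval']
      have hne' : (![1, 0, 0, 0] : Fin 4 → ℂ) ≠ 0 := fun h => by simpa using congrFun h 0
      refine ⟨hne', ?_⟩
      rw [← p.mk_rep, PSpace.mk_eq_mk_iff]
      have h0 : p.rep 0 ≠ 0 := fun h0 => p.rep_ne_zero (by
        ext i
        fin_cases i <;> assumption)
      refine ⟨(p.rep 0)⁻¹, ?_⟩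
      ext i
      fin_cases i <;> simp [h0, h1, h2, h3]
    · left
      refine ⟨p.rep 0 / p.rep 3, ?_⟩
      rw [hval]
      refine ⟨hne _, ?_⟩
      rw [← p.mk_rep, PSpace.mk_eq_mk_iff]
      refine ⟨(p.rep 3)⁻¹, ?_⟩
      rw [p.mk_rep]
      ext i
      fin_cases i <;> simp [h1, h2, h3, div_eq_inv_mul]
  · intro y hy
    refine ⟨y, y⁻¹, ?_⟩
    rw [hval, hval']
    ext i
    fin_cases i <;> simp [hy]

theorem isMinimalInfinite_modelConic : PSpace.IsMinimalInfinite modelConic := by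
  let w : Fin 4 → Polynomial ℂ :=
    ![-Polynomial.X, Polynomial.X * (Polynomial.X + 1), Polynomial.X + 1, 0]
  let w' : Fin 4 → Polynomial ℂ :=
    ![-Polynomial.X, 1 + Polynomial.X, Polynomial.X * (1 + Polynomial.X), 0]
  have hval : ∀ x, PSpace.pathAt w x = ![-x, x * (x + 1), x + 1, 0] := by
    intro x
    ext i
    fin_cases i <;> simp [PSpace.pathAt, w]
  have hval' : ∀ x, PSpace.pathAt w' x = ![-x, 1 + x, x * (1 + x), 0] := by
    intro x
    ext i
    fin_cases i <;> simp [PSpace.pathAt, w']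
  have hne : ∀ x : ℂ, (![-x, x * (x + 1), x + 1, 0] : Fin 4 → ℂ) ≠ 0 := fun x h => by
    have h0 := congrFun h 0
    have h2 := congrFun h 2
    simp at h0 h2
    simp [h0] at h2
  refine PSpace.isMinimalInfinite_of_path ?_ ?_ w w' ?_ ?_
  · have h1 := PSpace.isClosed_setOf_eval_eq_zero (X 3 : MvPolynomial (Fin 4) ℂ) 1 (by simp)
    have h2 := PSpace.isClosed_setOf_eval_eq_zero
      (X 0 * X 1 + X 1 * X 2 + X 2 * X 0 : MvPolynomial (Fin 4) ℂ) 2 (by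
        intro c v
        simp
        ring)
    convert h1.inter h2 using 1
    ext p
    simp [modelConic]
  · refine Set.infinite_of_injOn_mapsTo (s := {0, -1}ᶜ)
      (f := fun x : ℂ => PSpace.mk _ (hne x)) ?_ ?_
      (Set.Finite.infinite_compl (by simp))
    · intro x hx y hy hxy
      simp only [Set.mem_compl_iff, Set.mem_insert_iff, Set.mem_singleton_iff, not_or] at hx hy
      obtain ⟨k, hk⟩ := (PSpace.mk_eq_mk_iff _ _).mp hxy
      have h0 := congrFun hk 1
      have h3 := congrFun hk 2
      simp at h0 h3
      have hx1 : x + 1 ≠ 0 := fun h => hx.2 (eq_neg_of_add_eq_zero_left h)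
      refine mul_right_cancel₀ hx1 ?_
      linear_combination -h0 + y * h3
    · intro x _
      simp only [mk_mem_modelConic, Matrix.cons_val]
      exact ⟨trivial, by ring⟩
  · rintro p ⟨h3, hq⟩
    by_cases h2 : p.rep 2 = 0
    · rw [h2] at hq
      have h01 : p.rep 0 * p.rep 1 = 0 := by linear_combination hq
      rcases mul_eq_zero.mp h01 with h0 | h1
      · right
        have h1 : p.rep 1 ≠ 0 := fun h1 => p.rep_ne_zero (by
          ext i
          fin_cases i <;> assumption)
        rw [hval']
        have hne' : (![-0, 1 + 0, 0 * (1 + 0), 0] : Fin 4 → ℂ) ≠ 0 := fun h => by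
          simpa using congrFun h 1
        refine ⟨hne', ?_⟩
        rw [← p.mk_rep, PSpace.mk_eq_mk_iff]
        refine ⟨(p.rep 1)⁻¹, ?_⟩
        ext i
        fin_cases i <;> simp [h0, h1, h2, h3]
      · left
        have h0 : p.rep 0 ≠ 0 := fun h0 => p.rep_ne_zero (by
          ext i
          fin_cases i <;> assumption)
        refine ⟨-1, ?_⟩
        rw [hval]
        refine ⟨hne _, ?_⟩
        rw [← p.mk_rep, PSpace.mk_eq_mk_iff]
        refine ⟨(p.rep 0)⁻¹, ?_⟩
        ext i
        fin_cases i <;> simp [h0, h1, h2, h3]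
    · left
      have hs : p.rep 1 + p.rep 2 ≠ 0 := by
        intro hs
        have : p.rep 1 * p.rep 2 = 0 := by linear_combination hq - p.rep 0 * hs
        rcases mul_eq_zero.mp this with h1 | h1
        · rw [h1, zero_add] at hs
          exact h2 hs
        · exact h2 h1
      refine ⟨p.rep 1 / p.rep 2, ?_⟩
      rw [hval]
      refine ⟨hne _, ?_⟩
      have key : ((p.rep 1 + p.rep 2) / p.rep 2 ^ 2) • p.rep = ![-(p.rep 1 / p.rep 2),
          p.rep 1 / p.rep 2 * (p.rep 1 / p.rep 2 + 1), p.rep 1 / p.rep 2 + 1, 0] := by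
        ext i
        fin_cases i <;> simp [h3] <;> field_simp
        linear_combination hq
      generalize p.rep 1 / p.rep 2 = x at key ⊢
      obtain ⟨k, hk⟩ : ∃ k : ℂ, k • p.rep = ![-x, x * (x + 1), x + 1, 0] := ⟨_, key⟩
      rw [← p.mk_rep, PSpace.mk_eq_mk_iff]
      exact ⟨k, hk⟩
  · intro y hy
    refine ⟨y ^ 2, y⁻¹, ?_⟩
    rw [hval, hval']
    ext i
    fin_cases i <;> simp <;> field_simp

/-! ### The model congruence -/

/-- The Plücker coordinates of the lines of the model congruence, as quadratic forms in three
parameters. -/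
def modelPlucker {R : Type} [CommRing R] (v : Fin 3 → R) : Fin 6 → R :=
  ![v 0 * v 1, v 0 * v 2, v 1 * v 2, -(v 2 * (v 1 + v 2)), v 1 * (v 1 + v 2), 0]

/-- The parameters of the line that belongs to a point `(y, z)` of `ℙ¹ × ℙ¹`. -/
def modelParam {R : Type} [CommRing R] (y z : Fin 2 → R) : Fin 3 → R :=
  ![y 1 * z 1, y 0 * z 1, y 1 * z 0]

/-- The lines of the model congruence that belong to the points of `ℙ¹ × ℙ¹`. -/
def modelLines : Set (PSpace (Fin 6)) :=
  {ω | ∃ (y z : Fin 2 → ℂ) (h : modelPlucker (modelParam y z) ≠ 0), ω = PSpace.mk _ h}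

/-- The model congruence: the normal form of the congruence of the `s`-lines. -/
def modelCongruence : Set (PSpace (Fin 6)) := closure modelLines

theorem modelPlucker_modelParam (y z : Fin 2 → ℂ) :
    plucker ![y 1 * z 1, 0, 0, y 1 * z 0 + y 0 * z 1] ![0, y 0 * z 1, y 1 * z 0, y 0 * z 0] =
      modelPlucker (modelParam y z) := by
  ext i
  fin_cases i <;> simp [plucker, modelPlucker, modelParam] <;> ring

theorem modelPlucker_smul (d : ℂ) (v : Fin 3 → ℂ) :
    modelPlucker (d • v) = d ^ 2 • modelPlucker v := by
  ext i
  fin_cases i <;> simp [modelPlucker] <;> ring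

theorem mk_modelPlucker_mem {v : Fin 3 → ℂ} (h0 : v 0 ≠ 0) (h : modelPlucker v ≠ 0) :
    PSpace.mk _ h ∈ modelCongruence := by
  have key : modelPlucker (modelParam ![v 1, v 0] ![v 2, v 0]) = v 0 ^ 2 • modelPlucker v := by
    rw [← modelPlucker_smul]
    congr 1
    ext i
    fin_cases i <;> simp [modelParam]
    ring
  have hne : modelPlucker (modelParam ![v 1, v 0] ![v 2, v 0]) ≠ 0 := by
    rw [key]
    exact smul_ne_zero (pow_ne_zero _ h0) h
  refine subset_closure ⟨_, _, hne, ?_⟩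
  rw [PSpace.mk_eq_mk_iff]
  refine ⟨(v 0 ^ 2)⁻¹, ?_⟩
  rw [key, smul_smul, inv_mul_cancel₀ (pow_ne_zero _ h0), one_smul]

theorem isIrreducible_modelCongruence : IsIrreducible modelCongruence := by
  refine IsIrreducible.closure (PSpace.isIrreducible_of_path ?_ ?_)
  · have h : modelPlucker (modelParam ![1, 1] ![1, 1]) ≠ (0 : Fin 6 → ℂ) := fun h => by
      simpa [modelPlucker, modelParam] using congrFun h 0
    exact ⟨_, _, _, h, rfl⟩
  · rintro p ⟨y, z, h, rfl⟩ q ⟨y', z', h', rfl⟩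
    let Y : Fin 2 → Polynomial ℂ := fun i =>
      Polynomial.C (y i) + Polynomial.X * Polynomial.C (y' i - y i)
    let Z : Fin 2 → Polynomial ℂ := fun i =>
      Polynomial.C (z i) + Polynomial.X * Polynomial.C (z' i - z i)
    have hval : ∀ x, PSpace.pathAt (modelPlucker (modelParam Y Z)) x =
        modelPlucker (modelParam (fun i => y i + x * (y' i - y i))
          fun i => z i + x * (z' i - z i)) := by
      intro x
      ext i
      fin_cases i <;> simp [PSpace.pathAt, modelPlucker, modelParam, Y, Z]
    refine ⟨modelPlucker (modelParam Y Z), ⟨0, ?_, ?_⟩, ⟨1, ?_, ?_⟩, ?_⟩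
    · rw [hval]
      simpa using h
    · simp [hval]
    · rw [hval]
      simpa using h'
    · simp [hval]
    · convert Set.finite_empty
      ext x
      simp only [Set.mem_ofPred_eq, Set.mem_empty_iff_false, iff_false, not_not, hval]
      exact fun hn => ⟨_, _, hn, rfl⟩

theorem isVariety_modelCongruence : IsVariety modelCongruence :=
  ⟨isClosed_closure, isIrreducible_modelCongruence⟩

theorem topologicalKrullDim_modelCongruence_le : topologicalKrullDim modelCongruence ≤ 2 := by
  refine PSpace.topologicalKrullDim_le_of_param (n := 2) isClosed_closure
    (aeval (modelPlucker (X : Fin 3 → MvPolynomial (Fin 3) ℂ))) fun f hf => ?_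
  have hcl := PSpace.isClosed_forall_smul ({f} : Set (MvPolynomial (Fin 6) ℂ))
  have hsub : modelCongruence ⊆ {p | ∀ g ∈ ({f} : Set (MvPolynomial (Fin 6) ℂ)), ∀ c : ℂ,
      eval (c • p.rep) g = 0} := by
    refine closure_minimal ?_ hcl
    rintro p ⟨y, z, h, rfl⟩ g rfl c
    obtain ⟨k, -, hk⟩ := PSpace.exists_rep_mk _ h
    obtain ⟨d, hd⟩ := IsAlgClosed.exists_pow_nat_eq (c * k) (n := 2) (by norm_num)
    rw [hk, smul_smul, ← hd, ← modelPlucker_smul]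
    have h1 : ∀ v : Fin 3 → ℂ, (fun i => eval v (modelPlucker X i)) = modelPlucker v := by
      intro v
      ext i
      fin_cases i <;> simp [modelPlucker]
    have h2 := congrArg (aeval (d • modelParam y z)) hf
    rw [map_zero, comp_aeval_apply] at h2
    simp only [aeval_eq_eval] at h2
    rwa [← h1]
  exact fun p hp c => hsub hp f rfl c

/-- A polynomial equation that holds on the lines of the model congruence. -/
theorem eval_eq_zero_of_mem_modelCongruence (f : MvPolynomial (Fin 6) ℂ) (d : ℕ)
    (hf : ∀ (c : ℂ) (v : Fin 6 → ℂ), eval (c • v) f = c ^ d * eval v f)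
    (h : ∀ v : Fin 3 → ℂ, eval (modelPlucker v) f = 0) {ω : PSpace (Fin 6)}
    (hω : ω ∈ modelCongruence) : eval ω.rep f = 0 := by
  refine closure_minimal ?_ (PSpace.isClosed_setOf_eval_eq_zero f d hf) hω
  rintro _ ⟨y, z, hn, rfl⟩
  obtain ⟨k, -, hk⟩ := PSpace.exists_rep_mk _ hn
  change eval (PSpace.mk _ hn).rep f = 0
  rw [hk, hf, h, mul_zero]

theorem equations_of_mem_modelCongruence {ω : PSpace (Fin 6)} (hω : ω ∈ modelCongruence) :
    ω.rep 5 = 0 ∧ ω.rep 0 * ω.rep 3 + ω.rep 1 * ω.rep 4 = 0 ∧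
      -ω.rep 2 * ω.rep 4 - ω.rep 4 * ω.rep 3 + ω.rep 2 * ω.rep 3 = 0 := by
  refine ⟨?_, ?_, ?_⟩
  · simpa using eval_eq_zero_of_mem_modelCongruence (X 5) 1 (by simp)
      (by simp [modelPlucker]) hω
  · have h := eval_eq_zero_of_mem_modelCongruence (X 0 * X 3 + X 1 * X 4) 2
      (by intro c v; simp; ring) (by intro v; simp [modelPlucker]; ring) hω
    simpa only [map_add, map_mul, eval_X] using h
  · have h := eval_eq_zero_of_mem_modelCongruence (-X 2 * X 4 - X 4 * X 3 + X 2 * X 3) 2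
      (by intro c v; simp; ring) (by intro v; simp [modelPlucker]; ring) hω
    simpa only [map_add, map_sub, map_neg, map_mul, eval_X] using h

theorem modelCongruence_subset_klein : modelCongruence ⊆ kleinQuadric := by
  intro ω hω
  obtain ⟨h5, h, -⟩ := equations_of_mem_modelCongruence hω
  change ω.rep 0 * ω.rep 3 + ω.rep 1 * ω.rep 4 + ω.rep 2 * ω.rep 5 = 0
  rw [h5, h, mul_zero, add_zero]

theorem two_le_topologicalKrullDim_modelCongruence :
    2 ≤ topologicalKrullDim modelCongruence := by
  -- the lines with `γ = 0` form a line of the Klein quadric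
  let B : Set (PSpace (Fin 6)) := {ω | ∃ (x : ℂ) (_ : x ≠ 0)
    (h : (![x, 0, 0, 0, 1, 0] : Fin 6 → ℂ) ≠ 0), ω = PSpace.mk _ h}
  have hne : ∀ x, (![x, 0, 0, 0, 1, 0] : Fin 6 → ℂ) ≠ 0 := fun x h => by
    simpa using congrFun h 4
  have hBirr : IsIrreducible B := by
    refine PSpace.isIrreducible_of_path ⟨_, 1, one_ne_zero, hne 1, rfl⟩ ?_
    rintro p ⟨x, hx, h, rfl⟩ q ⟨y, hy, h', rfl⟩
    have hval : ∀ x, PSpace.pathAt ![Polynomial.X, 0, 0, 0, 1, 0] x = ![x, 0, 0, 0, 1, 0] := by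
      intro x
      ext i
      fin_cases i <;> simp [PSpace.pathAt]
    refine ⟨![Polynomial.X, 0, 0, 0, 1, 0], ⟨x, ?_, ?_⟩, ⟨y, ?_, ?_⟩, ?_⟩
    · rwa [hval]
    · simp [hval]
    · rwa [hval]
    · simp [hval]
    · refine (Set.finite_singleton (0 : ℂ)).subset fun a ha => ?_
      by_contra ha0
      refine ha fun hn => ⟨a, ha0, hne a, ?_⟩
      simp [hval]
  have hBsub : closure B ⊆ modelCongruence := by
    refine closure_minimal ?_ isClosed_closure
    rintro _ ⟨x, hx, h, rfl⟩
    have key : modelPlucker ![x, 1, 0] = ![x, 0, 0, 0, 1, 0] := by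
      ext i
      fin_cases i <;> simp [modelPlucker]
    have := mk_modelPlucker_mem (v := ![x, 1, 0]) hx (by rwa [key])
    simpa only [key] using this
  have hB1 : ∀ ω ∈ closure B, ω.rep 1 = 0 := by
    intro ω hω
    have hcl := PSpace.isClosed_setOf_eval_eq_zero (X 1 : MvPolynomial (Fin 6) ℂ) 1 (by simp)
    have hsub : B ⊆ {p : PSpace (Fin 6) | eval p.rep (X 1 : MvPolynomial (Fin 6) ℂ) = 0} := by
      rintro _ ⟨x, hx, h, rfl⟩
      obtain ⟨k, -, hk⟩ := PSpace.exists_rep_mk _ h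
      simp [hk]
    simpa using closure_minimal hsub hcl hω
  refine PSpace.two_le_topologicalKrullDim (A := {PSpace.mk _ (hne 1)}) (B := closure B)
    isClosed_closure isIrreducible_modelCongruence isClosed_singleton isIrreducible_singleton
    isClosed_closure hBirr.closure ?_ ?_
  · have h1 : PSpace.mk _ (hne 1) ∈ closure B := subset_closure ⟨1, one_ne_zero, hne 1, rfl⟩
    refine (Set.singleton_subset_iff.mpr h1).ssubset_of_ne fun h => ?_
    have h2 : PSpace.mk _ (hne 2) ∈ closure B := subset_closure ⟨2, two_ne_zero, hne 2, rfl⟩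
    rw [← h, Set.mem_singleton_iff, PSpace.mk_eq_mk_iff] at h2
    obtain ⟨k, hk⟩ := h2
    have h0 := congrFun hk 0
    have h4 := congrFun hk 4
    simp at h0 h4
    rw [h4] at h0
    norm_num at h0
  · refine hBsub.ssubset_of_ne fun h => ?_
    have hn : modelPlucker ![1, 1, 1] ≠ (0 : Fin 6 → ℂ) := fun h => by
      simpa [modelPlucker] using congrFun h 0
    have hm := mk_modelPlucker_mem (v := ![1, 1, 1]) one_ne_zero hn
    rw [← h] at hm
    have h1 := hB1 _ hm
    obtain ⟨k, hk0, hk⟩ := PSpace.exists_rep_mk _ hn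
    rw [hk] at h1
    simp [modelPlucker] at h1
    exact hk0 h1

theorem isLineCongruence_modelCongruence : IsLineCongruence modelCongruence :=
  ⟨⟨isVariety_modelCongruence, le_antisymm topologicalKrullDim_modelCongruence_le
    two_le_topologicalKrullDim_modelCongruence⟩, modelCongruence_subset_klein⟩

/-! ### The focal curves of the model congruence -/

theorem mk_mem_lineOf {v : Fin 4 → ℂ} (hv : v ≠ 0) {ω : PSpace (Fin 6)} (hω : ω ∈ kleinQuadric)
    (h : Incident v ω.rep) : PSpace.mk v hv ∈ lineOf ω :=
  mem_lineOf_of_incident hω ((incident_rep_left hv).mpr h)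

theorem meetsAll_modelAxis : MeetsAll modelCongruence modelAxis := by
  intro ω hω
  have hK := modelCongruence_subset_klein hω
  obtain ⟨h5, h, -⟩ := equations_of_mem_modelCongruence hω
  -- the common point is `(ω₀ : 0 : 0 : ω₄)` or `(ω₁ : 0 : 0 : -ω₃)`, or `(1 : 0 : 0 : 0)` if both
  -- formulas give zero
  by_cases h1 : (![ω.rep 0, 0, 0, ω.rep 4] : Fin 4 → ℂ) = 0
  · by_cases h2 : (![ω.rep 1, 0, 0, -ω.rep 3] : Fin 4 → ℂ) = 0
    · have e0 := congrFun h1 0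
      have e4 := congrFun h1 3
      have e1 := congrFun h2 0
      have e3 := congrFun h2 3
      simp at e0 e4 e1 e3
      have h3 : (![1, 0, 0, 0] : Fin 4 → ℂ) ≠ 0 := fun h => by simpa using congrFun h 0
      exact ⟨_, (mk_mem_modelAxis h3).mpr (by simp),
        mk_mem_lineOf h3 hK (by simp [Incident, h5, e0, e4, e1, e3])⟩
    · refine ⟨_, (mk_mem_modelAxis h2).mpr (by simp),
        mk_mem_lineOf h2 hK ⟨?_, ?_, ?_, ?_⟩⟩ <;> simp [h5] <;>
        first | ring1 | linear_combination -h
  · refine ⟨_, (mk_mem_modelAxis h1).mpr (by simp),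
      mk_mem_lineOf h1 hK ⟨?_, ?_, ?_, ?_⟩⟩ <;> simp [h5]
    · ring
    · linear_combination h

theorem meetsAll_modelConic : MeetsAll modelCongruence modelConic := by
  intro ω hω
  have hK := modelCongruence_subset_klein hω
  obtain ⟨h5, h, hq⟩ := equations_of_mem_modelCongruence hω
  -- the line meets the plane `w = 0` in `(-ω₂ : ω₄ : -ω₃ : 0)`, or is contained in it and passes
  -- through `(1 : 0 : 0 : 0)`
  by_cases h1 : (![-ω.rep 2, ω.rep 4, -ω.rep 3, 0] : Fin 4 → ℂ) = 0
  · have e2 := congrFun h1 0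
    have e4 := congrFun h1 1
    have e3 := congrFun h1 2
    simp at e2 e4 e3
    have h3 : (![1, 0, 0, 0] : Fin 4 → ℂ) ≠ 0 := fun h => by simpa using congrFun h 0
    exact ⟨_, (mk_mem_modelConic h3).mpr (by simp),
      mk_mem_lineOf h3 hK (by simp [Incident, h5, e2, e4, e3])⟩
  · refine ⟨_, (mk_mem_modelConic h1).mpr ⟨by simp, ?_⟩,
      mk_mem_lineOf h1 hK ⟨?_, ?_, ?_, ?_⟩⟩ <;> simp [h5]
    · linear_combination hq
    · linear_combination -h
    · ring
    · ring
    · ring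

/-- A curve that meets all lines is focal if two of the lines are disjoint. -/
theorem isFocal_of_isMinimalInfinite {X : Set (PSpace (Fin 6))} {C : Set (PSpace (Fin 4))}
    (hC : PSpace.IsMinimalInfinite C) (hX : MeetsAll X C) {ω ω' : PSpace (Fin 6)} (hω : ω ∈ X)
    (hω' : ω' ∈ X) (h : Disjoint (lineOf ω) (lineOf ω')) : IsFocal X C := by
  refine ⟨hC.isCurve.1, hX, fun W hW hWC hWX => ?_⟩
  rcases hC.eq_singleton_or_eq hW.1 hW.2 hWC with ⟨p, rfl⟩ | h1
  · exfalso
    obtain ⟨q, hq, hqω⟩ := hWX ω hω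
    obtain ⟨q', hq', hqω'⟩ := hWX ω' hω'
    rw [Set.mem_singleton_iff] at hq hq'
    subst hq hq'
    exact Set.disjoint_left.mp h hqω hqω'
  · exact h1

theorem exists_disjoint_lines : ∃ ω ∈ modelCongruence, ∃ ω' ∈ modelCongruence,
    Disjoint (lineOf ω) (lineOf ω') := by
  have h1 : modelPlucker ![1, 1, 1] ≠ (0 : Fin 6 → ℂ) := fun h => by
    simpa [modelPlucker] using congrFun h 0
  have h2 : modelPlucker ![1, 1, 0] ≠ (0 : Fin 6 → ℂ) := fun h => by
    simpa [modelPlucker] using congrFun h 0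
  refine ⟨_, mk_modelPlucker_mem (v := ![1, 1, 1]) one_ne_zero h1, _,
    mk_modelPlucker_mem (v := ![1, 1, 0]) one_ne_zero h2,
    Set.disjoint_left.mpr fun p hp hp' => ?_⟩
  obtain ⟨e11, e12, -, -⟩ := (incident_rep_right h1).mp (incident_of_mem_lineOf hp)
  obtain ⟨e21, e22, -, -⟩ := (incident_rep_right h2).mp (incident_of_mem_lineOf hp')
  simp [modelPlucker] at e11 e12 e21 e22
  have p1 : p.rep 1 = 0 := by linear_combination e21 - e11
  have p0 : p.rep 0 = 0 := by linear_combination e22 - e12 - p1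
  have p3 : p.rep 3 = 0 := by linear_combination e22 + p0
  apply p.rep_ne_zero
  ext i
  fin_cases i <;> assumption

theorem isFocal_modelAxis : IsFocal modelCongruence modelAxis := by
  obtain ⟨ω, hω, ω', hω', h⟩ := exists_disjoint_lines
  exact isFocal_of_isMinimalInfinite isMinimalInfinite_modelAxis meetsAll_modelAxis hω hω' h

theorem isFocal_modelConic : IsFocal modelCongruence modelConic := by
  obtain ⟨ω, hω, ω', hω', h⟩ := exists_disjoint_lines
  exact isFocal_of_isMinimalInfinite isMinimalInfinite_modelConic meetsAll_modelConic hω hω' h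

/-- The cone over the focal conic with vertex `(m, 0, 0, 1)` on the focal line. -/
def focalCone (m : ℂ) : Set (PSpace (Fin 4)) :=
  {p | (p.rep 0 - m * p.rep 3) * (p.rep 1 + p.rep 2) + p.rep 1 * p.rep 2 = 0}

theorem isClosed_focalCone (m : ℂ) : IsClosed (focalCone m) := by
  have h := PSpace.isClosed_setOf_eval_eq_zero
    ((X 0 - C m * X 3) * (X 1 + X 2) + X 1 * X 2 : MvPolynomial (Fin 4) ℂ) 2
    (by intro c v; simp; ring)
  convert h using 1
  ext p
  simp [focalCone]

/-- The vertex of the cone `focalCone m`. -/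
def focalVertex (m : ℂ) : PSpace (Fin 4) :=
  PSpace.mk ![m, 0, 0, 1] fun h => by simpa using congrFun h 3

theorem eq_focalVertex {m : ℂ} {p : PSpace (Fin 4)} (h1 : p.rep 1 = 0) (h2 : p.rep 2 = 0)
    (h3 : p.rep 0 = m * p.rep 3) : p = focalVertex m := by
  have hp : p.rep 3 ≠ 0 := fun h0 => p.rep_ne_zero (by
    ext i
    fin_cases i
    · simpa [h0] using h3
    all_goals assumption)
  rw [← p.mk_rep, focalVertex, PSpace.mk_eq_mk_iff]
  refine ⟨p.rep 3, ?_⟩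
  ext i
  fin_cases i <;> simp [h1, h2, h3, mul_comm]

theorem focalVertex_injective : Function.Injective focalVertex := by
  intro m m' h
  obtain ⟨k, hk⟩ := (PSpace.mk_eq_mk_iff _ _).mp h
  have h0 := congrFun hk 0
  have h3 := congrFun hk 3
  simp at h0 h3
  rw [← h0, h3, one_mul]

/-- The rulings of a focal cone are lines of the congruence, so a curve that meets all lines
contains the vertex or has infinitely many points on the cone. -/
theorem focalVertex_mem_or_subset_focalCone {V : Set (PSpace (Fin 4))} (hV : IsCurve V)
    (hVX : MeetsAll modelCongruence V) {m : ℂ} (hm : m ≠ 0) :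
    focalVertex m ∈ V ∨ V ⊆ focalCone m := by
  by_cases hv : focalVertex m ∈ V
  · exact Or.inl hv
  right
  have key : ∀ k : ℂ, ∃ p ∈ V, k ≠ -1 → p.rep 2 ≠ 0 ∧ p.rep 1 = k * p.rep 2 ∧
      p ∈ focalCone m := by
    intro k
    by_cases hk : k = -1
    · obtain ⟨p, hp⟩ := hV.1.2.1
      exact ⟨p, hp, fun h => absurd hk h⟩
    have hk1 : k + 1 ≠ 0 := fun h => hk (eq_neg_of_add_eq_zero_left h)
    have hne : modelPlucker ![m * (k + 1), k, 1] ≠ 0 := fun h => by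
      have := congrFun h 1
      simp [modelPlucker, hm, hk1] at this
    obtain ⟨p, hp, hpl⟩ := hVX _ (mk_modelPlucker_mem (v := ![m * (k + 1), k, 1])
      (mul_ne_zero hm hk1) hne)
    obtain ⟨-, -, e3, e4⟩ := (incident_rep_right hne).mp (incident_of_mem_lineOf hpl)
    simp [modelPlucker] at e3 e4
    have h1 : p.rep 1 = k * p.rep 2 := mul_left_cancel₀ hk1 (by linear_combination -e4)
    refine ⟨p, hp, fun _ => ⟨fun h2 => hv ?_, h1, ?_⟩⟩
    · rw [h2, mul_zero] at h1
      rw [← eq_focalVertex h1 h2 (mul_left_cancel₀ hk1 (by linear_combination -e3 - k * h2))]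
      exact hp
    · change (p.rep 0 - m * p.rep 3) * (p.rep 1 + p.rep 2) + p.rep 1 * p.rep 2 = 0
      rw [h1]
      linear_combination -p.rep 2 * e3
  choose f hfV hf using key
  have hinf : (V ∩ focalCone m).Infinite := by
    refine Set.infinite_of_injOn_mapsTo (s := {-1}ᶜ) (f := f) ?_ ?_
      (Set.finite_singleton _).infinite_compl
    · intro k hk k' hk' h
      obtain ⟨h2, h1, -⟩ := hf k hk
      obtain ⟨-, h1', -⟩ := hf k' hk'
      rw [← h, h1] at h1'
      exact mul_right_cancel₀ h2 h1'
    · exact fun k hk => ⟨hfV k, (hf k hk).2.2⟩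
  rw [← Set.inter_eq_left]
  exact PSpace.eq_of_infinite_of_isCurve hV Set.inter_subset_left
    (hV.1.1.inter (isClosed_focalCone m)) hinf

theorem focalCone_inter_subset {m m' : ℂ} (h : m ≠ m') :
    focalCone m ∩ focalCone m' ⊆ modelConic ∪ modelAxis := by
  rintro p ⟨h1, h2⟩
  change (p.rep 0 - m * p.rep 3) * (p.rep 1 + p.rep 2) + p.rep 1 * p.rep 2 = 0 at h1
  change (p.rep 0 - m' * p.rep 3) * (p.rep 1 + p.rep 2) + p.rep 1 * p.rep 2 = 0 at h2
  have h3 : p.rep 3 * (p.rep 1 + p.rep 2) = 0 :=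
    mul_left_cancel₀ (sub_ne_zero.mpr h) (by linear_combination h2 - h1)
  rcases mul_eq_zero.mp h3 with h4 | h4
  · refine Or.inl ⟨h4, ?_⟩
    rw [h4] at h1
    linear_combination h1
  · right
    have h5 : p.rep 1 * p.rep 1 = 0 := by
      linear_combination (p.rep 0 - m * p.rep 3 + p.rep 1) * h4 - h1
    have h6 : p.rep 1 = 0 := mul_self_eq_zero.mp h5
    exact ⟨h6, by linear_combination h4 - h6⟩

/-- The focal line and the focal conic are the only curves that meet all lines. -/
theorem eq_of_isCurve_of_meetsAll {V : Set (PSpace (Fin 4))} (hV : IsCurve V)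
    (hVX : MeetsAll modelCongruence V) : V = modelAxis ∨ V = modelConic := by
  have hsub : ∀ {D}, PSpace.IsMinimalInfinite D → V ⊆ D → V = D := by
    intro D hD hVD
    rcases hD.eq_singleton_or_eq hV.1.1 hV.1.2 hVD with ⟨p, rfl⟩ | h
    · obtain ⟨ω, hω, ω', hω', h⟩ := exists_disjoint_lines
      obtain ⟨q, hq, hqω⟩ := hVX ω hω
      obtain ⟨q', hq', hqω'⟩ := hVX ω' hω'
      rw [Set.mem_singleton_iff] at hq hq'
      subst hq hq'
      exact absurd hqω' (Set.disjoint_left.mp h hqω)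
    · exact h
  by_cases hinf : {m | focalVertex m ∈ V}.Infinite
  · left
    refine hsub isMinimalInfinite_modelAxis ?_
    rw [← Set.inter_eq_left]
    refine PSpace.eq_of_infinite_of_isCurve hV Set.inter_subset_left
      (hV.1.1.inter isMinimalInfinite_modelAxis.isClosed) ?_
    refine Set.infinite_of_injOn_mapsTo focalVertex_injective.injOn (fun m hm => ⟨hm, ?_⟩) hinf
    exact (mk_mem_modelAxis _).mpr (by simp)
  · rw [Set.not_infinite] at hinf
    have hmem : ∀ m ∈ ({m | focalVertex m ∈ V} ∪ {0})ᶜ, V ⊆ focalCone m := by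
      intro m hm
      simp only [Set.mem_compl_iff, Set.mem_union, Set.mem_singleton_iff, not_or] at hm
      exact (focalVertex_mem_or_subset_focalCone hV hVX hm.2).resolve_left hm.1
    obtain ⟨m, hm, m', hm', hne⟩ :=
      (hinf.union (Set.finite_singleton 0)).infinite_compl.nontrivial
    have hU := (Set.subset_inter (hmem m hm) (hmem m' hm')).trans (focalCone_inter_subset hne)
    rcases isPreirreducible_iff_isClosed_union_isClosed.mp hV.1.2.2 _ _
      isMinimalInfinite_modelConic.isClosed isMinimalInfinite_modelAxis.isClosed hU with h | h
    · exact Or.inr (hsub isMinimalInfinite_modelConic h)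
    · exact Or.inl (hsub isMinimalInfinite_modelAxis h)

theorem focalCurves_modelCongruence : focalCurves modelCongruence = {modelAxis, modelConic} := by
  ext V
  constructor
  · rintro ⟨hV, -, hVX, -⟩
    exact eq_of_isCurve_of_meetsAll hV hVX
  · rintro (rfl | rfl)
    · exact ⟨isMinimalInfinite_modelAxis.isCurve, isFocal_modelAxis⟩
    · exact ⟨isMinimalInfinite_modelConic.isCurve, isFocal_modelConic⟩

/-! ### Projective transformations -/

namespace PSpace

variable {ι : Type}

/-- The projective transformation of a linear automorphism, as a map. -/
def mapFun (e : (ι → ℂ) ≃ₗ[ℂ] (ι → ℂ)) (p : PSpace ι) : PSpace ι :=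
  mk (e p.rep) (e.map_ne_zero_iff.mpr p.rep_ne_zero)

theorem mapFun_mk (e : (ι → ℂ) ≃ₗ[ℂ] (ι → ℂ)) {v : ι → ℂ} (hv : v ≠ 0) :
    mapFun e (mk v hv) = mk (e v) (e.map_ne_zero_iff.mpr hv) := by
  obtain ⟨k, -, hk⟩ := exists_rep_mk v hv
  rw [mapFun, mk_eq_mk_iff]
  exact ⟨k, by rw [hk, map_smul]⟩

theorem mapFun_symm_mapFun (e : (ι → ℂ) ≃ₗ[ℂ] (ι → ℂ)) (p : PSpace ι) :
    mapFun e.symm (mapFun e p) = p := by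
  change mapFun e.symm (mk (e p.rep) _) = p
  rw [mapFun_mk]
  simp only [LinearEquiv.symm_apply_apply]
  exact p.mk_rep

theorem continuous_mapFun [Fintype ι] (e : (ι → ℂ) ≃ₗ[ℂ] (ι → ℂ)) : Continuous (mapFun e) := by
  classical
  rw [continuous_iff_isClosed]
  intro Z hZ
  obtain ⟨F, hF, hmem⟩ := mem_of_isClosed hZ
  let g : ι → MvPolynomial ι ℂ := fun i => ∑ j, C (e (Pi.single j 1) i) * X j
  have hg : ∀ v : ι → ℂ, (fun i => eval v (g i)) = e v := by
    intro v
    have hv : v = ∑ j, v j • (Pi.single j 1 : ι → ℂ) := by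
      ext i
      simp [Finset.sum_apply, Pi.single_apply]
    conv_rhs => rw [hv]
    ext i
    simp only [g, map_sum, map_mul, eval_C, eval_X, map_smul, Finset.sum_apply, Pi.smul_apply,
      smul_eq_mul, mul_comm]
  have heval : ∀ (v : ι → ℂ) f, eval v (aeval g f) = eval (e v) f := by
    intro v f
    rw [← hg, ← aeval_eq_eval, ← aeval_eq_eval]
    exact comp_aeval_apply g (aeval v) f
  convert isClosed_setOf_eval ((aeval g) '' F) ?_ using 1
  · ext p
    rw [Set.mem_preimage, ← rep_mem_cone (p := mapFun e p)]
    obtain ⟨k, hk0, hk⟩ := exists_rep_mk (e p.rep) (e.map_ne_zero_iff.mpr p.rep_ne_zero)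
    rw [mapFun, hk, smul_mem_cone_iff hk0, hmem _ (e.map_ne_zero_iff.mpr p.rep_ne_zero)]
    simp only [Set.mem_ofPred_eq, Set.forall_mem_image, heval]
  · rintro _ ⟨f, hf, rfl⟩
    obtain ⟨d, hd⟩ := hF f hf
    refine ⟨d, fun c v => ?_⟩
    rw [heval, heval, map_smul, eval_smul hd]

/-- The projective transformation of a linear automorphism. -/
def map [Fintype ι] (e : (ι → ℂ) ≃ₗ[ℂ] (ι → ℂ)) : PSpace ι ≃ₜ PSpace ι where
  toFun := mapFun e
  invFun := mapFun e.symm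
  left_inv := mapFun_symm_mapFun e
  right_inv := mapFun_symm_mapFun e.symm
  continuous_toFun := continuous_mapFun e
  continuous_invFun := continuous_mapFun e.symm

variable [Fintype ι] (e : (ι → ℂ) ≃ₗ[ℂ] (ι → ℂ))

theorem map_mk {v : ι → ℂ} (hv : v ≠ 0) :
    map e (mk v hv) = mk (e v) (e.map_ne_zero_iff.mpr hv) := mapFun_mk e hv

theorem exists_rep_map (p : PSpace ι) : ∃ c : ℂ, c ≠ 0 ∧ (map e p).rep = c • e p.rep :=
  exists_rep_mk _ _

theorem image_symm_image (Z : Set (PSpace ι)) : map e.symm '' (map e '' Z) = Z :=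
  (map e).symm_image_image Z

theorem image_image_symm (Z : Set (PSpace ι)) : map e '' (map e.symm '' Z) = Z :=
  (map e).image_symm_image Z

theorem mem_image_iff {p : PSpace ι} {Z : Set (PSpace ι)} :
    p ∈ map e '' Z ↔ map e.symm p ∈ Z := by
  constructor
  · rintro ⟨q, hq, rfl⟩
    change mapFun e.symm (mapFun e q) ∈ Z
    rwa [mapFun_symm_mapFun]
  · exact fun h => ⟨_, h, mapFun_symm_mapFun e.symm p⟩

end PSpace

section Homeomorph

variable {ι : Type} (h : PSpace ι ≃ₜ PSpace ι) {V : Set (PSpace ι)}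

theorem IsVariety.image (hV : IsVariety V) : IsVariety (h '' V) :=
  ⟨h.isClosedMap _ hV.1, hV.2.image _ h.continuous.continuousOn⟩

theorem topologicalKrullDim_image : topologicalKrullDim (h '' V) = topologicalKrullDim V :=
  (IsHomeomorph.topologicalKrullDim_eq _ (h.image V).isHomeomorph).symm

theorem IsCurve.image (hV : IsCurve V) : IsCurve (h '' V) :=
  ⟨hV.1.image h, by rw [topologicalKrullDim_image, hV.2]⟩

theorem IsSurface.image (hV : IsSurface V) : IsSurface (h '' V) :=
  ⟨hV.1.image h, by rw [topologicalKrullDim_image, hV.2]⟩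

end Homeomorph

/-- The endomorphism of the space of Plücker vectors induced by an endomorphism of `ℂ⁴`: the
second exterior power. -/
def wedgeHom (e : (Fin 4 → ℂ) →ₗ[ℂ] (Fin 4 → ℂ)) : (Fin 6 → ℂ) →ₗ[ℂ] (Fin 6 → ℂ) :=
  Fintype.linearCombination ℂ fun m : Fin 6 =>
    plucker (e (Pi.single ((![0, 0, 0, 2, 3, 1] : Fin 6 → Fin 4) m) 1))
      (e (Pi.single ((![1, 2, 3, 3, 1, 2] : Fin 6 → Fin 4) m) 1))

theorem wedgeHom_plucker (e : (Fin 4 → ℂ) →ₗ[ℂ] (Fin 4 → ℂ)) (a b : Fin 4 → ℂ) :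
    wedgeHom e (plucker a b) = plucker (e a) (e b) := by
  have h : ∀ v i, e v i = v 0 * e (Pi.single 0 1) i + v 1 * e (Pi.single 1 1) i +
      v 2 * e (Pi.single 2 1) i + v 3 * e (Pi.single 3 1) i := by
    intro v i
    have hv : v = v 0 • Pi.single 0 1 + v 1 • Pi.single 1 1 + v 2 • Pi.single 2 1 +
        v 3 • Pi.single 3 1 := by
      ext j
      fin_cases j <;> simp
    conv_lhs => rw [hv]
    simp
  ext n
  simp only [wedgeHom, Fintype.linearCombination_apply, Fin.sum_univ_six, Finset.sum_apply,
    Pi.smul_apply, smul_eq_mul, Matrix.cons_val]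
  fin_cases n <;> simp only [plucker, Matrix.cons_val, Fin.mk_one, Fin.zero_eta, Fin.reduceFinMk,
    h a, h b] <;> ring

theorem wedgeHom_comp (e e' : (Fin 4 → ℂ) →ₗ[ℂ] (Fin 4 → ℂ)) (h : e ∘ₗ e' = LinearMap.id) :
    wedgeHom e ∘ₗ wedgeHom e' = LinearMap.id := by
  refine (Pi.basisFun ℂ (Fin 6)).ext fun m => ?_
  have hm : (Pi.single m 1 : Fin 6 → ℂ) =
      plucker (Pi.single ((![0, 0, 0, 2, 3, 1] : Fin 6 → Fin 4) m) 1)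
        (Pi.single ((![1, 2, 3, 3, 1, 2] : Fin 6 → Fin 4) m) 1) := by
    ext i
    fin_cases m <;> fin_cases i <;> simp [plucker]
  have hee : ∀ v, e (e' v) = v := fun v => LinearMap.congr_fun h v
  rw [Pi.basisFun_apply, LinearMap.comp_apply, hm, wedgeHom_plucker, wedgeHom_plucker, hee, hee,
    LinearMap.id_apply]

/-- The automorphism of the space of Plücker vectors induced by an automorphism of `ℂ⁴`. -/
def wedge (e : (Fin 4 → ℂ) ≃ₗ[ℂ] (Fin 4 → ℂ)) : (Fin 6 → ℂ) ≃ₗ[ℂ] (Fin 6 → ℂ) :=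
  LinearEquiv.ofLinearMap (wedgeHom e) (wedgeHom e.symm)
    (wedgeHom_comp _ _ (LinearMap.ext fun v => e.apply_symm_apply v))
    (wedgeHom_comp _ _ (LinearMap.ext fun v => e.symm_apply_apply v))

theorem wedge_plucker (e : (Fin 4 → ℂ) ≃ₗ[ℂ] (Fin 4 → ℂ)) (a b : Fin 4 → ℂ) :
    wedge e (plucker a b) = plucker (e a) (e b) := wedgeHom_plucker e a b

theorem wedge_symm (e : (Fin 4 → ℂ) ≃ₗ[ℂ] (Fin 4 → ℂ)) : (wedge e).symm = wedge e.symm := rfl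

section Transport

variable (e : (Fin 4 → ℂ) ≃ₗ[ℂ] (Fin 4 → ℂ)) {X : Set (PSpace (Fin 6))} {V : Set (PSpace (Fin 4))}

theorem map_mem_lineOf {ω : PSpace (Fin 6)} {p : PSpace (Fin 4)} (hp : p ∈ lineOf ω) :
    PSpace.map e p ∈ lineOf (PSpace.map (wedge e) ω) := by
  obtain ⟨a, b, h, rfl, hp⟩ := hp
  have h' : plucker (e a) (e b) ≠ 0 := by
    rw [← wedge_plucker]
    exact (wedge e).map_ne_zero_iff.mpr h
  refine ⟨e a, e b, h', ?_, ?_⟩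
  · rw [PSpace.map_mk]
    simp only [wedge_plucker]
  · obtain ⟨k, -, hk⟩ := PSpace.exists_rep_map e p
    rw [hk]
    refine Submodule.smul_mem _ _ ?_
    rw [Submodule.mem_span_pair] at hp ⊢
    obtain ⟨x, y, hxy⟩ := hp
    exact ⟨x, y, by rw [← hxy, map_add, map_smul, map_smul]⟩

theorem MeetsAll.image (h : MeetsAll X V) :
    MeetsAll (PSpace.map (wedge e) '' X) (PSpace.map e '' V) := by
  rintro _ ⟨ω, hω, rfl⟩
  obtain ⟨p, hp, hpω⟩ := h ω hω
  exact ⟨_, ⟨p, hp, rfl⟩, map_mem_lineOf e hpω⟩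

theorem IsFocal.image (h : IsFocal X V) :
    IsFocal (PSpace.map (wedge e) '' X) (PSpace.map e '' V) := by
  obtain ⟨hV, hVX, hmin⟩ := h
  refine ⟨hV.image _, hVX.image e, fun W hW hWV hWX => ?_⟩
  have h1 := hmin (PSpace.map e.symm '' W) (hW.image _) ?_ ?_
  · rw [← h1, PSpace.image_image_symm]
  · rw [← PSpace.image_symm_image e V]
    exact Set.image_mono hWV
  · have := hWX.image e.symm
    rwa [← wedge_symm, PSpace.image_symm_image] at this

theorem focalCurves_image :
    focalCurves (PSpace.map (wedge e) '' X) = Set.image (PSpace.map e) '' focalCurves X := by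
  ext V
  constructor
  · rintro ⟨hV, hVX⟩
    refine ⟨PSpace.map e.symm '' V, ⟨hV.image _, ?_⟩, PSpace.image_image_symm e V⟩
    have := hVX.image e.symm
    rwa [← wedge_symm, PSpace.image_symm_image] at this
  · rintro ⟨V, ⟨hV, hVX⟩, rfl⟩
    exact ⟨hV.image _, hVX.image e⟩

theorem IsLineCongruence.image (h : IsLineCongruence X) :
    IsLineCongruence (PSpace.map (wedge e) '' X) := by
  refine ⟨h.1.image _, ?_⟩
  rintro _ ⟨ω, hω, rfl⟩
  obtain ⟨a, b, hab⟩ := exists_plucker_eq ω.rep_ne_zero (h.2 hω)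
  have h' : plucker (e a) (e b) ≠ 0 := by
    rw [← wedge_plucker, hab]
    exact (wedge e).map_ne_zero_iff.mpr ω.rep_ne_zero
  have := plucker_mem_klein h'
  simpa only [← wedge_plucker, hab, ← PSpace.map_mk _ ω.rep_ne_zero, PSpace.mk_rep] using this

theorem map_symm_rep_mem_iff (W : Submodule ℂ (Fin 4 → ℂ)) (p : PSpace (Fin 4)) :
    (PSpace.map e.symm p).rep ∈ W ↔ p.rep ∈ W.map (e : (Fin 4 → ℂ) →ₗ[ℂ] (Fin 4 → ℂ)) := by
  obtain ⟨k, hk0, hk⟩ := PSpace.exists_rep_map e.symm p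
  rw [hk, W.smul_mem_iff hk0]
  exact (Submodule.mem_map_equiv (e := e) (p := W)).symm

theorem IsLine.image (h : IsLine V) : IsLine (PSpace.map e '' V) := by
  obtain ⟨W, hW, rfl⟩ := h
  refine ⟨W.map (e : (Fin 4 → ℂ) →ₗ[ℂ] (Fin 4 → ℂ)), ?_, ?_⟩
  · rw [← hW]
    exact LinearEquiv.finrank_map_eq e W
  · ext p
    rw [PSpace.mem_image_iff]
    exact map_symm_rep_mem_iff e W p

theorem IsSmoothPlaneConic.image (h : IsSmoothPlaneConic V) :
    IsSmoothPlaneConic (PSpace.map e '' V) := by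
  obtain ⟨W, hW, q, hq, rfl⟩ := h
  let i : W.map (e : (Fin 4 → ℂ) →ₗ[ℂ] (Fin 4 → ℂ)) ≃ₗ[ℂ] W := (e.submoduleMap W).symm
  refine ⟨W.map (e : (Fin 4 → ℂ) →ₗ[ℂ] (Fin 4 → ℂ)), ?_, q.comp i, ?_, ?_⟩
  · rw [← hW]
    exact LinearEquiv.finrank_map_eq e W
  · have : QuadraticMap.polarBilin (q.comp (i : _ →ₗ[ℂ] W)) =
        i.symm.arrowCongr (i.symm.arrowCongr (LinearEquiv.refl ℂ ℂ)) (QuadraticMap.polarBilin q) := by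
      ext x y
      simp [QuadraticMap.polar]
    rw [this]
    exact hq.congr _ _
  · ext p
    rw [PSpace.mem_image_iff]
    obtain ⟨k, hk0, hk⟩ := PSpace.exists_rep_map e.symm p
    have key : ∀ h1 h2, (⟨(PSpace.map e.symm p).rep, h1⟩ : W) = k • i ⟨p.rep, h2⟩ :=
      fun h1 h2 => Subtype.ext hk
    refine ⟨fun ⟨h1, h2⟩ => ⟨(map_symm_rep_mem_iff e W p).mp h1, ?_⟩,
      fun ⟨h1, h2⟩ => ⟨(map_symm_rep_mem_iff e W p).mpr h1, ?_⟩⟩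
    · rw [key h1 ((map_symm_rep_mem_iff e W p).mp h1), QuadraticMap.map_smul, smul_eq_mul] at h2
      exact (mul_eq_zero.mp h2).resolve_left (mul_ne_zero hk0 hk0)
    · rw [key _ h1, QuadraticMap.map_smul]
      exact smul_eq_zero_of_right _ h2

end Transport

/-! ### The congruences of a map in normal form -/

theorem isLine_modelAxis : IsLine modelAxis := by
  refine ⟨Submodule.span ℂ (Set.range ![Pi.single 0 1, Pi.single 3 1]), ?_, ?_⟩
  · rw [finrank_span_eq_card]
    · rfl
    · rw [LinearIndependent.pair_iff]
      intro x y h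
      have h0 := congrFun h 0
      have h3 := congrFun h 3
      simp at h0 h3
      exact ⟨h0, h3⟩
  · ext p
    change p.rep 1 = 0 ∧ p.rep 2 = 0 ↔
      p.rep ∈ Submodule.span ℂ (Set.range ![Pi.single 0 1, Pi.single 3 1])
    rw [Matrix.range_cons, Matrix.range_cons, Matrix.range_empty, Set.union_empty,
      Set.singleton_union, Submodule.mem_span_pair]
    constructor
    · rintro ⟨h1, h2⟩
      refine ⟨p.rep 0, p.rep 3, ?_⟩
      ext i
      fin_cases i <;> simp [h1, h2]
    · rintro ⟨x, y, h⟩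
      rw [← h]
      simp

theorem isSmoothPlaneConic_modelConic : IsSmoothPlaneConic modelConic := by
  let π : Fin 4 → (Fin 4 → ℂ) →ₗ[ℂ] ℂ := fun i => LinearMap.proj i
  let W : Submodule ℂ (Fin 4 → ℂ) := LinearMap.ker (π 3)
  let l : Fin 4 → W →ₗ[ℂ] ℂ := fun i => π i ∘ₗ W.subtype
  let q : QuadraticForm ℂ W := QuadraticMap.linMulLin (l 0) (l 1) +
    QuadraticMap.linMulLin (l 1) (l 2) + QuadraticMap.linMulLin (l 2) (l 0)
  have hq : ∀ v : W, q v = v.1 0 * v.1 1 + v.1 1 * v.1 2 + v.1 2 * v.1 0 := fun v => rfl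
  refine ⟨W, ?_, q, ?_, ?_⟩
  · have h := LinearMap.finrank_range_add_finrank_ker (π 3)
    have hr : LinearMap.range (π 3) = ⊤ := LinearMap.range_eq_top.mpr fun x =>
      ⟨Pi.single 3 x, by simp [π]⟩
    rw [hr, finrank_top, Module.finrank_self, Module.finrank_fin_fun] at h
    change Module.finrank ℂ (LinearMap.ker (π 3)) = 3
    omega
  · have hpol : ∀ v w : W, QuadraticMap.polarBilin q v w = v.1 0 * w.1 1 + v.1 1 * w.1 0 +
        (v.1 1 * w.1 2 + v.1 2 * w.1 1) + (v.1 2 * w.1 0 + v.1 0 * w.1 2) := by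
      intro v w
      rw [QuadraticMap.polarBilin_apply_apply, QuadraticMap.polar, hq, hq, hq]
      simp only [Submodule.coe_add, Pi.add_apply]
      ring
    have hsym : ∀ v w : W, QuadraticMap.polarBilin q v w = QuadraticMap.polarBilin q w v := by
      intro v w
      rw [hpol, hpol]
      ring
    have hsep : (QuadraticMap.polarBilin q).SeparatingLeft := by
      intro v hv
      have hW : ∀ w : Fin 4 → ℂ, w 3 = 0 → w ∈ W := fun w hw => hw
      have e0 := hv ⟨![1, 0, 0, 0], hW _ (by simp)⟩
      have e1 := hv ⟨![0, 1, 0, 0], hW _ (by simp)⟩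
      have e2 := hv ⟨![0, 0, 1, 0], hW _ (by simp)⟩
      rw [hpol] at e0 e1 e2
      simp at e0 e1 e2
      have h3 : v.1 3 = 0 := v.2
      ext i
      fin_cases i
      · change v.1 0 = 0
        linear_combination (e1 + e2 - e0) / 2
      · change v.1 1 = 0
        linear_combination (e0 + e2 - e1) / 2
      · change v.1 2 = 0
        linear_combination (e0 + e1 - e2) / 2
      · exact h3
    exact ⟨hsep, fun w hw => hsep w fun v => (hsym w v).trans (hw v)⟩
  · ext p
    exact ⟨fun ⟨h3, h⟩ => ⟨h3, h⟩, fun ⟨h3, h⟩ => ⟨h3, h⟩⟩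

theorem modelAxis_inter_modelConic : ∃ p, modelAxis ∩ modelConic = {p} := by
  have hne : (![1, 0, 0, 0] : Fin 4 → ℂ) ≠ 0 := fun h => by simpa using congrFun h 0
  refine ⟨PSpace.mk _ hne, Set.Subset.antisymm ?_ ?_⟩
  · rintro p ⟨⟨h1, h2⟩, h3, -⟩
    rw [Set.mem_singleton_iff, ← p.mk_rep, PSpace.mk_eq_mk_iff]
    refine ⟨p.rep 0, ?_⟩
    ext i
    fin_cases i <;> simp [h1, h2, h3]
  · rintro _ rfl
    exact ⟨(mk_mem_modelAxis hne).mpr (by simp), (mk_mem_modelConic hne).mpr (by simp)⟩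

/-- The Zariski closure of the set of lines obtained by fixing the second and the third argument
of a trilinear map. -/
def lineCongruence (a : TriCoeff) : Set (PSpace (Fin 6)) :=
  closure {ω | ∃ (t u : Fin 2 → ℂ)
    (h : plucker (tri a ![1, 0] t u) (tri a ![0, 1] t u) ≠ 0), ω = PSpace.mk _ h}

theorem congruenceS_eq (φ : TrilinearTuple) : congruenceS φ = lineCongruence (coeffs φ.rep) := rfl

theorem congruenceT_eq (φ : TrilinearTuple) :
    congruenceT φ = lineCongruence (swapST (coeffs φ.rep)) := by
  simp only [lineCongruence, tri_swapST]
  rfl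

theorem congruenceU_eq (φ : TrilinearTuple) :
    congruenceU φ = lineCongruence (rotU (coeffs φ.rep)) := by
  simp only [lineCongruence, tri_rotU]
  rfl

theorem plucker_combination (a b : Fin 4 → ℂ) (x y : Fin 2 → ℂ) :
    plucker (x 0 • a + x 1 • b) (y 0 • a + y 1 • b) = det2 x y • plucker a b := by
  ext i
  fin_cases i <;> simp [plucker, det2] <;> ring

/-- In suitable coordinates, the lines of a map in normal form make up the model congruence. -/
theorem CubeValues.lineCongruence_eq {a : TriCoeff} {s₀ s₁ t₀ t₁ u₀ u₁ : Fin 2 → ℂ}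
    {A B₁ B₂ B₃ : Fin 4 → ℂ} (h : CubeValues a s₀ s₁ t₀ t₁ u₀ u₁ A B₁ B₂ B₃ 0)
    (e : (Fin 4 → ℂ) ≃ₗ[ℂ] (Fin 4 → ℂ))
    (he : ∀ v, e v = v 0 • B₁ + v 1 • B₂ + v 2 • B₃ + v 3 • A) :
    lineCongruence a = PSpace.map (wedge e) '' modelCongruence := by
  rw [modelCongruence, (PSpace.map (wedge e)).image_closure, lineCongruence]
  congr 1
  have key : ∀ y z : Fin 2 → ℂ, wedge e (modelPlucker (modelParam y z)) =
      det2 s₀ s₁ • plucker (tri a ![1, 0] (y 0 • t₀ + y 1 • t₁) (z 0 • u₀ + z 1 • u₁))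
        (tri a ![0, 1] (y 0 • t₀ + y 1 • t₁) (z 0 • u₀ + z 1 • u₁)) := by
    intro y z
    have h0 := h.tri_eq ![1, 0] y z
    have h1 := h.tri_eq ![0, 1] y z
    have hs : ∀ (s t u : Fin 2 → ℂ), tri a s t u =
        s 0 • tri a ![1, 0] t u + s 1 • tri a ![0, 1] t u := by
      intro s t u
      funext i
      simp only [tri, Fin.sum_univ_two, Pi.add_apply, Pi.smul_apply, smul_eq_mul,
        Matrix.cons_val_zero, Matrix.cons_val_one]
      ring
    simp only [Matrix.cons_val_zero, Matrix.cons_val_one, one_smul, zero_smul, add_zero,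
      zero_add, one_mul, zero_mul] at h0 h1
    rw [← plucker_combination, ← hs, ← hs, h0, h1, ← modelPlucker_modelParam, wedge_plucker]
    congr 1
    · rw [he]
      simp only [Matrix.cons_val]
      module
    · rw [he]
      simp only [Matrix.cons_val]
      module
  ext ω
  constructor
  · rintro ⟨t, u, hn, rfl⟩
    obtain ⟨y, rfl⟩ := CubeValues.exists_coords h.det_t t
    obtain ⟨z, rfl⟩ := CubeValues.exists_coords h.det_u u
    have hk := key y z
    have hne : modelPlucker (modelParam y z) ≠ 0 := by
      rw [← (wedge e).map_ne_zero_iff, hk]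
      exact smul_ne_zero h.det_s hn
    refine ⟨_, ⟨y, z, hne, rfl⟩, ?_⟩
    rw [PSpace.map_mk, PSpace.mk_eq_mk_iff]
    exact ⟨_, hk.symm⟩
  · rintro ⟨_, ⟨y, z, hne, rfl⟩, rfl⟩
    have hk := key y z
    have hn := (wedge e).map_ne_zero_iff.mpr hne
    rw [hk] at hn
    refine ⟨_, _, (smul_ne_zero_iff.mp hn).2, ?_⟩
    rw [PSpace.map_mk, PSpace.mk_eq_mk_iff]
    exact ⟨_, hk.symm⟩

section Frame

variable (e : (Fin 4 → ℂ) ≃ₗ[ℂ] (Fin 4 → ℂ))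

theorem isQuadratic_image : IsQuadratic (PSpace.map (wedge e) '' modelCongruence) := by
  obtain ⟨p, hp⟩ := modelAxis_inter_modelConic
  refine ⟨isLineCongruence_modelCongruence.image e, PSpace.map e '' modelAxis,
    PSpace.map e '' modelConic, isLine_modelAxis.image e, isSmoothPlaneConic_modelConic.image e,
    isFocal_modelAxis.image e, isFocal_modelConic.image e, ?_⟩
  rw [← Set.image_inter (PSpace.map e).injective, hp]
  exact (Set.singleton_nonempty p).image _

theorem focalCurves_image_modelCongruence :
    focalCurves (PSpace.map (wedge e) '' modelCongruence) =
      {PSpace.map e '' modelAxis, PSpace.map e '' modelConic} := by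
  rw [focalCurves_image, focalCurves_modelCongruence, Set.image_pair]

theorem image_modelAxis_inter_image_modelConic :
    ∃ p, PSpace.map e '' modelAxis ∩ PSpace.map e '' modelConic = {p} := by
  obtain ⟨p, hp⟩ := modelAxis_inter_modelConic
  exact ⟨_, by rw [← Set.image_inter (PSpace.map e).injective, hp, Set.image_singleton]⟩

theorem mem_image_modelAxis {p : PSpace (Fin 4)} :
    p ∈ PSpace.map e '' modelAxis ↔ e.symm p.rep 1 = 0 ∧ e.symm p.rep 2 = 0 := by
  rw [PSpace.mem_image_iff]
  exact mk_mem_modelAxis _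

theorem mem_image_modelConic {p : PSpace (Fin 4)} :
    p ∈ PSpace.map e '' modelConic ↔ e.symm p.rep 3 = 0 ∧ e.symm p.rep 0 * e.symm p.rep 1 +
      e.symm p.rep 1 * e.symm p.rep 2 + e.symm p.rep 2 * e.symm p.rep 0 = 0 := by
  rw [PSpace.mem_image_iff]
  exact mk_mem_modelConic _

end Frame

/-- The linear automorphism of `ℂ⁴` with a given basis as the images of the unit vectors. -/
theorem exists_linearEquiv_of_linearIndependent {b : Fin 4 → Fin 4 → ℂ}
    (hb : LinearIndependent ℂ b) : ∃ e : (Fin 4 → ℂ) ≃ₗ[ℂ] (Fin 4 → ℂ),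
      ∀ v, e v = v 0 • b 0 + v 1 • b 1 + v 2 • b 2 + v 3 • b 3 := by
  let B := basisOfLinearIndependentOfCardEqFinrank hb (by simp)
  refine ⟨B.equivFun.symm, fun v => ?_⟩
  rw [Module.Basis.equivFun_symm_apply, Fin.sum_univ_four]
  simp [B]

end LineCongruence

end

theorem propositionC :
    (LineCongruence.Bir 2 2 2).Nonempty ∧
    ∃ G : Set LineCongruence.TrilinearTuple, IsOpen G ∧
      LineCongruence.Bir 2 2 2 ⊆ closure (G ∩ LineCongruence.Bir 2 2 2) ∧
      ∀ φ ∈ G ∩ LineCongruence.Bir 2 2 2,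
        ∃ x y z c : Set (LineCongruence.PSpace (Fin 4)),
          LineCongruence.IsLine x ∧ LineCongruence.IsLine y ∧ LineCongruence.IsLine z ∧
          x ≠ y ∧ x ≠ z ∧ y ≠ z ∧
          LineCongruence.IsSmoothPlaneConic c ∧
          (∃ P, x ∩ y ∩ z = {P}) ∧
          (∃ p, x ∩ c = {p}) ∧ (∃ p, y ∩ c = {p}) ∧ (∃ p, z ∩ c = {p}) ∧
          LineCongruence.focalCurves (LineCongruence.congruenceS φ) = {x, c} ∧
          LineCongruence.focalCurves (LineCongruence.congruenceT φ) = {y, c} ∧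
          LineCongruence.focalCurves (LineCongruence.congruenceU φ) = {z, c} ∧
          LineCongruence.IsQuadratic (LineCongruence.congruenceS φ) ∧
          LineCongruence.IsQuadratic (LineCongruence.congruenceT φ) ∧
          LineCongruence.IsQuadratic (LineCongruence.congruenceU φ) := by
  open LineCongruence in
  refine ⟨bir_nonempty, generalMaps, isOpen_generalMaps, bir_subset_closure, ?_⟩
  rintro φ ⟨hG, hB⟩
  obtain ⟨s₀, s₁, t₀, t₁, u₀, u₁, A, B₁, B₂, B₃, h, hli⟩ := isNormal_of_mem hG hB
  obtain ⟨e, he⟩ := exists_linearEquiv_of_linearIndependent hli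
  simp only [Matrix.cons_val] at he
  -- The three congruences have the same normal form, up to a permutation of `B₁`, `B₂`, `B₃`.
  let σ : Equiv.Perm (Fin 4) := Equiv.swap 0 1
  let τ : Equiv.Perm (Fin 4) := Equiv.swap 0 2 * Equiv.swap 0 1
  let eT := (LinearEquiv.funCongrLeft ℂ ℂ σ).trans e
  let eU := (LinearEquiv.funCongrLeft ℂ ℂ τ).trans e
  have heT : ∀ v, eT v = v 0 • B₂ + v 1 • B₁ + v 2 • B₃ + v 3 • A := by
    intro v
    change e (v ∘ σ) = _
    rw [he]
    simp [σ, Equiv.swap_apply_of_ne_of_ne]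
    module
  have heU : ∀ v, eU v = v 0 • B₃ + v 1 • B₁ + v 2 • B₂ + v 3 • A := by
    intro v
    change e (v ∘ τ) = _
    rw [he]
    simp [τ, Equiv.swap_apply_of_ne_of_ne]
    module
  have hTs : ∀ v, eT.symm v = ![e.symm v 1, e.symm v 0, e.symm v 2, e.symm v 3] := by
    intro v
    rw [LinearEquiv.symm_apply_eq, heT]
    conv_lhs => rw [← e.apply_symm_apply v, he]
    simp only [Matrix.cons_val]
    module
  have hUs : ∀ v, eU.symm v = ![e.symm v 2, e.symm v 0, e.symm v 1, e.symm v 3] := by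
    intro v
    rw [LinearEquiv.symm_apply_eq, heU]
    conv_lhs => rw [← e.apply_symm_apply v, he]
    simp only [Matrix.cons_val]
    module
  have hcT : PSpace.map eT '' modelConic = PSpace.map e '' modelConic := by
    ext p
    rw [mem_image_modelConic, mem_image_modelConic, hTs]
    simp only [Matrix.cons_val]
    refine and_congr_right fun _ => ?_
    ring_nf
  have hcU : PSpace.map eU '' modelConic = PSpace.map e '' modelConic := by
    ext p
    rw [mem_image_modelConic, mem_image_modelConic, hUs]
    simp only [Matrix.cons_val]
    refine and_congr_right fun _ => ?_
    ring_nf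
  have hS : congruenceS φ = PSpace.map (wedge e) '' modelCongruence := by
    rw [congruenceS_eq]
    exact h.lineCongruence_eq e he
  have hT : congruenceT φ = PSpace.map (wedge eT) '' modelCongruence := by
    rw [congruenceT_eq]
    exact h.swapST.lineCongruence_eq eT heT
  have hU : congruenceU φ = PSpace.map (wedge eU) '' modelCongruence := by
    rw [congruenceU_eq]
    exact h.rotU.lineCongruence_eq eU heU
  have mx : ∀ p : PSpace (Fin 4), p ∈ PSpace.map e '' modelAxis ↔
      e.symm p.rep 1 = 0 ∧ e.symm p.rep 2 = 0 := fun p => mem_image_modelAxis e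
  have my : ∀ p : PSpace (Fin 4), p ∈ PSpace.map eT '' modelAxis ↔
      e.symm p.rep 0 = 0 ∧ e.symm p.rep 2 = 0 := fun p => by
    rw [mem_image_modelAxis, hTs]
    rfl
  have mz : ∀ p : PSpace (Fin 4), p ∈ PSpace.map eU '' modelAxis ↔
      e.symm p.rep 0 = 0 ∧ e.symm p.rep 1 = 0 := fun p => by
    rw [mem_image_modelAxis, hUs]
    rfl
  have hpt : ∀ v : Fin 4 → ℂ, v ≠ 0 → ∃ (p : PSpace (Fin 4)) (k : ℂ), k ≠ 0 ∧
      e.symm p.rep = k • v := by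
    intro v hv
    obtain ⟨k, hk0, hk⟩ := PSpace.exists_rep_mk (e v) (e.map_ne_zero_iff.mpr hv)
    exact ⟨_, k, hk0, by rw [hk, map_smul, e.symm_apply_apply]⟩
  obtain ⟨p, k, hk0, hp⟩ := hpt ![1, 0, 0, 0] fun h => by simpa using congrFun h 0
  obtain ⟨q, l, hl0, hq⟩ := hpt ![0, 1, 0, 0] fun h => by simpa using congrFun h 1
  obtain ⟨P, m, hm0, hP⟩ := hpt ![0, 0, 0, 1] fun h => by simpa using congrFun h 3
  have hxy : PSpace.map e '' modelAxis ≠ PSpace.map eT '' modelAxis := by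
    intro hxy
    have h1 := (mx p).mpr (by simp [hp])
    rw [hxy, my, hp] at h1
    simp [hk0] at h1
  have hxz : PSpace.map e '' modelAxis ≠ PSpace.map eU '' modelAxis := by
    intro hxz
    have h1 := (mx p).mpr (by simp [hp])
    rw [hxz, mz, hp] at h1
    simp [hk0] at h1
  have hyz : PSpace.map eT '' modelAxis ≠ PSpace.map eU '' modelAxis := by
    intro hyz
    have h1 := (my q).mpr (by simp [hq])
    rw [hyz, mz, hq] at h1
    simp [hl0] at h1
  refine ⟨PSpace.map e '' modelAxis, PSpace.map eT '' modelAxis, PSpace.map eU '' modelAxis,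
    PSpace.map e '' modelConic, isLine_modelAxis.image _, isLine_modelAxis.image _,
    isLine_modelAxis.image _, hxy, hxz, hyz, isSmoothPlaneConic_modelConic.image _,
    ⟨P, Set.Subset.antisymm ?_ ?_⟩, image_modelAxis_inter_image_modelConic e, ?_, ?_, ?_, ?_, ?_,
    ?_, ?_, ?_⟩
  · rintro r ⟨⟨hx, hy⟩, -⟩
    rw [mx] at hx
    rw [my] at hy
    rw [Set.mem_singleton_iff, ← r.mk_rep, ← P.mk_rep, PSpace.mk_eq_mk_iff]
    refine ⟨e.symm r.rep 3 / m, e.symm.injective ?_⟩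
    rw [map_smul, hP]
    ext i
    fin_cases i <;> simp [hx, hy, hm0]
  · rintro _ rfl
    refine ⟨⟨?_, ?_⟩, ?_⟩
    · rw [mx, hP]
      simp
    · rw [my, hP]
      simp
    · rw [mz, hP]
      simp
  · rw [← hcT]
    exact image_modelAxis_inter_image_modelConic eT
  · rw [← hcU]
    exact image_modelAxis_inter_image_modelConic eU
  · rw [hS, focalCurves_image_modelCongruence]
  · rw [hT, focalCurves_image_modelCongruence, hcT]
  · rw [hU, focalCurves_image_modelCongruence, hcU]
  · rw [hS]
    exact isQuadratic_image e
  · rw [hT]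
    exact isQuadratic_image eT
  · rw [hU]
    exact isQuadratic_image eU
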